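/- For isometries $f_1,\dots,f_m$ of $\mathbb{R}^3$ generating a group $\Gamma$, let $\mathbb{R}^3/\Gamma$ denote the orbit space. Let $\mathcal{G}_1=\mathbb{R}^3/\mathbb{Z}^3$ be the three-torus; let $\mathcal{G}_2=\mathbb{R}^3/\Gamma_2$ be the half-turn manifold, where $\Gamma_2$ is generated by $(x,y,z)\mapsto(x+1,y,z)$, $(x,y,z)\mapsto(x,y+1,z)$ and $(x,y,z)\mapsto(-x,-y,z+1)$; and let $\mathcal{G}_6=\mathbb{R}^3/\Gamma_6$ be the Hantzsche–Wendt manifold, where $\Gamma_6$ is generated by $$S_1:(x,y,z)\mapsto(x+1,-y,-z+1),\quad S_2:(x,y,z)\mapsto(-x+1,y+1,-z),\quad S_3:(x,y,z)\mapsto(-x,-y+1,z+1).$$ For a positive integer $n$ put $$\sigma_2(n)=\sum_{abc=n}a,\qquad d_3(n)=\sum_{abc=n}1,\qquad \omega(n)=\sum_{abc=n}a^2b,$$ the sums being over ordered triples of positive integers, and let these functions be $0$ at non-integral arguments. Two coverings $p_1:\mathcal{N}_1\to\mathcal{G}_6$ and $p_2:\mathcal{N}_2\to\mathcal{G}_6$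 are equivalent if $p_1=p_2\circ h$ for some homeomorphism $h:\mathcal{N}_1\to\mathcal{N}_2$. For $i\in\{1,2,6\}$ let $c_{\mathcal{G}_i,\mathcal{G}_6}(n)$ be the number of conjugacy classes of subgroups of index $n$ in $\pi_1(\mathcal{G}_6)$ that are isomorphic to $\pi_1(\mathcal{G}_i)$. **Theorem.** Let $n\ge 1$ and let $\mathcal{N}\to\mathcal{G}_6$ be an $n$-fold covering with $\mathcal{N}$ connected. Then $\mathcal{N}$ is homeomorphic to $\mathcal{G}_6$, $\mathcal{G}_2$ or $\mathcal{G}_1$. For $i\in\{1,2,6\}$, the number of equivalence classes of connected $n$-fold coverings of $\mathcal{G}_6$ with total space homeomorphic to $\mathcal{G}_i$ is finite and equals $c_{\mathcal{G}_i,\mathcal{G}_6}(n)$, and (i) $c_{\mathcal{G}_1,\mathcal{G}_6}(n)=\frac14\omega\left(\frac n4\right)+\frac34\sigma_2\left(\frac n4\right)+\frac94\sigma_2\left(\frac n8\right)$; (ii) $c_{\mathcal{G}_2,\mathcal{G}_6}(n)=\frac32\Big(\sigma_2\left(\frac n2\right)+2\sigma_2\left(\frac n4\right)-3\sigma_2\left(\frac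 n8\right)+d_3\left(\frac n2\right)-d_3\left(\frac n4\right)-3d_3\left(\frac n8\right)+5d_3\left(\frac n{16}\right)-2d_3\left(\frac n{32}\right)\Big)$; (iii) $c_{\mathcal{G}_6,\mathcal{G}_6}(n)=d_3(n)-3d_3\left(\frac n2\right)+3d_3\left(\frac n4\right)-d_3\left(\frac n8\right)$, which is also the number of ordered factorizations $n=abc$ into three odd positive factors. -/

import Mathlib

open scoped Pointwise

universe u

namespace HantzscheWendt

noncomputable section

/-! ### Arithmetic functions -/

/-- `σ₀(n)`: the number of factorizations `n = ab` into two positive factors. -/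
def sigma0 (n : ℕ) : ℕ := ∑ _p ∈ n.divisorsAntidiagonal, 1

/-- `σ₁(n) = ∑_{ab = n} a`. -/
def sigma1 (n : ℕ) : ℕ := ∑ p ∈ n.divisorsAntidiagonal, p.1

/-- `σ₂(n) = ∑_{ab = n} σ₁(a) = ∑_{abc = n} a` (this is not the sum of squares of divisors). -/
def sigma2 (n : ℕ) : ℕ := ∑ p ∈ n.divisorsAntidiagonal, sigma1 p.1

/-- `d₃(n) = ∑_{ab = n} σ₀(a) = ∑_{abc = n} 1`. -/
def d3 (n : ℕ) : ℕ := ∑ p ∈ n.divisorsAntidiagonal, sigma0 p.1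

/-- `ω(n) = ∑_{ab = n} a σ₁(a) = ∑_{abc = n} a² b`. -/
def omega (n : ℕ) : ℕ := ∑ p ∈ n.divisorsAntidiagonal, p.1 * sigma1 p.1

/-- The value `f(n / k)` of an arithmetic function, with the convention that it is `0` when
`n / k` is not an integer. -/
def atQuot (f : ℕ → ℕ) (n k : ℕ) : ℚ := if k ∣ n then (f (n / k) : ℚ) else 0

/-! ### Flat manifolds as quotients of Euclidean space -/

/-- Euclidean three-space. -/
abbrev E3 : Type := EuclideanSpace ℝ (Fin 3)

/-- The isometry group of Euclidean space acts on it by evaluation. -/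
instance isometryAction : MulAction (E3 ≃ᵢ E3) E3 where
  smul g v := g v
  one_smul _ := rfl
  mul_smul _ _ _ := rfl

/-- The sign changes by `ε` as an isometry of Euclidean space. -/
def signIsometry (ε : Fin 3 → ℤˣ) : E3 ≃ᵢ E3 where
  toFun v := !₂[((ε 0 : ℤ) : ℝ) * v 0, ((ε 1 : ℤ) : ℝ) * v 1, ((ε 2 : ℤ) : ℝ) * v 2]
  invFun v := !₂[((ε 0 : ℤ) : ℝ) * v 0, ((ε 1 : ℤ) : ℝ) * v 1, ((ε 2 : ℤ) : ℝ) * v 2]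
  left_inv v := by
    have h : ∀ i, ((ε i : ℤ) : ℝ) * ((ε i : ℤ) : ℝ) = 1 := fun i => by
      rcases Int.units_eq_one_or (ε i) with h | h <;> simp [h]
    ext i
    fin_cases i <;> simp [← mul_assoc, h]
  right_inv v := by
    have h : ∀ i, ((ε i : ℤ) : ℝ) * ((ε i : ℤ) : ℝ) = 1 := fun i => by
      rcases Int.units_eq_one_or (ε i) with h | h <;> simp [h]
    ext i
    fin_cases i <;> simp [← mul_assoc, h]
  isometry_toFun := by
    refine Isometry.of_dist_eq fun v w => ?_
    have h : ∀ i, ((ε i : ℤ) : ℝ) ^ 2 = 1 := fun i => by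
      rcases Int.units_eq_one_or (ε i) with h | h <;> simp [h]
    simp [EuclideanSpace.dist_eq, Fin.sum_univ_three, Real.dist_eq, ← mul_sub, mul_pow, h]

/-- The isometry `(x, y, z) ↦ (ε₀ x + t₀, ε₁ y + t₁, ε₂ z + t₂)`, for signs `εᵢ = ±1`. -/
def motion (ε : Fin 3 → ℤˣ) (t : E3) : E3 ≃ᵢ E3 := (signIsometry ε).trans (IsometryEquiv.addRight t)

theorem motion_apply (ε : Fin 3 → ℤˣ) (t v : E3) :
    motion ε t v = !₂[((ε 0 : ℤ) : ℝ) * v 0 + t 0, ((ε 1 : ℤ) : ℝ) * v 1 + t 1,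
      ((ε 2 : ℤ) : ℝ) * v 2 + t 2] := by
  ext i
  fin_cases i <;> simp [motion, signIsometry]

/-- `S₁ : (x, y, z) ↦ (x + 1, -y, -z + 1)`. -/
def S1 : E3 ≃ᵢ E3 := motion ![1, -1, -1] !₂[1, 0, 1]

/-- `S₂ : (x, y, z) ↦ (-x + 1, y + 1, -z)`. -/
def S2 : E3 ≃ᵢ E3 := motion ![-1, 1, -1] !₂[1, 1, 0]

/-- `S₃ : (x, y, z) ↦ (-x, -y + 1, z + 1)`. -/
def S3 : E3 ≃ᵢ E3 := motion ![-1, -1, 1] !₂[0, 1, 1]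

/-- The unit translation along the first axis. -/
def T1 : E3 ≃ᵢ E3 := motion 1 !₂[1, 0, 0]

/-- The unit translation along the second axis. -/
def T2 : E3 ≃ᵢ E3 := motion 1 !₂[0, 1, 0]

/-- The unit translation along the third axis. -/
def T3 : E3 ≃ᵢ E3 := motion 1 !₂[0, 0, 1]

/-- The half-turn screw motion `(x, y, z) ↦ (-x, -y, z + 1)`. -/
def R3 : E3 ≃ᵢ E3 := motion ![-1, -1, 1] !₂[0, 0, 1]

/-- The translation group `ℤ³`. -/
def Gamma1 : Subgroup (E3 ≃ᵢ E3) := Subgroup.closure {T1, T2, T3}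

/-- The Bieberbach group of the half-turn manifold. -/
def Gamma2 : Subgroup (E3 ≃ᵢ E3) := Subgroup.closure {T1, T2, R3}

/-- The Bieberbach group of the Hantzsche–Wendt manifold. -/
def Gamma6 : Subgroup (E3 ≃ᵢ E3) := Subgroup.closure {S1, S2, S3}

/-- The three-torus, with the quotient topology. -/
abbrev G1 : Type := MulAction.orbitRel.Quotient Gamma1 E3

/-- The half-turn manifold, with the quotient topology. -/
abbrev G2 : Type := MulAction.orbitRel.Quotient Gamma2 E3

/-- The Hantzsche–Wendt manifold, with the quotient topology. -/
abbrev G6 : Type := MulAction.orbitRel.Quotient Gamma6 E3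

/-! ### Coverings and their equivalence classes -/

/-- An `n`-fold covering `proj : Space → X` with connected total space. -/
structure FiniteCovering (X : Type) [TopologicalSpace X] (n : ℕ) : Type (u + 1) where
  /-- The total space. -/
  Space : Type u
  [topology : TopologicalSpace Space]
  [connected : ConnectedSpace Space]
  /-- The covering map. -/
  proj : Space → X
  isCoveringMap : IsCoveringMap proj
  card_fiber : ∀ x : X, (proj ⁻¹' {x}).encard = n

attribute [instance] FiniteCovering.topology FiniteCovering.connected

/-- Two coverings `p₁`, `p₂` are equivalent if `p₁ = p₂ ∘ h` for a homeomorphism `h` of the total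
spaces. -/
def FiniteCovering.setoid (X : Type) [TopologicalSpace X] (n : ℕ) :
    Setoid (FiniteCovering.{u} X n) where
  r C D := ∃ h : C.Space ≃ₜ D.Space, C.proj = D.proj ∘ h
  iseqv :=
    { refl := fun C => ⟨Homeomorph.refl C.Space, rfl⟩
      symm := by
        rintro C D ⟨h, e⟩
        refine ⟨h.symm, ?_⟩
        rw [e]
        funext x
        simp
      trans := by
        rintro C D F ⟨h, e⟩ ⟨k, e'⟩
        refine ⟨h.trans k, ?_⟩
        rw [e, e']
        rfl }

/-- The number of equivalence classes of connected `n`-fold coverings of `X` whose total space is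
homeomorphic to `Y`. -/
def numCoverings (Y X : Type) [TopologicalSpace Y] [TopologicalSpace X] (n : ℕ) :
    ℕ∞ :=
  {c : Quotient (FiniteCovering.setoid.{u} X n) |
    ∃ C : FiniteCovering.{u} X n,
      Quotient.mk (FiniteCovering.setoid X n) C = c ∧ Nonempty (C.Space ≃ₜ Y)}.encard

/-- `c_{H,G}(n)`: the number of conjugacy classes of subgroups of index `n` in `G` that are
isomorphic to `H`. The conjugacy classes of subgroups are the orbits of the conjugation action of
`G` on its subgroups. -/
def numConjClasses (H G : Type) [Group H] [Group G] (n : ℕ) : ℕ∞ :=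
  {c : MulAction.orbitRel.Quotient (ConjAct G) (Subgroup G) |
    ∃ K : Subgroup G, Quotient.mk (MulAction.orbitRel (ConjAct G) (Subgroup G)) K = c ∧
      K.index = n ∧ Nonempty (K ≃* H)}.encard

end

end HantzscheWendt

open HantzscheWendt

/-! The problem becomes one about subgroups, then about integral lattices. Euclidean space is simply
connected and the Hantzsche–Wendt group acts on it freely and properly discontinuously. So connected
`n`-fold coverings of the quotient, up to equivalence, correspond to conjugacy classes of subgroups
`K` of index `n`, with total space the quotient by `K` (`numCoverings_eq_encard_classesOf`).

In integer coordinates the group is `HW`: triples `(x, y, z)` with even sum, whose parities also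
determine the linear part. The parities give a surjection onto the Klein four-group whose kernel
consists of the translations by even vectors. The image of `K` under it is trivial, of order two, or
everything (`HW.type_cases`), and these cases give total spaces `G1`, `G2` and `G6` by explicit
affine maps. The types are not isomorphic as groups: for finite index the first is commutative, the
second is noncommutative with nontrivial center, and the third has trivial center. Hence counting by
homeomorphism type, by isomorphism type and by parity image is the same (`HW.counts_eq`).

Torus type: `K` is a sublattice of `ℤ³` of index `n / 4`, and conjugation acts through the four
diagonal sign changes of determinant one. Burnside's lemma gives a quarter of the number `ω` of all
sublattices plus three times the number of those invariant under one half-turn.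

Half-turn type, with `n = 2m`: along a fixed axis, `K` is determined up to conjugation by
translations by an odd height `k`, a planar lattice `M` of index `m / k` and a class modulo `M +
2ℤ²` locating the screw axes. The remaining conjugations act on these data by an involution, so the
number of classes is half of all data plus the fixed data. The three axes contribute equally.

Hantzsche–Wendt type: the least translation lengths along the axes are odd numbers `a`, `b`, `c`,
and a translation conjugates `K` into the standard subgroup `diagSub a b c` of index `abc`
(`HW.IsFull.exists_conj`). So classes correspond to ordered factorizations of `n` into three odd
factors.

Sublattices are enumerated in Hermite normal form (`sum_subs_prod`), and the resulting divisor sums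
are evaluated by Dirichlet convolution with `1` together with the dilation `f(n) ↦ f(n / 2)`. -/

namespace HantzscheWendt

open Topology

/-! ### Coverings of the quotient by a free and properly discontinuous action -/

section Coverings

set_option linter.unusedSectionVars false

variable {E X N : Type*} [TopologicalSpace E] [TopologicalSpace X] [TopologicalSpace N]
  {H : Type*} [Group H] [MulAction H E] {π : E → X} {f : E → N} {p : N → X}

/-- The subgroup of all elements whose action leaves a map invariant. -/
def liftStab (H : Type*) [Group H] [MulAction H E] (f : E → N) : Subgroup H where
  carrier := {h | ∀ e, f (h • e) = f e}
  one_mem' e := by rw [one_smul]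
  mul_mem' {a b} ha hb e := by rw [mul_smul, ha, hb]
  inv_mem' {a} ha e := by rw [← ha (a⁻¹ • e), smul_inv_smul]

theorem isQuotientCoveringMap_quotientMk (hπ : IsQuotientCoveringMap π H) (K : Subgroup H) :
    IsQuotientCoveringMap (Quotient.mk (MulAction.orbitRel K E)) K where
  __ := isQuotientMap_quotient_mk'
  continuous_const_smul g := hπ.continuous_const_smul (g : H)
  apply_eq_iff_mem_orbit := Quotient.eq''
  disjoint e := by
    obtain ⟨U, hU, h⟩ := hπ.disjoint e
    exact ⟨U, hU, fun g hg => Subtype.ext (h g hg)⟩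

/-- Two quotient maps with the same fibers have homeomorphic targets. -/
theorem exists_homeomorph_of_fibers {Y : Type*} [TopologicalSpace Y] {g : E → Y}
    (hf : IsQuotientMap f) (hg : IsQuotientMap g) (h : ∀ a b, f a = f b ↔ g a = g b) :
    ∃ φ : N ≃ₜ Y, φ ∘ f = g := by
  let F : C(E, N) := ⟨f, hf.continuous⟩
  let G : C(E, Y) := ⟨g, hg.continuous⟩
  have hF : IsQuotientMap F := hf
  have hG : IsQuotientMap G := hg
  have h1 : ∀ a, hF.lift G (fun a b hab => (h a b).1 hab) (f a) = g a := fun a =>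
    congrArg (fun k : C(E, Y) => k a) (hF.lift_comp G (fun a b hab => (h a b).1 hab))
  have h2 : ∀ a, hG.lift F (fun a b hab => (h a b).2 hab) (g a) = f a := fun a =>
    congrArg (fun k : C(E, N) => k a) (hG.lift_comp F (fun a b hab => (h a b).2 hab))
  refine ⟨{ toFun := hF.lift G (fun a b hab => (h a b).1 hab)
            invFun := hG.lift F (fun a b hab => (h a b).2 hab)
            left_inv := ?_
            right_inv := ?_
            continuous_toFun := (hF.lift G _).continuous
            continuous_invFun := (hG.lift F _).continuous }, ?_⟩
  · intro x
    obtain ⟨a, rfl⟩ := hf.surjective x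
    rw [h1, h2]
  · intro x
    obtain ⟨a, rfl⟩ := hg.surjective x
    rw [h2, h1]
  · funext a
    exact h1 a

/-- The fiber of `π` through `e` is a copy of `H`, and `f` collapses it along the orbits of `K`. -/
theorem fiber_card (hπ : IsQuotientCoveringMap π H) {K : Subgroup H}
    (hf : Function.Surjective f) (hfK : ∀ a b, f a = f b ↔ ∃ k ∈ K, k • b = a) (hp : p ∘ f = π)
    (x : X) : (p ⁻¹' {x}).encard = ENat.card (H ⧸ K) := by
  obtain ⟨e, rfl⟩ := hπ.surjective x
  have hc := hπ.isCancelSMul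
  have hp' : ∀ a, p (f a) = π a := fun a => congrFun hp a
  -- The inverse matches left cosets `gK` with the orbits of `K`, which acts from the left.
  let F : H → p ⁻¹' {π e} := fun g => ⟨f (g⁻¹ • e), by
    change p (f (g⁻¹ • e)) = π e
    rw [hp', hπ.map_smul]⟩
  have hF : ∀ g g' : H, (QuotientGroup.leftRel K).r g g' → F g = F g' := by
    intro g g' h
    have h : g⁻¹ * g' ∈ K := QuotientGroup.leftRel_apply.1 h
    refine Subtype.ext ((hfK _ _).2 ⟨g⁻¹ * g', h, ?_⟩)
    rw [mul_smul, smul_inv_smul]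
  have hbij : Function.Bijective (Quotient.lift F hF : H ⧸ K → p ⁻¹' {π e}) := by
    constructor
    · rintro ⟨g⟩ ⟨g'⟩ h
      obtain ⟨k, hk, hkg⟩ := (hfK _ _).1 (congrArg Subtype.val h)
      refine Quotient.sound (QuotientGroup.leftRel_apply.2 ?_)
      rw [← mul_smul] at hkg
      have := hc.right_cancel' _ _ _ hkg
      rw [← this, mul_assoc, inv_mul_cancel, mul_one]
      exact hk
    · rintro ⟨y, hy⟩
      obtain ⟨v, rfl⟩ := hf y
      have hy : p (f v) = π e := hy
      rw [hp'] at hy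
      obtain ⟨g, rfl⟩ := hπ.apply_eq_iff_mem_orbit.1 hy
      refine ⟨QuotientGroup.mk g⁻¹, Subtype.ext ?_⟩
      change f (g⁻¹⁻¹ • e) = f (g • e)
      rw [inv_inv]
  exact (ENat.card_congr (Equiv.ofBijective _ hbij)).symm

/-- If the translates of `U` under `H` are disjoint, then `π '' U` is evenly covered. Its sheets are
indexed by `H ⧸ K`: the sheet of a coset is the image under `f` of the sets `g⁻¹ U` for `g` in that
coset. -/
theorem isCoveringMap_of_factor (hπ : IsQuotientCoveringMap π H) {K : Subgroup H}
    (hf : IsOpenQuotientMap f) (hfK : ∀ a b, f a = f b ↔ ∃ k ∈ K, k • b = a) (hp : p ∘ f = π) :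
    IsCoveringMap p := by
  have hc := hπ.isCancelSMul
  have hp' : ∀ a, p (f a) = π a := fun a => congrFun hp a
  have hpq : IsOpenQuotientMap p := hf.of_comp_iff.1 (hp ▸ hπ.isOpenQuotientMap)
  let _ : TopologicalSpace (H ⧸ K) := ⊥
  have : DiscreteTopology (H ⧸ K) := ⟨rfl⟩
  have key : ∀ x, ∃ t : Bundle.Trivialization (H ⧸ K) p, x ∈ t.baseSet := by
    intro x
    obtain ⟨e, rfl⟩ := hπ.surjective x
    obtain ⟨U', hU', hdisj'⟩ := hπ.disjoint e
    obtain ⟨U, hUU', hU, heU⟩ := mem_nhds_iff.1 hU'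
    have hdisj : ∀ u ∈ U, ∀ u' ∈ U, π u = π u' → u = u' := by
      intro u hu u' hu' h
      obtain ⟨g, rfl⟩ := hπ.apply_eq_iff_mem_orbit.1 h
      rw [show g = 1 from hdisj' g ⟨g • u', ⟨u', hUU' hu', rfl⟩, hUU' hu⟩]
      exact one_smul H u'
    have : Nonempty (X → N) := ⟨fun _ => f e⟩
    have hpi : ∀ (g : H) u, p (f (g⁻¹ • u)) = π u := fun g u => by rw [hp', hπ.map_smul]
    let V : H ⧸ K → Set N := fun i => {n | ∃ g : H, QuotientGroup.mk g = i ∧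
      ∃ u ∈ U, f (g⁻¹ • u) = n}
    have hVo : ∀ i, IsOpen (V i) := by
      intro i
      have : V i = ⋃ g : {g : H // QuotientGroup.mk g = i}, f '' ((g.1 • ·) ⁻¹' U) := by
        ext n
        simp only [V, Set.mem_ofPred_eq, Set.mem_iUnion, Set.mem_image, Set.mem_preimage,
          Subtype.exists, exists_prop]
        refine exists_congr fun g => and_congr_right fun _ => ⟨?_, ?_⟩
        · rintro ⟨u, hu, rfl⟩
          exact ⟨_, by rwa [smul_inv_smul], rfl⟩
        · rintro ⟨v, hv, rfl⟩
          exact ⟨_, hv, by rw [inv_smul_smul]⟩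
      rw [this]
      exact isOpen_iUnion fun g =>
        hf.isOpenMap _ (hU.preimage (hπ.continuous_const_smul (g : H)))
    have hsurj : ∀ i, (V i).SurjOn p (π '' U) := by
      rintro ⟨g⟩ _ ⟨u, hu, rfl⟩
      exact ⟨f (g⁻¹ • u), ⟨g, rfl, u, hu, rfl⟩, hpi g u⟩
    refine ⟨IsOpen.trivializationDiscrete V (π '' U)
      (hπ.isOpenQuotientMap.isOpenMap _ hU) (fun i W hW => ⟨fun hWo =>
        (hWo.preimage hpq.continuous).inter (hVo i), fun h => ?_⟩) ?_ hsurj ?_ ?_, e, heU, rfl⟩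
    · have : W = p '' (p ⁻¹' W ∩ V i) := by
        ext w
        constructor
        · intro hw
          obtain ⟨n, hn, rfl⟩ := hsurj i (hW hw)
          exact ⟨n, ⟨hw, hn⟩, rfl⟩
        · rintro ⟨n, ⟨hn, -⟩, rfl⟩
          exact hn
      rw [this]
      exact hpq.isOpenMap _ h
    · rintro i _ ⟨g, hg, u, hu, rfl⟩ _ ⟨g', hg', u', hu', rfl⟩ h
      rw [hpi, hpi] at h
      obtain rfl := hdisj u hu u' hu' h
      refine (hfK _ _).2 ⟨g⁻¹ * g', QuotientGroup.eq.1 (hg.trans hg'.symm), ?_⟩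
      rw [mul_smul, smul_inv_smul]
    · intro i j hij
      refine Set.disjoint_left.2 ?_
      rintro _ ⟨g, hg, u, hu, rfl⟩ ⟨g', hg', u', hu', h⟩
      have h2 := congrArg p h
      rw [hpi, hpi] at h2
      obtain rfl := hdisj u' hu' u hu h2
      obtain ⟨k, hk, hkg⟩ := (hfK _ _).1 h.symm
      rw [← mul_smul] at hkg
      have := hc.right_cancel' _ _ _ hkg
      refine hij (hg.symm.trans (Eq.trans (QuotientGroup.eq.2 ?_) hg'))
      rw [← this, mul_assoc, inv_mul_cancel, mul_one]
      exact hk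
    · intro n hn
      obtain ⟨v, rfl⟩ := hf.surjective n
      obtain ⟨u, hu, hun⟩ := hn
      rw [hp'] at hun
      obtain ⟨g, rfl⟩ := hπ.apply_eq_iff_mem_orbit.1 hun.symm
      refine Set.mem_iUnion.2 ⟨QuotientGroup.mk g⁻¹, g⁻¹, rfl, u, hu, ?_⟩
      rw [inv_inv]
  choose t ht using key
  exact IsCoveringMap.mk _ (fun _ => H ⧸ K) t ht

/-! ### Lifts of the universal covering -/

theorem exists_lift [SimplyConnectedSpace E] [LocallyPathConnectedSpace E]
    (hπ : IsQuotientCoveringMap π H) (hp : IsCoveringMap p) {e : E} {n : N} (h : p n = π e) :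
    ∃ f : E → N, Continuous f ∧ p ∘ f = π ∧ f e = n := by
  obtain ⟨F, ⟨h1, h2⟩, -⟩ :=
    hp.existsUnique_continuousMap_lifts (⟨π, hπ.continuous⟩ : C(E, X)) e n h
  exact ⟨F, F.continuous, h2, h1⟩

/-- Uniqueness of lifts: if `f (k • w) = f w`, then `f` and `f (k • ·)` lift the same map and agree
at `w`, so they agree everywhere and `k` stabilizes `f`. -/
theorem lift_fibers [PreconnectedSpace E] (hπ : IsQuotientCoveringMap π H)
    (hp : IsCoveringMap p) (hf : Continuous f) (hpf : p ∘ f = π) (v w : E) :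
    f v = f w ↔ ∃ k ∈ liftStab H f, k • w = v := by
  constructor
  · intro h
    have h2 : π v = π w := by rw [← hpf, Function.comp_apply, h, Function.comp_apply]
    obtain ⟨k, rfl⟩ := hπ.apply_eq_iff_mem_orbit.1 h2
    refine ⟨k, fun e => ?_, rfl⟩
    refine congrFun (hp.eq_of_comp_eq (hf.comp (hπ.continuous_const_smul k)) hf ?_ w h) e
    funext x
    have := congrFun hpf
    simp only [Function.comp_apply] at this ⊢
    rw [this, this, hπ.map_smul]
  · rintro ⟨k, hk, rfl⟩
    exact hk w

theorem lift_isOpenMap (hπ : IsQuotientCoveringMap π H)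
    (hp : IsCoveringMap p) (hf : Continuous f) (hpf : p ∘ f = π) : IsOpenMap f :=
  (IsLocalHomeomorph.of_comp (hpf ▸ hπ.isCoveringMap.isLocalHomeomorph)
    hp.isLocalHomeomorph hf).isOpenMap

/-- Two lifts of the universal covering differ by an element of the group as soon as their images
meet. -/
theorem exists_smul_of_lifts [PreconnectedSpace E] (hπ : IsQuotientCoveringMap π H)
    (hp : IsCoveringMap p) {g : E → N} (hf : Continuous f) (hpf : p ∘ f = π)
    (hg : Continuous g) (hpg : p ∘ g = π) {v w : E} (h : f v = g w) :
    ∃ k : H, ∀ e, f e = g (k • e) := by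
  have hf' := congrFun hpf
  have hg' := congrFun hpg
  simp only [Function.comp_apply] at hf' hg'
  have h2 : π w = π v := by rw [← hg', ← h, hf']
  obtain ⟨k, rfl⟩ := hπ.apply_eq_iff_mem_orbit.1 h2
  refine ⟨k, fun e => congrFun (hp.eq_of_comp_eq hf
    (hg.comp (hπ.continuous_const_smul k)) ?_ v h) e⟩
  funext x
  simp only [Function.comp_apply]
  rw [hf', hg', hπ.map_smul]

/-- The range is open, and so is its complement: a missed point lies in the open range of another
lift, and lifts whose images meet have the same range, since they differ by an element of `H`. -/
theorem lift_surjective [SimplyConnectedSpace E] [LocallyPathConnectedSpace E] [ConnectedSpace N]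
    (hπ : IsQuotientCoveringMap π H) (hp : IsCoveringMap p) (hf : Continuous f)
    (hpf : p ∘ f = π) : Function.Surjective f := by
  have hcl : IsClopen (Set.range f) := by
    refine ⟨⟨?_⟩, (lift_isOpenMap hπ hp hf hpf).isOpen_range⟩
    refine isOpen_iff_forall_mem_open.2 fun n hn => ?_
    obtain ⟨e, he⟩ := hπ.surjective (p n)
    obtain ⟨g, hg, hpg, rfl⟩ := exists_lift hπ hp he.symm
    refine ⟨Set.range g, ?_, (lift_isOpenMap hπ hp hg hpg).isOpen_range, e, rfl⟩
    rintro _ ⟨w, rfl⟩ ⟨v, hv⟩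
    obtain ⟨k, hk⟩ := exists_smul_of_lifts hπ hp hg hpg hf hpf hv.symm
    exact hn ⟨k • e, (hk e).symm⟩
  have hne : Nonempty E := inferInstance
  have := hcl.eq_univ ⟨f hne.some, ⟨_, rfl⟩⟩
  exact Set.range_eq_univ.1 this

theorem lift_isOpenQuotientMap [SimplyConnectedSpace E] [LocallyPathConnectedSpace E]
    [ConnectedSpace N] (hπ : IsQuotientCoveringMap π H) (hp : IsCoveringMap p)
    (hf : Continuous f) (hpf : p ∘ f = π) : IsOpenQuotientMap f :=
  ⟨lift_surjective hπ hp hf hpf, hf, lift_isOpenMap hπ hp hf hpf⟩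

/-- This is why a covering determines a conjugacy class of subgroups rather than a subgroup: another
choice of lift conjugates the stabilizer. -/
theorem liftStab_comp_smul (g : E → N) (k : H) :
    liftStab H (fun e => g (k • e)) = (ConjAct.toConjAct k)⁻¹ • liftStab H g := by
  ext h
  rw [Subgroup.mem_inv_pointwise_smul_iff, ConjAct.toConjAct_smul]
  constructor
  · intro hh e
    have : g (k • h • k⁻¹ • e) = g (k • k⁻¹ • e) := hh (k⁻¹ • e)
    rw [smul_inv_smul] at this
    rw [mul_smul, mul_smul, this]
  · intro hh e
    have := hh (k • e)
    rwa [mul_smul, mul_smul, inv_smul_smul] at this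

theorem quotientMk_eq_iff (K : Subgroup H) (v w : E) :
    (Quotient.mk (MulAction.orbitRel K E) v = Quotient.mk (MulAction.orbitRel K E) w) ↔
      ∃ k ∈ K, k • w = v := by
  rw [Quotient.eq]
  change v ∈ MulAction.orbit K w ↔ _
  constructor
  · rintro ⟨k, rfl⟩
    exact ⟨k, k.2, rfl⟩
  · rintro ⟨k, hk, rfl⟩
    exact ⟨⟨k, hk⟩, rfl⟩

theorem liftStab_of_fibers (hπ : IsQuotientCoveringMap π H) [Nonempty E] {K : Subgroup H}
    (hfK : ∀ a b, f a = f b ↔ ∃ k ∈ K, k • b = a) : liftStab H f = K := by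
  have hc := hπ.isCancelSMul
  ext h
  constructor
  · intro hh
    let e : E := Classical.arbitrary E
    obtain ⟨k, hk, hke⟩ := (hfK _ _).1 (hh e)
    rwa [← hc.right_cancel' _ _ _ hke]
  · intro hh e
    exact (hfK _ _).2 ⟨h, hh, rfl⟩

end Coverings

/-! ### Conjugacy classes of subgroups -/

/-- The conjugacy classes of the subgroups satisfying a predicate. -/
def classesOf {H : Type*} [Group H] (P : Subgroup H → Prop) :
    Set (MulAction.orbitRel.Quotient (ConjAct H) (Subgroup H)) :=
  {c | ∃ K, Quotient.mk (MulAction.orbitRel (ConjAct H) (Subgroup H)) K = c ∧ P K}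

theorem conjClass_eq_iff {H : Type*} [Group H] (K L : Subgroup H) :
    (Quotient.mk (MulAction.orbitRel (ConjAct H) (Subgroup H)) K =
      Quotient.mk (MulAction.orbitRel (ConjAct H) (Subgroup H)) L) ↔
      ∃ h : H, ConjAct.toConjAct h • L = K := by
  rw [Quotient.eq]
  rfl

/-- The counting principle behind all three formulas: `F` is a complete invariant of conjugacy among
the subgroups with `P`, and `T` is its set of values. -/
theorem encard_classesOf {H : Type*} [Group H] {P : Subgroup H → Prop} {β : Type*} {T : Set β}
    (F : Subgroup H → β) (hF : ∀ K, P K → F K ∈ T) (hT : ∀ t ∈ T, ∃ K, P K ∧ F K = t)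
    (hFF : ∀ K L, P K → P L → (F K = F L ↔ ∃ h : H, ConjAct.toConjAct h • L = K)) :
    (classesOf P).encard = T.encard := by
  classical
  choose! S hS using hT
  have : classesOf P =
      (fun t => Quotient.mk (MulAction.orbitRel (ConjAct H) (Subgroup H)) (S t)) '' T := by
    ext c
    constructor
    · rintro ⟨K, rfl, hK⟩
      refine ⟨F K, hF K hK, ?_⟩
      have := hS (F K) (hF K hK)
      exact (conjClass_eq_iff _ _).2 ((hFF _ _ this.1 hK).1 this.2)
    · rintro ⟨t, ht, rfl⟩
      exact ⟨S t, rfl, (hS t ht).1⟩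
  rw [this]
  refine Set.InjOn.encard_image fun t ht s hs hts => ?_
  have := (hFF _ _ (hS t ht).1 (hS s hs).1).2 ((conjClass_eq_iff _ _).1 hts)
  rwa [(hS t ht).2, (hS s hs).2] at this

/-! ### Classification of the coverings -/

section Classification

set_option linter.unusedSectionVars false

variable {E X : Type} [TopologicalSpace E] [TopologicalSpace X] [SimplyConnectedSpace E]
  [LocallyPathConnectedSpace E] {H : Type} [Group H] [MulAction H E] {π : E → X} {n : ℕ}

theorem index_liftStab (hπ : IsQuotientCoveringMap π H) (C : FiniteCovering.{u} X n)
    {f : E → C.Space} (hf : Continuous f) (hpf : C.proj ∘ f = π) : (liftStab H f).index = n := by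
  obtain ⟨e⟩ : Nonempty E := inferInstance
  have := fiber_card hπ (lift_surjective hπ C.isCoveringMap hf hpf)
    (lift_fibers hπ C.isCoveringMap hf hpf) hpf (π e)
  rw [C.card_fiber] at this
  have hfin : Finite (H ⧸ liftStab H f) :=
    ENat.card_lt_top.1 (this ▸ ENat.natCast_lt_top n)
  rw [ENat.card_eq_coe_natCard] at this
  exact (ENat.natCast_inj.1 this).symm

theorem exists_homeomorph_quotient (hπ : IsQuotientCoveringMap π H)
    (C : FiniteCovering.{u} X n) {f : E → C.Space} (hf : Continuous f) (hpf : C.proj ∘ f = π) :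
    Nonempty (C.Space ≃ₜ MulAction.orbitRel.Quotient (liftStab H f) E) := by
  obtain ⟨φ, -⟩ := exists_homeomorph_of_fibers
    (lift_isOpenQuotientMap hπ C.isCoveringMap hf hpf).isQuotientMap
    (isQuotientCoveringMap_quotientMk hπ (liftStab H f)).toIsQuotientMap fun a b => by
      rw [quotientMk_eq_iff, lift_fibers hπ C.isCoveringMap hf hpf]
  exact ⟨φ⟩

/-- An equivalence carries `f` to another lift into `D`, which differs from `g` by an element of
`H`. Conversely, after replacing `g` by a translate the two lifts have the same fibers, and both are
quotient maps. -/
theorem covering_equiv_iff (hπ : IsQuotientCoveringMap π H) (C D : FiniteCovering.{u} X n)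
    {f : E → C.Space} (hf : Continuous f) (hpf : C.proj ∘ f = π)
    {g : E → D.Space} (hg : Continuous g) (hpg : D.proj ∘ g = π) :
    (∃ h : C.Space ≃ₜ D.Space, C.proj = D.proj ∘ h) ↔
      ∃ k : H, ConjAct.toConjAct k • liftStab H g = liftStab H f := by
  constructor
  · rintro ⟨h, hh⟩
    obtain ⟨e⟩ : Nonempty E := inferInstance
    have hph : D.proj ∘ (h ∘ f) = π := by rw [← Function.comp_assoc, ← hh, hpf]
    obtain ⟨w, hw⟩ := lift_surjective hπ D.isCoveringMap hg hpg (h (f e))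
    obtain ⟨k, hk⟩ := exists_smul_of_lifts hπ D.isCoveringMap (h.continuous.comp hf) hph hg hpg
      (v := e) (w := w) hw.symm
    refine ⟨k⁻¹, ?_⟩
    rw [ConjAct.toConjAct_inv, ← liftStab_comp_smul]
    ext x
    refine forall_congr' fun e => ?_
    change g (k • x • e) = g (k • e) ↔ _
    rw [← hk, ← hk]
    exact h.injective.eq_iff
  · rintro ⟨k, hk⟩
    have hgk : Continuous fun e => g (k⁻¹ • e) := hg.comp (hπ.continuous_const_smul k⁻¹)
    have hpgk : D.proj ∘ (fun e => g (k⁻¹ • e)) = π := by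
      funext e
      have := congrFun hpg (k⁻¹ • e)
      simp only [Function.comp_apply] at this ⊢
      rw [this, hπ.map_smul]
    obtain ⟨φ, hφ⟩ := exists_homeomorph_of_fibers
      (lift_isOpenQuotientMap hπ C.isCoveringMap hf hpf).isQuotientMap
      (lift_isOpenQuotientMap hπ D.isCoveringMap hgk hpgk).isQuotientMap fun a b => by
        rw [lift_fibers hπ C.isCoveringMap hf hpf, lift_fibers hπ D.isCoveringMap hgk hpgk,
          liftStab_comp_smul, ConjAct.toConjAct_inv, inv_inv, hk]
    refine ⟨φ, ?_⟩
    funext y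
    obtain ⟨e, rfl⟩ := lift_surjective hπ C.isCoveringMap hf hpf y
    have h1 := congrFun hpf e
    have h2 := congrFun hpgk e
    rw [← hφ] at h2
    exact h1.trans h2.symm

theorem exists_covering (hπ : IsQuotientCoveringMap π H) (hn : n ≠ 0) {K : Subgroup H}
    (hK : K.index = n) : ∃ (C : FiniteCovering.{u} X n) (f : E → C.Space), Continuous f ∧
      C.proj ∘ f = π ∧ liftStab H f = K := by
  let q : E → MulAction.orbitRel.Quotient K E := Quotient.mk (MulAction.orbitRel K E)
  have hq : IsQuotientCoveringMap q K := isQuotientCoveringMap_quotientMk hπ K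
  let p : MulAction.orbitRel.Quotient K E → X := Quotient.lift π fun a b hab => by
    obtain ⟨k, rfl⟩ := MulAction.orbitRel_apply.1 hab
    exact hπ.map_smul (k : H)
  have hpq : p ∘ q = π := rfl
  have hfib := quotientMk_eq_iff (E := E) K
  have hp := isCoveringMap_of_factor hπ hq.isOpenQuotientMap hfib hpq
  have hconn : ConnectedSpace (MulAction.orbitRel.Quotient K E) :=
    hq.surjective.connectedSpace hq.continuous
  have hcard := fiber_card hπ hq.surjective hfib hpq
  have hfin : ENat.card (H ⧸ K) = n := by
    have : Finite (H ⧸ K) := Nat.finite_of_card_ne_zero (hK.trans_ne hn)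
    rw [← hK, Subgroup.index, ENat.card_eq_coe_natCard]
  -- The quotient lives in the lowest universe, so `ULift` moves it to the universe of the coverings
  -- being counted.
  refine ⟨{ Space := ULift.{u} (MulAction.orbitRel.Quotient K E)
            connected := Homeomorph.ulift.symm.surjective.connectedSpace
              Homeomorph.ulift.symm.continuous
            proj := p ∘ Homeomorph.ulift
            isCoveringMap := hp.comp_homeomorph _
            card_fiber := fun x => ?_ }, Homeomorph.ulift.symm ∘ q,
          Homeomorph.ulift.symm.continuous.comp hq.continuous, ?_, ?_⟩
  · rw [← hfin, ← hcard x, Set.preimage_comp]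
    exact Set.encard_preimage_of_bijective Homeomorph.ulift.bijective _
  · exact hpq
  · refine liftStab_of_fibers hπ fun a b => ?_
    rw [← hfib]
    exact Homeomorph.ulift.symm.injective.eq_iff

/-- A lift is chosen for every covering. The conjugacy class of its stabilizer is an injective
function of the equivalence class of the covering, and every subgroup of index `n` is realized by
its own quotient. -/
theorem numCoverings_eq_encard_classesOf (hπ : IsQuotientCoveringMap π H) (hn : n ≠ 0)
    (Y : Type) [TopologicalSpace Y] :
    numCoverings.{u} Y X n = (classesOf fun K : Subgroup H =>
      K.index = n ∧ Nonempty (MulAction.orbitRel.Quotient K E ≃ₜ Y)).encard := by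
  have hl : ∀ C : FiniteCovering.{u} X n, ∃ f : E → C.Space, Continuous f ∧ C.proj ∘ f = π := by
    intro C
    obtain ⟨y⟩ : Nonempty C.Space := inferInstance
    obtain ⟨e, he⟩ := hπ.surjective (C.proj y)
    obtain ⟨f, hf, hpf, -⟩ := exists_lift hπ C.isCoveringMap he.symm
    exact ⟨f, hf, hpf⟩
  choose f hf hpf using hl
  let cls (C : FiniteCovering.{u} X n) : MulAction.orbitRel.Quotient (ConjAct H) (Subgroup H) :=
    Quotient.mk _ (liftStab H (f C))
  have hcls : ∀ C D, cls C = cls D ↔ (FiniteCovering.setoid X n).r C D := fun C D => by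
    rw [conjClass_eq_iff]
    exact (covering_equiv_iff hπ C D (hf C) (hpf C) (hf D) (hpf D)).symm
  let F : Quotient (FiniteCovering.setoid.{u} X n) →
      MulAction.orbitRel.Quotient (ConjAct H) (Subgroup H) :=
    Quotient.lift cls fun C D h => (hcls C D).2 h
  have hF : Function.Injective F := by
    rintro ⟨C⟩ ⟨D⟩ h
    exact Quotient.sound ((hcls C D).1 h)
  rw [numCoverings, ← hF.encard_image]
  congr 1
  ext c
  constructor
  · rintro ⟨_, ⟨C, rfl, ⟨φ⟩⟩, rfl⟩
    obtain ⟨ψ⟩ := exists_homeomorph_quotient hπ C (hf C) (hpf C)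
    exact ⟨liftStab H (f C), rfl, index_liftStab hπ C (hf C) (hpf C), ⟨ψ.symm.trans φ⟩⟩
  · rintro ⟨K, rfl, hK, ⟨φ⟩⟩
    obtain ⟨C, g, hg, hpg, rfl⟩ := exists_covering.{u} hπ hn hK
    obtain ⟨ψ⟩ := exists_homeomorph_quotient hπ C hg hpg
    refine ⟨Quotient.mk _ C, ⟨C, rfl, ⟨ψ.trans φ⟩⟩, ?_⟩
    exact (conjClass_eq_iff _ _).2
      ((covering_equiv_iff hπ C C (hf C) (hpf C) hg hpg).1 ⟨Homeomorph.refl _, rfl⟩)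

theorem exists_homeomorph_quotient_of_covering (hπ : IsQuotientCoveringMap π H)
    (C : FiniteCovering.{u} X n) : ∃ K : Subgroup H, K.index = n ∧
      Nonempty (C.Space ≃ₜ MulAction.orbitRel.Quotient K E) := by
  obtain ⟨y⟩ : Nonempty C.Space := inferInstance
  obtain ⟨e, he⟩ := hπ.surjective (C.proj y)
  obtain ⟨f, hf, hpf, -⟩ := exists_lift hπ C.isCoveringMap he.symm
  exact ⟨liftStab H f, index_liftStab hπ C hf hpf, exists_homeomorph_quotient hπ C hf hpf⟩

/-- The fundamental group of the quotient by a free properly discontinuous action. -/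
theorem nonempty_fundamentalGroup_mulEquiv (hπ : IsQuotientCoveringMap π H) (x : X) :
    Nonempty (FundamentalGroup X x ≃* H) := by
  obtain ⟨e, he⟩ := hπ.surjective x
  -- Lifting loops yields the opposite group of `H`, which inversion identifies with `H`.
  exact ⟨(hπ.fundamentalGroupEquiv ⟨e, he⟩).trans (MulEquiv.inv' H).symm⟩

end Classification

/-- Conjugacy class counts are invariant under isomorphisms. -/
theorem numConjClasses_eq_encard_classesOf {H G A B : Type} [Group H] [Group G] [Group A]
    [Group B] (e : H ≃* A) (g : G ≃* B) (n : ℕ) :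
    numConjClasses H G n = (classesOf fun K : Subgroup B =>
      K.index = n ∧ Nonempty (K ≃* A)).encard := by
  have hsmul : ∀ (h : G) (L : Subgroup G),
      (ConjAct.toConjAct h • L).map g.toMonoidHom =
        ConjAct.toConjAct (g h) • L.map g.toMonoidHom := by
    intro h L
    ext x
    constructor
    · rintro ⟨_, ⟨l, hl, rfl⟩, rfl⟩
      refine ⟨g l, ⟨l, hl, rfl⟩, ?_⟩
      simp [ConjAct.smul_def]
    · rintro ⟨_, ⟨l, hl, rfl⟩, rfl⟩
      refine ⟨ConjAct.toConjAct h • l, ⟨l, hl, rfl⟩, ?_⟩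
      simp [ConjAct.smul_def]
  have hinj : Function.Injective fun K : Subgroup G => K.map g.toMonoidHom :=
    Subgroup.map_injective g.injective
  refine encard_classesOf (P := fun K : Subgroup G => K.index = n ∧ Nonempty (K ≃* H))
    (fun K => Quotient.mk _ (K.map g.toMonoidHom)) ?_ ?_ ?_
  · rintro K ⟨hK, ⟨φ⟩⟩
    refine ⟨_, rfl, ?_, ⟨(K.equivMapOfInjective g.toMonoidHom g.injective).symm.trans
      (φ.trans e)⟩⟩
    rw [← hK]
    exact Subgroup.index_map_of_bijective g.bijective K
  · rintro _ ⟨K, rfl, hK, ⟨φ⟩⟩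
    have hm : (K.comap g.toMonoidHom).map g.toMonoidHom = K :=
      Subgroup.map_comap_eq_self_of_surjective g.surjective K
    refine ⟨K.comap g.toMonoidHom, ⟨?_, ?_⟩, by rw [hm]⟩
    · rw [← hK]
      exact Subgroup.index_comap_of_surjective K g.surjective
    · have := (K.comap g.toMonoidHom).equivMapOfInjective g.toMonoidHom g.injective
      rw [hm] at this
      exact ⟨this.trans (φ.trans e.symm)⟩
  · intro K L _ _
    rw [conjClass_eq_iff]
    constructor
    · rintro ⟨h, hh⟩
      refine ⟨g.symm h, hinj ?_⟩
      change (_ : Subgroup G).map _ = _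
      rw [hsmul, g.apply_symm_apply, hh]
    · rintro ⟨h, rfl⟩
      exact ⟨g h, (hsmul h L).symm⟩

/-! ### Subgroups of finite index in a product with the integers -/

section Build

variable {A : Type*} [AddCommGroup A]

/-- The subgroup of `ℤ × A` generated by `(a, v)` and `0 × M`. -/
def build (a : ℕ) (M : AddSubgroup A) (v : A) : AddSubgroup (ℤ × A) where
  carrier := {p | ∃ i : ℤ, p.1 = i * a ∧ p.2 - i • v ∈ M}
  zero_mem' := ⟨0, by simp, by simp⟩
  add_mem' := by
    rintro p q ⟨i, hi, hi'⟩ ⟨j, hj, hj'⟩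
    refine ⟨i + j, by rw [Prod.fst_add, hi, hj, add_mul], ?_⟩
    have := M.add_mem hi' hj'
    rw [Prod.snd_add, add_smul]
    convert this using 1
    abel
  neg_mem' := by
    rintro p ⟨i, hi, hi'⟩
    refine ⟨-i, by rw [Prod.fst_neg, hi, neg_mul], ?_⟩
    have := M.neg_mem hi'
    rw [Prod.snd_neg, neg_smul]
    convert this using 1
    abel

theorem mem_build {a : ℕ} {M : AddSubgroup A} {v : A} {p : ℤ × A} :
    p ∈ build a M v ↔ ∃ i : ℤ, p.1 = i * a ∧ p.2 - i • v ∈ M := Iff.rfl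

theorem zero_mem_build_iff {a : ℕ} (ha : a ≠ 0) {M : AddSubgroup A} {v y : A} :
    ((0 : ℤ), y) ∈ build a M v ↔ y ∈ M := by
  rw [mem_build]
  constructor
  · rintro ⟨i, hi, hy⟩
    have : i = 0 := by
      rcases mul_eq_zero.1 hi.symm with h | h
      · exact h
      · exact absurd (Int.natCast_eq_zero.1 h) ha
    simpa [this] using hy
  · intro h
    exact ⟨0, by simp, by simpa using h⟩

/-- With `N` the kernel of the projection to `ℤ`, the index factors through `L + N`: the upper step
is seen in the projection of `L`, the lower one in `L ∩ N`. -/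
theorem index_eq_mul_of_prod (L : AddSubgroup (ℤ × A)) :
    L.index = (L.map (AddMonoidHom.fst ℤ A)).index * (L.comap (AddMonoidHom.inr ℤ A)).index := by
  have h1 : L.relIndex (AddMonoidHom.fst ℤ A).ker = (L.comap (AddMonoidHom.inr ℤ A)).index := by
    rw [AddSubgroup.index_comap]
    congr 1
    ext ⟨x, y⟩
    simp [AddSubgroup.mem_prod, AddMonoidHom.mem_range, eq_comm]
  rw [AddSubgroup.index_map, ← h1,
    AddMonoidHom.range_eq_top_of_surjective _ (fun x => ⟨(x, 0), rfl⟩), AddSubgroup.index_top,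
    mul_one, ← AddSubgroup.relIndex_sup_right (H := (AddMonoidHom.fst ℤ A).ker) (K := L),
    sup_comm L, mul_comm, AddSubgroup.relIndex_mul_index le_sup_right]

theorem index_build {a : ℕ} (ha : a ≠ 0) (M : AddSubgroup A) (v : A) :
    (build a M v).index = a * M.index := by
  rw [index_eq_mul_of_prod]
  congr 1
  · have : (build a M v).map (AddMonoidHom.fst ℤ A) = AddSubgroup.zmultiples (a : ℤ) := by
      ext x
      rw [AddSubgroup.mem_zmultiples_iff]
      constructor
      · rintro ⟨p, ⟨i, hi, -⟩, rfl⟩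
        exact ⟨i, by simpa using hi.symm⟩
      · rintro ⟨i, rfl⟩
        exact ⟨(i * a, i • v), ⟨i, rfl, by simp⟩, by simp⟩
    rw [this, Int.index_zmultiples, Int.natAbs_natCast]
  · congr 1
    ext y
    exact zero_mem_build_iff ha

/-- Thus subgroups of finite index correspond to a positive `a`, a subgroup `M` and a class `v` in
`A ⧸ M`. -/
theorem build_eq_build_iff {a a' : ℕ} (ha : a ≠ 0) (ha' : a' ≠ 0) {M M' : AddSubgroup A}
    {v v' : A} : build a M v = build a' M' v' ↔ a = a' ∧ M = M' ∧ v - v' ∈ M := by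
  constructor
  · intro h
    have hM : M = M' := by
      ext y
      rw [← zero_mem_build_iff ha (v := v), h, zero_mem_build_iff ha']
    subst hM
    obtain ⟨i, hi, hi'⟩ : ((a : ℤ), v) ∈ build a' M v' := by
      rw [← h]
      exact ⟨1, by simp, by simp⟩
    obtain ⟨j, hj, hj'⟩ : ((a' : ℤ), v') ∈ build a M v := by
      rw [h]
      exact ⟨1, by simp, by simp⟩
    have haa : a = a' := Nat.dvd_antisymm
      (Int.natCast_dvd_natCast.1 ⟨j, by simpa [mul_comm] using hj⟩)
      (Int.natCast_dvd_natCast.1 ⟨i, by simpa [mul_comm] using hi⟩)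
    subst haa
    have : i = 1 := by
      have h2 : (a : ℤ) ≠ 0 := by exact_mod_cast ha
      exact mul_right_cancel₀ h2 (by simpa using hi.symm)
    refine ⟨rfl, rfl, ?_⟩
    simpa [this] using hi'
  · rintro ⟨rfl, rfl, hv⟩
    ext ⟨x, y⟩
    rw [mem_build, mem_build]
    refine exists_congr fun i => and_congr_right fun _ => ?_
    have := M.zsmul_mem hv i
    constructor
    · intro h
      have := M.add_mem h this
      rw [smul_sub] at this
      convert this using 1
      abel
    · intro h
      have := M.sub_mem h this
      rw [smul_sub] at this
      convert this using 1
      abel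

/-- The projection of `L` to `ℤ` is cyclic and nonzero; `a` is its positive generator and `(a, v)`
any element of `L` above it. -/
theorem exists_eq_build (L : AddSubgroup (ℤ × A)) (hL : L.index ≠ 0) :
    ∃ (a : ℕ) (v : A), a ≠ 0 ∧ L = build a (L.comap (AddMonoidHom.inr ℤ A)) v := by
  obtain ⟨g, hg⟩ := Int.subgroup_cyclic (L.map (AddMonoidHom.fst ℤ A))
  rw [← AddSubgroup.zmultiples_eq_closure, ← Int.zmultiples_natAbs] at hg
  have hg0 : g.natAbs ≠ 0 := by
    intro h0
    apply hL
    rw [index_eq_mul_of_prod, hg, Int.index_zmultiples, Int.natAbs_natCast, h0, zero_mul]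
  obtain ⟨⟨x, v⟩, hv, hx⟩ : (g.natAbs : ℤ) ∈ L.map (AddMonoidHom.fst ℤ A) := by
    rw [hg]
    exact AddSubgroup.mem_zmultiples _
  have hx : x = (g.natAbs : ℤ) := hx
  subst hx
  refine ⟨g.natAbs, v, hg0, ?_⟩
  have key : ∀ (i : ℤ) (y : A), ((i * (g.natAbs : ℤ), y) ∈ L ↔ ((0 : ℤ), y - i • v) ∈ L) := by
    intro i y
    have h1 : ((0 : ℤ), y - i • v) = (i * (g.natAbs : ℤ), y) - i • ((g.natAbs : ℤ), v) := by
      ext <;> simp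
    rw [h1]
    exact ⟨fun h => L.sub_mem h (L.zsmul_mem hv i),
      fun h => by simpa using L.add_mem h (L.zsmul_mem hv i)⟩
  ext ⟨x, y⟩
  rw [mem_build]
  constructor
  · intro h
    have : x ∈ L.map (AddMonoidHom.fst ℤ A) := ⟨_, h, rfl⟩
    rw [hg, AddSubgroup.mem_zmultiples_iff] at this
    obtain ⟨i, hi⟩ := this
    simp only [smul_eq_mul] at hi
    subst hi
    exact ⟨i, rfl, (key i y).1 h⟩
  · rintro ⟨i, hi, h⟩
    dsimp only at hi
    subst hi
    exact (key i y).2 h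

/-! ### Summation over the subgroups of given index. -/

/-- A group with finitely many subgroups of every finite index. -/
def FinitelyManySubgroups (A : Type*) [AddCommGroup A] : Prop :=
  ∀ b ≠ 0, {M : AddSubgroup A | M.index = b}.Finite

open Classical in
/-- The finite set of all subgroups of index `b`. -/
noncomputable def subs (A : Type*) [AddCommGroup A] (b : ℕ) : Finset (AddSubgroup A) :=
  if h : {M : AddSubgroup A | M.index = b}.Finite then h.toFinset else ∅

theorem mem_subs (hA : FinitelyManySubgroups A) {b : ℕ} (hb : b ≠ 0) {M : AddSubgroup A} :
    M ∈ subs A b ↔ M.index = b := by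
  rw [subs, dif_pos (hA b hb), Set.Finite.mem_toFinset]
  rfl

theorem finitelyManySubgroups_int : FinitelyManySubgroups ℤ := by
  intro b _
  refine (Set.finite_singleton (AddSubgroup.zmultiples (b : ℤ))).subset fun M hM => ?_
  obtain ⟨g, hg⟩ := Int.subgroup_cyclic M
  rw [← AddSubgroup.zmultiples_eq_closure, ← Int.zmultiples_natAbs] at hg
  have hM : M.index = b := hM
  rw [hg, Int.index_zmultiples, Int.natAbs_natCast] at hM
  rw [Set.mem_singleton_iff, hg, hM]

theorem subs_int {b : ℕ} (hb : b ≠ 0) : subs ℤ b = {AddSubgroup.zmultiples (b : ℤ)} := by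
  ext M
  rw [mem_subs finitelyManySubgroups_int hb, Finset.mem_singleton]
  constructor
  · intro hM
    obtain ⟨g, hg⟩ := Int.subgroup_cyclic M
    rw [← AddSubgroup.zmultiples_eq_closure, ← Int.zmultiples_natAbs] at hg
    rw [hg, Int.index_zmultiples, Int.natAbs_natCast] at hM
    rw [hg, hM]
  · rintro rfl
    rw [Int.index_zmultiples, Int.natAbs_natCast]

theorem finitelyManySubgroups_prod (hA : FinitelyManySubgroups A) :
    FinitelyManySubgroups (ℤ × A) := by
  intro m hm
  have : {L : AddSubgroup (ℤ × A) | L.index = m} ⊆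
      ⋃ p ∈ m.divisorsAntidiagonal, ⋃ M ∈ subs A p.2,
        -- The guard keeps every set of the union finite, whatever the indices occurring in it.
        (fun w : A ⧸ M => build p.1 M w.out) '' (if M.index = 0 then ∅ else Set.univ) := by
    intro L hL
    have hL : L.index = m := hL
    obtain ⟨a, v, ha, h⟩ := exists_eq_build L (hL ▸ hm)
    set M := L.comap (AddMonoidHom.inr ℤ A)
    have hi : a * M.index = m := by rw [← hL, h, index_build ha]
    have hM0 : M.index ≠ 0 := by
      rintro h0
      rw [h0, mul_zero] at hi
      exact hm hi.symm
    refine Set.mem_iUnion₂.2 ⟨(a, M.index), Nat.mem_divisorsAntidiagonal.2 ⟨hi, hm⟩,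
      Set.mem_iUnion₂.2 ⟨M, (mem_subs hA hM0).2 rfl, (v : A ⧸ M), ?_, ?_⟩⟩
    · rw [if_neg hM0]
      trivial
    · rw [h]
      refine (build_eq_build_iff ha ha).2 ⟨rfl, rfl, ?_⟩
      rw [← neg_add_eq_sub, ← QuotientAddGroup.eq]
      simp
  refine Set.Finite.subset ?_ this
  refine Set.Finite.biUnion (Finset.finite_toSet _) fun p _ => Set.Finite.biUnion
    (Finset.finite_toSet _) fun M _ => ?_
  split_ifs with h
  · simp
  · have : Finite (A ⧸ M) := AddSubgroup.index_ne_zero_iff_finite.1 h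
    exact Set.Finite.image _ Set.finite_univ

/-- Hermite normal form, one coordinate at a time: the subgroups of index `m` split into disjoint
families indexed by `a * b = m` and `M` of index `b`, each parametrized by `A ⧸ M`. -/
theorem sum_subs_prod (hA : FinitelyManySubgroups A) {m : ℕ} (hm : m ≠ 0)
    (g : AddSubgroup (ℤ × A) → ℕ) :
    ∑ L ∈ subs (ℤ × A) m, g L = ∑ p ∈ m.divisorsAntidiagonal, ∑ M ∈ subs A p.2,
      ∑ᶠ w : A ⧸ M, g (build p.1 M w.out) := by
  classical
  have hfin : ∀ p ∈ m.divisorsAntidiagonal, ∀ M ∈ subs A p.2, Finite (A ⧸ M) := by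
    intro p hp M hM
    have h2 : p.2 ≠ 0 := (Nat.ne_zero_of_mem_divisorsAntidiagonal hp).2
    rw [mem_subs hA h2] at hM
    exact AddSubgroup.index_ne_zero_iff_finite.1 (hM ▸ h2)
  let R : Finset (Σ p : ℕ × ℕ, AddSubgroup A) := m.divisorsAntidiagonal.sigma fun p => subs A p.2
  let T : (Σ _ : ℕ × ℕ, AddSubgroup A) → Finset (AddSubgroup (ℤ × A)) := fun r =>
    if h : Finite (A ⧸ r.2) then
      (@Finset.univ _ (Fintype.ofFinite (A ⧸ r.2))).image fun w => build r.1.1 r.2 w.out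
    else ∅
  have hT : ∀ r ∈ R, ∀ L, L ∈ T r ↔ ∃ v, L = build r.1.1 r.2 v := by
    rintro ⟨p, M⟩ hr L
    obtain ⟨hp, hM⟩ := Finset.mem_sigma.1 hr
    have ha : p.1 ≠ 0 := (Nat.ne_zero_of_mem_divisorsAntidiagonal hp).1
    have := hfin p hp M hM
    simp only [T, dif_pos this, Finset.mem_image, Finset.mem_univ, true_and]
    constructor
    · rintro ⟨w, rfl⟩
      exact ⟨_, rfl⟩
    · rintro ⟨v, rfl⟩
      refine ⟨(v : A ⧸ M), (build_eq_build_iff ha ha).2 ⟨rfl, rfl, ?_⟩⟩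
      rw [← neg_add_eq_sub, ← QuotientAddGroup.eq]
      simp
  have hsubs : subs (ℤ × A) m = R.biUnion T := by
    ext L
    rw [mem_subs (finitelyManySubgroups_prod hA) hm, Finset.mem_biUnion]
    constructor
    · intro hL
      obtain ⟨a, v, ha, h⟩ := exists_eq_build L (hL ▸ hm)
      set M := L.comap (AddMonoidHom.inr ℤ A)
      have hi : a * M.index = m := by rw [← hL, h, index_build ha]
      have hM0 : M.index ≠ 0 := by
        rintro h0
        rw [h0, mul_zero] at hi
        exact hm hi.symm
      have hR : (⟨(a, M.index), M⟩ : Σ _ : ℕ × ℕ, AddSubgroup A) ∈ R := Finset.mem_sigma.2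
        ⟨Nat.mem_divisorsAntidiagonal.2 ⟨hi, hm⟩, (mem_subs hA hM0).2 rfl⟩
      exact ⟨_, hR, (hT _ hR L).2 ⟨v, h⟩⟩
    · rintro ⟨⟨p, M⟩, hR, hL⟩
      obtain ⟨v, rfl⟩ := (hT _ hR L).1 hL
      obtain ⟨hp, hM⟩ := Finset.mem_sigma.1 hR
      have h0 := Nat.ne_zero_of_mem_divisorsAntidiagonal hp
      rw [index_build h0.1, (mem_subs hA h0.2).1 hM]
      exact (Nat.mem_divisorsAntidiagonal.1 hp).1
  rw [hsubs, Finset.sum_biUnion, Finset.sum_sigma]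
  · refine Finset.sum_congr rfl fun p hp => Finset.sum_congr rfl fun M hM => ?_
    have hf := hfin p hp M hM
    let _ := Fintype.ofFinite (A ⧸ M)
    have ha : p.1 ≠ 0 := (Nat.ne_zero_of_mem_divisorsAntidiagonal hp).1
    simp only [T, dif_pos hf]
    rw [finsum_eq_sum_of_fintype, Finset.sum_image]
    intro w _ w' _ h
    have h3 := ((build_eq_build_iff ha ha).1 h).2.2
    rw [← neg_add_eq_sub, ← QuotientAddGroup.eq] at h3
    simpa using h3.symm
  · rintro ⟨p, M⟩ hr ⟨p', M'⟩ hr' hne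
    refine Finset.disjoint_left.2 fun L hL hL' => hne ?_
    obtain ⟨v, rfl⟩ := (hT _ hr L).1 hL
    obtain ⟨v', h'⟩ := (hT _ hr' _).1 hL'
    obtain ⟨hp, hM⟩ := Finset.mem_sigma.1 hr
    obtain ⟨hp', hM'⟩ := Finset.mem_sigma.1 hr'
    have h0 := Nat.ne_zero_of_mem_divisorsAntidiagonal hp
    have h0' := Nat.ne_zero_of_mem_divisorsAntidiagonal hp'
    obtain ⟨h1, rfl, -⟩ := (build_eq_build_iff h0.1 h0'.1).1 h'
    have h2 : p.2 = p'.2 := by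
      rw [← (mem_subs hA h0.2).1 hM, ← (mem_subs hA h0'.2).1 hM']
    rw [show p = p' from Prod.ext h1 h2]

end Build
/-! ### Counting sublattices -/

theorem sum_divisorsAntidiagonal_swap {M : Type*} [AddCommMonoid M] (n : ℕ) (F : ℕ → ℕ → M) :
    ∑ p ∈ n.divisorsAntidiagonal, F p.2 p.1 = ∑ p ∈ n.divisorsAntidiagonal, F p.1 p.2 := by
  rw [← Nat.map_swap_divisorsAntidiagonal (n := n), Finset.sum_map,
    Nat.map_swap_divisorsAntidiagonal]
  rfl

theorem finsum_quotient_const {A : Type*} [AddCommGroup A] {M : AddSubgroup A}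
    (hM : M.index ≠ 0) (c : ℕ) : ∑ᶠ _ : A ⧸ M, c = M.index * c := by
  have : Finite (A ⧸ M) := AddSubgroup.index_ne_zero_iff_finite.1 hM
  let _ := Fintype.ofFinite (A ⧸ M)
  rw [finsum_eq_sum_of_fintype, Finset.sum_const, smul_eq_mul, Finset.card_univ,
    ← Nat.card_eq_fintype_card]
  rfl

theorem finitelyManySubgroups_int2 : FinitelyManySubgroups (ℤ × ℤ) :=
  finitelyManySubgroups_prod finitelyManySubgroups_int

theorem finitelyManySubgroups_int3 : FinitelyManySubgroups (ℤ × ℤ × ℤ) :=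
  finitelyManySubgroups_prod finitelyManySubgroups_int2

theorem card_subs_int2 {b : ℕ} (hb : b ≠ 0) : (subs (ℤ × ℤ) b).card = sigma1 b := by
  rw [Finset.card_eq_sum_ones, sum_subs_prod finitelyManySubgroups_int hb, sigma1,
    ← sum_divisorsAntidiagonal_swap b fun a _ => a]
  refine Finset.sum_congr rfl fun p hp => ?_
  have h2 := (Nat.ne_zero_of_mem_divisorsAntidiagonal hp).2
  have hi : (AddSubgroup.zmultiples (p.2 : ℤ)).index = p.2 := by
    rw [Int.index_zmultiples, Int.natAbs_natCast]
  rw [subs_int h2, Finset.sum_singleton, finsum_quotient_const (hi.trans_ne h2), hi, mul_one]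

/-- Each planar lattice of index `b` extends in `b` ways, one for every class in its quotient, so
`b` contributes `b σ₁(b)`. -/
theorem card_subs_int3 {m : ℕ} (hm : m ≠ 0) : (subs (ℤ × ℤ × ℤ) m).card = omega m := by
  rw [Finset.card_eq_sum_ones, sum_subs_prod finitelyManySubgroups_int2 hm, omega,
    ← sum_divisorsAntidiagonal_swap m fun a _ => a * sigma1 a]
  refine Finset.sum_congr rfl fun p hp => ?_
  have h2 := (Nat.ne_zero_of_mem_divisorsAntidiagonal hp).2
  rw [← card_subs_int2 h2, mul_comm, ← smul_eq_mul, ← Finset.sum_const]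
  refine Finset.sum_congr rfl fun M hM => ?_
  have hi := (mem_subs finitelyManySubgroups_int2 h2).1 hM
  rw [finsum_quotient_const (hi ▸ h2), hi, mul_one]

/-- The sublattice of `ℤ²` spanned by `(α, w)` and `(0, β)`. -/
def lat (α β : ℕ) (w : ℤ) : AddSubgroup (ℤ × ℤ) := build α (AddSubgroup.zmultiples (β : ℤ)) w

theorem mem_lat {α β : ℕ} {w x y : ℤ} :
    (x, y) ∈ lat α β w ↔ ∃ i : ℤ, x = i * α ∧ (β : ℤ) ∣ y - i * w := by
  rw [lat, mem_build]
  simp only [Int.mem_zmultiples_iff, smul_eq_mul]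

theorem index_lat {α β : ℕ} (hα : α ≠ 0) (w : ℤ) : (lat α β w).index = α * β := by
  rw [lat, index_build hα, Int.index_zmultiples, Int.natAbs_natCast]

/-- Concrete representatives `0, …, β - 1` replace the abstract classes modulo `β`, so that later
sums can be split by parity. -/
theorem sum_subs_int2 {b : ℕ} (hb : b ≠ 0) (g : AddSubgroup (ℤ × ℤ) → ℕ) :
    ∑ M ∈ subs (ℤ × ℤ) b, g M =
      ∑ p ∈ b.divisorsAntidiagonal, ∑ j ∈ Finset.range p.2, g (lat p.1 p.2 j) := by
  rw [sum_subs_prod finitelyManySubgroups_int hb]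
  refine Finset.sum_congr rfl fun p hp => ?_
  obtain ⟨h1, h2⟩ := Nat.ne_zero_of_mem_divisorsAntidiagonal hp
  rw [subs_int h2, Finset.sum_singleton]
  have hi : (AddSubgroup.zmultiples (p.2 : ℤ)).index ≠ 0 := by
    rwa [Int.index_zmultiples, Int.natAbs_natCast]
  have : Finite (ℤ ⧸ AddSubgroup.zmultiples (p.2 : ℤ)) :=
    AddSubgroup.index_ne_zero_iff_finite.1 hi
  let _ := Fintype.ofFinite (ℤ ⧸ AddSubgroup.zmultiples (p.2 : ℤ))
  rw [finsum_eq_sum_of_fintype]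
  symm
  have h2' : (0 : ℤ) < p.2 := by exact_mod_cast Nat.pos_of_ne_zero h2
  refine Finset.sum_bij (fun j _ => ((j : ℤ) : ℤ ⧸ AddSubgroup.zmultiples (p.2 : ℤ)))
    (fun _ _ => Finset.mem_univ _) ?_ ?_ ?_
  · intro j hj k hk h
    rw [QuotientAddGroup.eq, Int.mem_zmultiples_iff] at h
    have hj := Finset.mem_range.1 hj
    have hk := Finset.mem_range.1 hk
    obtain ⟨c, hc⟩ := h
    have hc0 : c = 0 := by
      by_contra hne
      rcases lt_or_gt_of_ne hne with h | h
      · have : (p.2 : ℤ) * c ≤ p.2 * (-1) := by gcongr; omega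
        omega
      · have : (p.2 : ℤ) * 1 ≤ p.2 * c := by gcongr; omega
        omega
    rw [hc0, mul_zero] at hc
    omega
  · intro w _
    obtain ⟨x, rfl⟩ := QuotientAddGroup.mk_surjective w
    have h0 := Int.emod_nonneg x h2'.ne'
    refine ⟨(x % p.2).toNat, Finset.mem_range.2 ?_, ?_⟩
    · have := Int.emod_lt_of_pos x h2'
      omega
    · rw [QuotientAddGroup.eq, Int.mem_zmultiples_iff, Int.toNat_of_nonneg h0]
      refine ⟨x / p.2, ?_⟩
      have := Int.emod_add_mul_ediv x p.2
      linarith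
  · intro j hj
    refine congrArg g ((build_eq_build_iff h1 h1).2 ⟨rfl, rfl, ?_⟩)
    rw [← neg_add_eq_sub, ← QuotientAddGroup.eq]
    simp

/-! ### Sublattices of the plane modulo two. -/

/-- The subgroup of all doubles. -/
def doubles (A : Type*) [AddCommGroup A] : AddSubgroup A := (zsmulAddGroupHom (α := A) 2).range

theorem mem_lat_sup_doubles {α β : ℕ} {w x y : ℤ} : (x, y) ∈ lat α β w ⊔ doubles (ℤ × ℤ) ↔
    ∃ i j : ℤ, Even (x - i * α) ∧ Even (y - i * w - j * β) := by
  rw [AddSubgroup.mem_sup]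
  constructor
  · rintro ⟨⟨x', y'⟩, h, _, ⟨⟨s, t⟩, rfl⟩, he⟩
    obtain ⟨i, hi, j, hj⟩ := mem_lat.1 h
    simp only [zsmulAddGroupHom_apply, Prod.smul_mk, smul_eq_mul, Prod.mk_add_mk,
      Prod.mk.injEq] at he
    refine ⟨i, j, ⟨s, by linarith [he.1]⟩, ⟨t, by linarith [he.2]⟩⟩
  · rintro ⟨i, j, ⟨s, hs⟩, ⟨t, ht⟩⟩
    refine ⟨(i * α, i * w + j * β), mem_lat.2 ⟨i, rfl, j, by ring⟩, (2 * s, 2 * t),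
      ⟨(s, t), rfl⟩, ?_⟩
    ext
    · simp only [Prod.mk_add_mk]
      linarith
    · simp only [Prod.mk_add_mk]
      linarith

/-- Modulo `2ℤ²` only the parities of `α`, `β` and `w` matter; this and the next three lemmas run
through the cases, in which the index of the sum is 1, 2, 2 and 4. -/
theorem lat_sup_doubles_of_odd_of_odd {α β : ℕ} (hα : Odd α) (hβ : Odd β) (w : ℤ) :
    lat α β w ⊔ doubles (ℤ × ℤ) = ⊤ := by
  rw [eq_top_iff]
  rintro ⟨x, y⟩ -
  have hα : ¬ Even (α : ℤ) := by exact_mod_cast Nat.not_even_iff_odd.2 hα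
  have hβ : ¬ Even (β : ℤ) := by exact_mod_cast Nat.not_even_iff_odd.2 hβ
  refine mem_lat_sup_doubles.2 ⟨x, y - x * w, ?_, ?_⟩
  · simp [Int.even_sub, Int.even_mul, hα]
  · simp [Int.even_sub, Int.even_mul, hβ]

theorem lat_sup_doubles_of_odd_of_even {α β : ℕ} (hα : Odd α) (hβ : Even β) (w : ℤ) :
    lat α β w ⊔ doubles (ℤ × ℤ) = lat 1 2 w := by
  have hα : ¬ Even (α : ℤ) := by exact_mod_cast Nat.not_even_iff_odd.2 hα
  have hβ : Even (β : ℤ) := by exact_mod_cast hβ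
  ext ⟨x, y⟩
  rw [mem_lat_sup_doubles, mem_lat]
  simp only [Nat.cast_one, mul_one, Nat.cast_ofNat, ← even_iff_two_dvd, exists_eq_left',
    Int.even_sub, Int.even_mul, hα, hβ]
  constructor
  · rintro ⟨i, j, h1, h2⟩
    tauto
  · intro h
    exact ⟨x, 0, by tauto, by tauto⟩

theorem lat_sup_doubles_of_even {α β : ℕ} (hα : Even α) {w : ℤ} (h : Odd β ∨ Odd w) :
    lat α β w ⊔ doubles (ℤ × ℤ) = lat 2 1 0 := by
  have hα : Even (α : ℤ) := by exact_mod_cast hα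
  have h : ¬ Even (β : ℤ) ∨ ¬ Even w := by
    rw [Int.not_even_iff_odd, Int.not_even_iff_odd]
    exact_mod_cast h
  ext ⟨x, y⟩
  rw [mem_lat_sup_doubles, mem_lat]
  simp only [Nat.cast_one, isUnit_one, IsUnit.dvd, and_true, Nat.cast_ofNat, Int.even_sub,
    Int.even_mul, hα, or_true, iff_true]
  constructor
  · rintro ⟨i, j, ⟨s, hs⟩, -⟩
    exact ⟨s, by omega⟩
  · rintro ⟨i, rfl⟩
    rcases h with h | h
    · exact ⟨0, y, by simp, by simp [h]⟩
    · exact ⟨y, 0, by simp, by simp [h]⟩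

theorem lat_sup_doubles_of_even_of_even {α β : ℕ} (hα : Even α) (hβ : Even β) {w : ℤ}
    (h : Even w) : lat α β w ⊔ doubles (ℤ × ℤ) = lat 2 2 0 := by
  have hα : Even (α : ℤ) := by exact_mod_cast hα
  have hβ : Even (β : ℤ) := by exact_mod_cast hβ
  ext ⟨x, y⟩
  rw [mem_lat_sup_doubles, mem_lat]
  simp only [Nat.cast_ofNat, Int.even_sub, Int.even_mul, hα, hβ, h, or_true, iff_true, mul_zero,
    sub_zero]
  constructor
  · rintro ⟨i, j, ⟨s, hs⟩, ht⟩
    exact ⟨s, by omega, even_iff_two_dvd.1 ht⟩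
  · rintro ⟨i, rfl, ht⟩
    exact ⟨0, 0, by simp, even_iff_two_dvd.2 ht⟩

theorem sum_index_lat_sup_doubles {α β : ℕ} :
    ∑ j ∈ Finset.range β, (lat α β j ⊔ doubles (ℤ × ℤ)).index =
      β + (if 2 ∣ α then β else 0) + (if 2 ∣ β then β else 0) := by
  simp only [← even_iff_two_dvd]
  by_cases hα : Even α <;> by_cases hβ : Even β
  · rw [if_pos hα, if_pos hβ]
    have : ∀ j : ℕ, (lat α β j ⊔ doubles (ℤ × ℤ)).index = if Even j then 4 else 2 := by
      intro j
      split_ifs with hj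
      · rw [lat_sup_doubles_of_even_of_even hα hβ (by exact_mod_cast hj), index_lat two_ne_zero]
      · rw [lat_sup_doubles_of_even hα
          (Or.inr (by exact_mod_cast Nat.not_even_iff_odd.1 hj)), index_lat two_ne_zero]
    -- With `α` and `β` even, consecutive residues `j` contribute 4 and 2, hence 6 for every two
    -- residues and `3β` altogether.
    simp only [this]
    obtain ⟨γ, rfl⟩ := hβ
    clear this
    induction γ with
    | zero => simp
    | succ γ ih =>
      rw [show γ + 1 + (γ + 1) = γ + γ + 1 + 1 by ring, Finset.sum_range_succ,
        Finset.sum_range_succ, ih, if_pos (by simp), if_neg (by simp)]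
      ring
  · rw [if_pos hα, if_neg hβ, add_zero, ← two_mul, mul_comm]
    have : ∀ j ∈ Finset.range β, (lat α β j ⊔ doubles (ℤ × ℤ)).index = 2 := by
      intro j _
      rw [lat_sup_doubles_of_even hα (Or.inl (Nat.not_even_iff_odd.1 hβ)), index_lat two_ne_zero]
    rw [Finset.sum_congr rfl this]
    simp
  · rw [if_neg hα, if_pos hβ, add_zero, ← two_mul, mul_comm]
    have : ∀ j ∈ Finset.range β, (lat α β j ⊔ doubles (ℤ × ℤ)).index = 2 := by
      intro j _
      rw [lat_sup_doubles_of_odd_of_even (Nat.not_even_iff_odd.1 hα) hβ, index_lat one_ne_zero,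
        one_mul]
    rw [Finset.sum_congr rfl this]
    simp
  · rw [if_neg hα, if_neg hβ, add_zero, add_zero]
    have : ∀ j ∈ Finset.range β, (lat α β j ⊔ doubles (ℤ × ℤ)).index = 1 := by
      intro j _
      rw [lat_sup_doubles_of_odd_of_odd (Nat.not_even_iff_odd.1 hα) (Nat.not_even_iff_odd.1 hβ),
        AddSubgroup.index_top]
    rw [Finset.sum_congr rfl this]
    simp

/-- The number of pairs of a sublattice `M` of index `b` and a class in `ℤ² / (M + 2 ℤ²)`. -/
noncomputable def cosetCount (b : ℕ) : ℕ :=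
  ∑ M ∈ subs (ℤ × ℤ) b, (M ⊔ doubles (ℤ × ℤ)).index

theorem cosetCount_eq {b : ℕ} (hb : b ≠ 0) : cosetCount b =
    ∑ p ∈ b.divisorsAntidiagonal,
      (p.2 + (if 2 ∣ p.1 then p.2 else 0) + (if 2 ∣ p.2 then p.2 else 0)) := by
  rw [cosetCount, sum_subs_int2 hb]
  exact Finset.sum_congr rfl fun p _ => sum_index_lat_sup_doubles

/-- An endomorphism of a finite group has kernel and cokernel of the same size. For doubling on `A ⧸
M` the cokernel is `A ⧸ (M + 2A)`. -/
theorem index_sup_doubles {A : Type*} [AddCommGroup A] {M : AddSubgroup A} (hM : M.index ≠ 0) :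
    Nat.card {w : A ⧸ M // (2 : ℤ) • w = 0} = (M ⊔ doubles A).index := by
  have : Finite (A ⧸ M) := AddSubgroup.index_ne_zero_iff_finite.1 hM
  let f : A ⧸ M →+ A ⧸ M := zsmulAddGroupHom 2
  have h1 : (M ⊔ doubles A).map (QuotientAddGroup.mk' M) = f.range := by
    rw [AddSubgroup.map_sup, doubles]
    ext w
    constructor
    · intro h
      obtain ⟨_, ⟨m, hm, rfl⟩, _, ⟨_, ⟨a, rfl⟩, rfl⟩, rfl⟩ := AddSubgroup.mem_sup.1 h
      refine ⟨(a : A ⧸ M), ?_⟩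
      have : (QuotientAddGroup.mk' M) m = 0 := (QuotientAddGroup.eq_zero_iff m).2 hm
      rw [this, zero_add]
      simp [f]
    · rintro ⟨a, rfl⟩
      obtain ⟨a, rfl⟩ := QuotientAddGroup.mk_surjective a
      exact AddSubgroup.mem_sup_right ⟨_, ⟨a, rfl⟩, by simp [f]⟩
  have h2 : (M ⊔ doubles A).index = f.range.index := by
    rw [← h1, AddSubgroup.index_map_eq _ (QuotientAddGroup.mk'_surjective M)]
    rw [QuotientAddGroup.ker_mk']
    exact le_sup_left
  have h3 : Nat.card {w : A ⧸ M // (2 : ℤ) • w = 0} = Nat.card f.ker :=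
    Nat.card_congr (Equiv.subtypeEquivRight fun w => by rw [AddMonoidHom.mem_ker]; rfl)
  have h4 := f.ker.card_mul_index
  have h5 := f.range.card_mul_index
  rw [AddSubgroup.index_ker, ← h5, mul_comm] at h4
  rw [h3, h2]
  exact Nat.eq_of_mul_eq_mul_left Nat.card_pos h4

/-- Since `M` is symmetric, invariance only has to be tested on the generator `(a, v)`, and `(a,
-v)` belongs to the subgroup exactly when `v` and `-v` agree modulo `M`. -/
theorem build_reflection_iff {A : Type*} [AddCommGroup A] {a : ℕ} (ha : a ≠ 0)
    {M : AddSubgroup A} {v : A} :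
    (∀ q ∈ build a M v, (q.1, -q.2) ∈ build a M v) ↔ (2 : ℤ) • v ∈ M := by
  constructor
  · intro h
    obtain ⟨i, hi, hi'⟩ := h ((a : ℤ), v) ⟨1, by simp, by simp⟩
    have : i = 1 := by
      have h2 : (a : ℤ) ≠ 0 := by exact_mod_cast ha
      exact mul_right_cancel₀ h2 (by simpa using hi.symm)
    have h3 := M.neg_mem hi'
    rw [this] at h3
    convert h3 using 1
    simp only [two_smul, one_smul]
    abel
  · rintro h ⟨x, y⟩ ⟨i, hi, hi'⟩
    refine ⟨i, hi, ?_⟩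
    have := M.sub_mem (M.neg_mem hi') (M.zsmul_mem h i)
    convert this using 1
    simp only [two_smul, smul_add]
    abel

-- For given `a` and `M` the invariant extensions are the classes `v` killed by doubling, and
-- `index_sup_doubles` counts these by the index of `M + 2ℤ²`.
open Classical in
theorem card_reflection_invariant {m : ℕ} (hm : m ≠ 0) :
    ((subs (ℤ × ℤ × ℤ) m).filter fun L => ∀ q ∈ L, (q.1, -q.2) ∈ L).card =
      ∑ p ∈ m.divisorsAntidiagonal, cosetCount p.2 := by
  rw [Finset.card_filter, sum_subs_prod finitelyManySubgroups_int2 hm]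
  refine Finset.sum_congr rfl fun p hp => ?_
  obtain ⟨h1, h2⟩ := Nat.ne_zero_of_mem_divisorsAntidiagonal hp
  refine Finset.sum_congr rfl fun M hM => ?_
  have hi := (mem_subs finitelyManySubgroups_int2 h2).1 hM
  have hi0 : M.index ≠ 0 := hi ▸ h2
  have : Finite ((ℤ × ℤ) ⧸ M) := AddSubgroup.index_ne_zero_iff_finite.1 hi0
  let _ := Fintype.ofFinite ((ℤ × ℤ) ⧸ M)
  rw [← index_sup_doubles hi0, finsum_eq_sum_of_fintype, ← Finset.card_filter,
    Nat.card_eq_fintype_card, Fintype.card_subtype]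
  congr 1
  refine Finset.filter_congr fun w _ => ?_
  rw [build_reflection_iff h1, ← QuotientAddGroup.eq_zero_iff, QuotientAddGroup.mk_zsmul]
  simp

open Classical in
/-- The number of pairs of a sublattice `M` of index `b` and a class in `ℤ² / (M + 2 ℤ²)` that are
fixed by the glide reflection `(x, y) ↦ (x + 1, -y - 1)`. -/
noncomputable def fixedCosetCount (b : ℕ) : ℕ :=
  ∑ M ∈ subs (ℤ × ℤ) b, if (∀ q ∈ M, (q.1, -q.2) ∈ M) ∧ (1, 1) ∈ M ⊔ doubles (ℤ × ℤ) then
    (M ⊔ doubles (ℤ × ℤ)).index else 0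

/-- Invariance of `lat α β j` means `β ∣ 2 * j`, and `(1, 1)` can lie in the sum with `2ℤ²` only if
`α` is odd. For odd `β` this leaves `j = 0` with index 1. For `β = 2γ` it requires `γ ∣ j` with `j`
odd, so `γ` is odd, `j = γ`, and the index is 2. -/
theorem fixedCosetCount_eq {b : ℕ} (hb : b ≠ 0) : fixedCosetCount b =
    ∑ p ∈ b.divisorsAntidiagonal, if Odd p.1 then
      ((if Odd p.2 then 1 else 0) + if 2 ∣ p.2 then (if Odd (p.2 / 2) then 2 else 0) else 0)
      else 0 := by
  classical
  rw [fixedCosetCount, sum_subs_int2 hb]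
  refine Finset.sum_congr rfl fun ⟨α, β⟩ hp => ?_
  obtain ⟨h1, h2⟩ := Nat.ne_zero_of_mem_divisorsAntidiagonal hp
  dsimp only at h1 h2 ⊢
  have hrefl : ∀ j : ℕ, (∀ q ∈ lat α β j, (q.1, -q.2) ∈ lat α β j) ↔ β ∣ 2 * j := fun j => by
    rw [lat, build_reflection_iff h1, Int.mem_zmultiples_iff, smul_eq_mul]
    exact_mod_cast Iff.rfl
  simp only [hrefl]
  by_cases hα : Odd α
  · rw [if_pos hα]
    by_cases hβ : Odd β
    · have hβ2 : ¬ 2 ∣ β := fun h => Nat.not_even_iff_odd.2 hβ (even_iff_two_dvd.2 h)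
      rw [if_pos hβ, if_neg hβ2, add_zero, Finset.sum_eq_single 0]
      · rw [lat_sup_doubles_of_odd_of_odd hα hβ]
        simp
      · intro j hj hj0
        rw [if_neg]
        rintro ⟨hd, -⟩
        have := (Nat.Coprime.dvd_mul_left (Nat.coprime_two_right.2 hβ)).1 hd
        have := Nat.le_of_dvd (Nat.pos_of_ne_zero hj0) this
        have := Finset.mem_range.1 hj
        omega
      · intro h
        exact absurd (Finset.mem_range.2 (Nat.pos_of_ne_zero h2)) h
    · have hβe := Nat.not_odd_iff_even.1 hβ
      obtain ⟨γ, rfl⟩ := even_iff_two_dvd.1 hβe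
      have hγ0 : 0 < γ := by omega
      have hmem : ∀ j : ℕ, (((1 : ℤ), (1 : ℤ)) ∈ lat 1 2 j ↔ Odd j) := by
        intro j
        rw [mem_lat]
        simp only [Nat.cast_one, mul_one, Nat.cast_ofNat, exists_eq_left', one_mul]
        rw [Nat.odd_iff]
        omega
      have hterm : ∀ j : ℕ, (if 2 * γ ∣ 2 * j ∧
          (1, 1) ∈ lat α (2 * γ) j ⊔ doubles (ℤ × ℤ) then
            (lat α (2 * γ) j ⊔ doubles (ℤ × ℤ)).index else 0) =
          if γ ∣ j ∧ Odd j then 2 else 0 := by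
        intro j
        rw [lat_sup_doubles_of_odd_of_even hα hβe, hmem, index_lat one_ne_zero, one_mul]
        simp only [Nat.mul_dvd_mul_iff_left two_pos]
      simp only [hterm]
      rw [if_neg hβ, if_pos (dvd_mul_right 2 γ), Nat.mul_div_cancel_left γ two_pos, zero_add]
      split_ifs with hγ
      · rw [Finset.sum_eq_single γ, if_pos ⟨dvd_rfl, hγ⟩]
        · intro j hj hjγ
          rw [if_neg]
          rintro ⟨⟨c, rfl⟩, hodd⟩
          have hj := Finset.mem_range.1 hj
          have hc : c < 2 := by
            by_contra hc
            have : γ * 2 ≤ γ * c := Nat.mul_le_mul_left γ (by omega)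
            omega
          interval_cases c
          · simp at hodd
          · simp at hjγ
        · intro h
          exact absurd (Finset.mem_range.2 (by omega)) h
      · refine Finset.sum_eq_zero fun j _ => if_neg ?_
        rintro ⟨⟨c, rfl⟩, hodd⟩
        exact hγ (Nat.odd_mul.1 hodd).1
  · rw [if_neg hα]
    refine Finset.sum_eq_zero fun j _ => if_neg ?_
    rintro ⟨-, h⟩
    obtain ⟨i, k, h, -⟩ := mem_lat_sup_doubles.1 h
    have hα : Even (α : ℤ) := by exact_mod_cast Nat.not_odd_iff_even.1 hα
    simp [Int.even_sub, hα] at h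

/-! ### Divisor sums -/

/-- The Dirichlet convolution with the constant function `1`. -/
def conv (f : ℕ → ℚ) (n : ℕ) : ℚ := ∑ p ∈ n.divisorsAntidiagonal, f p.1

/-- The function `f (n / k)`, which vanishes when `n / k` is not an integer. -/
def dil (k : ℕ) (f : ℕ → ℚ) (n : ℕ) : ℚ := if k ∣ n then f (n / k) else 0

theorem dil_dil (j k : ℕ) (f : ℕ → ℚ) : dil j (dil k f) = dil (j * k) f := by
  funext n
  simp only [dil]
  by_cases hj : j ∣ n
  · rw [if_pos hj]
    rcases Nat.eq_zero_or_pos j with rfl | hj0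
    · obtain rfl := zero_dvd_iff.1 hj
      simp
    · simp only [Nat.dvd_div_iff_mul_dvd hj, Nat.div_div_eq_div_mul]
  · rw [if_neg hj, if_neg fun h => hj ((dvd_mul_right j k).trans h)]

theorem dil_add (k : ℕ) (f g : ℕ → ℚ) : dil k (f + g) = dil k f + dil k g := by
  funext n
  simp only [dil, Pi.add_apply]
  split_ifs <;> simp

theorem dil_sub (k : ℕ) (f g : ℕ → ℚ) : dil k (f - g) = dil k f - dil k g := by
  funext n
  simp only [dil, Pi.sub_apply]
  split_ifs <;> simp

theorem dil_smul (k : ℕ) (c : ℚ) (f : ℕ → ℚ) : dil k (c • f) = c • dil k f := by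
  funext n
  simp only [dil, Pi.smul_apply]
  split_ifs <;> simp

theorem conv_add (f g : ℕ → ℚ) : conv (f + g) = conv f + conv g := by
  funext n
  simp [conv, Finset.sum_add_distrib]

theorem conv_sub (f g : ℕ → ℚ) : conv (f - g) = conv f - conv g := by
  funext n
  simp [conv]

theorem conv_smul (c : ℚ) (f : ℕ → ℚ) : conv (c • f) = c • conv f := by
  funext n
  simp [conv, Finset.mul_sum]

theorem conv_congr {f g : ℕ → ℚ} (h : ∀ n ≠ 0, f n = g n) : conv f = conv g := by
  funext n
  exact Finset.sum_congr rfl fun p hp => h _ (Nat.ne_zero_of_mem_divisorsAntidiagonal hp).1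

/-- Factorizations of `n` whose first factor is a multiple of `k` are factorizations of `n / k`. It
follows that `conv` commutes with `dil k`, so both may be treated as commuting operators. -/
theorem sum_dilate {M : Type*} [AddCommMonoid M] {k : ℕ} (hk : k ≠ 0) (n : ℕ) (F : ℕ → ℕ → M) :
    ∑ p ∈ n.divisorsAntidiagonal, (if k ∣ p.1 then F (p.1 / k) p.2 else 0) =
      if k ∣ n then ∑ p ∈ (n / k).divisorsAntidiagonal, F p.1 p.2 else 0 := by
  rw [← Finset.sum_filter]
  split_ifs with h
  · obtain ⟨m, rfl⟩ := h
    rw [Nat.mul_div_cancel_left m (Nat.pos_of_ne_zero hk)]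
    refine Finset.sum_bij' (fun p _ => (p.1 / k, p.2)) (fun p _ => (k * p.1, p.2)) ?_ ?_ ?_ ?_ ?_
    · rintro ⟨a, b⟩ h
      obtain ⟨h1, c, hc⟩ := Finset.mem_filter.1 h
      obtain ⟨h1, h2⟩ := Nat.mem_divisorsAntidiagonal.1 h1
      dsimp only at *
      subst hc
      rw [Nat.mul_div_cancel_left c (Nat.pos_of_ne_zero hk)]
      refine Nat.mem_divisorsAntidiagonal.2 ⟨?_, right_ne_zero_of_mul h2⟩
      rw [mul_assoc] at h1
      exact Nat.eq_of_mul_eq_mul_left (Nat.pos_of_ne_zero hk) h1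
    · rintro ⟨a, b⟩ h
      obtain ⟨h1, h2⟩ := Nat.mem_divisorsAntidiagonal.1 h
      refine Finset.mem_filter.2 ⟨Nat.mem_divisorsAntidiagonal.2 ⟨?_, mul_ne_zero hk h2⟩,
        dvd_mul_right k a⟩
      dsimp only at *
      rw [mul_assoc, h1]
    · rintro ⟨a, b⟩ h
      obtain ⟨h1, c, hc⟩ := Finset.mem_filter.1 h
      dsimp only at *
      subst hc
      rw [Nat.mul_div_cancel_left c (Nat.pos_of_ne_zero hk)]
    · rintro ⟨a, b⟩ h
      dsimp only
      rw [Nat.mul_div_cancel_left a (Nat.pos_of_ne_zero hk)]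
    · intro p _
      rfl
  · refine Finset.sum_eq_zero fun p hp => absurd ?_ h
    obtain ⟨h1, h2⟩ := Finset.mem_filter.1 hp
    rw [← (Nat.mem_divisorsAntidiagonal.1 h1).1]
    exact h2.mul_right _

theorem conv_dil {k : ℕ} (hk : k ≠ 0) (f : ℕ → ℚ) : conv (dil k f) = dil k (conv f) := by
  funext n
  exact sum_dilate hk n fun a _ => f a

/-- Writing `D` for `dil 2`, an oddness condition on one factor amounts to the operator `1 - D`: all
terms minus those with that factor even. -/
theorem sum_odd_snd (f : ℕ → ℚ) (n : ℕ) :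
    ∑ p ∈ n.divisorsAntidiagonal, (if Odd p.2 then f p.1 else 0) =
      (conv f - dil 2 (conv f)) n := by
  have h := sum_dilate two_ne_zero n fun _ b => f b
  rw [← sum_divisorsAntidiagonal_swap n fun a b => if 2 ∣ a then f b else 0,
    ← sum_divisorsAntidiagonal_swap (n / 2) fun a b => f b] at h
  have h2 : dil 2 (conv f) n = if 2 ∣ n then ∑ p ∈ (n / 2).divisorsAntidiagonal, f p.1 else 0 :=
    rfl
  rw [Pi.sub_apply, h2, ← h, conv, ← Finset.sum_sub_distrib]
  refine Finset.sum_congr rfl fun p _ => ?_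
  by_cases hp : Odd p.2
  · rw [if_pos hp, if_neg fun h => Nat.not_even_iff_odd.2 hp (even_iff_two_dvd.2 h), sub_zero]
  · rw [if_neg hp, if_pos (even_iff_two_dvd.1 (Nat.not_odd_iff_even.1 hp)), sub_self]

/-- `σ₀` with rational values. -/
def s0 (n : ℕ) : ℚ := sigma0 n
/-- `σ₁` with rational values. -/
def s1 (n : ℕ) : ℚ := sigma1 n
/-- `σ₂` with rational values. -/
def s2 (n : ℕ) : ℚ := sigma2 n
/-- `d₃` with rational values. -/
def q3 (n : ℕ) : ℚ := d3 n

theorem conv_one : conv 1 = s0 := by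
  funext n
  simp [conv, s0, sigma0]

theorem conv_s1 : conv s1 = s2 := by
  funext n
  simp [conv, s1, s2, sigma2]

theorem conv_s0 : conv s0 = q3 := by
  funext n
  simp [conv, s0, q3, d3]

/-- The number of factorizations into two odd factors. -/
def oddPairs (n : ℕ) : ℚ :=
  ∑ p ∈ n.divisorsAntidiagonal, if Odd p.2 then (if Odd p.1 then 1 else 0) else 0

theorem oddPairs_eq : oddPairs = s0 - (2 : ℚ) • dil 2 s0 + dil 4 s0 := by
  have h1 : (fun n : ℕ => if Odd n then (1 : ℚ) else 0) = 1 - dil 2 1 := by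
    funext n
    simp only [dil, Pi.sub_apply, Pi.one_apply]
    by_cases hp : Odd n
    · rw [if_pos hp, if_neg fun h => Nat.not_even_iff_odd.2 hp (even_iff_two_dvd.2 h), sub_zero]
    · rw [if_neg hp, if_pos (even_iff_two_dvd.1 (Nat.not_odd_iff_even.1 hp)), sub_self]
  funext n
  rw [oddPairs, sum_odd_snd (fun n : ℕ => if Odd n then (1 : ℚ) else 0) n, h1, conv_sub,
    conv_dil two_ne_zero, conv_one, dil_sub, dil_dil]
  simp only [Pi.sub_apply, Pi.add_apply, Pi.smul_apply, smul_eq_mul]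
  ring

theorem conv_oddPairs : conv oddPairs = q3 - (2 : ℚ) • dil 2 q3 + dil 4 q3 := by
  rw [oddPairs_eq, conv_add, conv_sub, conv_smul, conv_dil two_ne_zero, conv_dil four_ne_zero,
    conv_s0]

/-- The three summands of `cosetCount_eq` give `σ₁(b)`, `σ₁(b / 2)` and `2 σ₁(b / 2)`; the factor 2
in the last arises because the summed factor itself is halved. -/
theorem cosetCount_eq_s1 {b : ℕ} (hb : b ≠ 0) :
    (cosetCount b : ℚ) = (s1 + (3 : ℚ) • dil 2 s1) b := by
  have hs : ∀ n, s1 n = ∑ p ∈ n.divisorsAntidiagonal, (p.2 : ℚ) := fun n => by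
    rw [sum_divisorsAntidiagonal_swap n fun a _ => (a : ℚ)]
    simp [s1, sigma1]
  have h1 : ∑ p ∈ b.divisorsAntidiagonal, (if 2 ∣ p.1 then (p.2 : ℚ) else 0) = dil 2 s1 b := by
    rw [sum_dilate two_ne_zero b fun _ c => (c : ℚ), dil, hs]
  have h2 : ∑ p ∈ b.divisorsAntidiagonal, (if 2 ∣ p.2 then (p.2 : ℚ) else 0) =
      2 * dil 2 s1 b := by
    rw [sum_divisorsAntidiagonal_swap b fun a _ => if 2 ∣ a then (a : ℚ) else 0]
    have : ∀ p ∈ b.divisorsAntidiagonal, (if 2 ∣ p.1 then (p.1 : ℚ) else 0) =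
        if 2 ∣ p.1 then 2 * ((p.1 / 2 : ℕ) : ℚ) else 0 := by
      intro p _
      split_ifs with h
      · obtain ⟨c, hc⟩ := h
        rw [hc, Nat.mul_div_cancel_left c two_pos]
        push_cast
        ring
      · rfl
    rw [Finset.sum_congr rfl this, sum_dilate two_ne_zero b fun a _ => 2 * (a : ℚ), dil]
    split_ifs
    · rw [← Finset.mul_sum]
      simp [s1, sigma1]
    · simp
  rw [cosetCount_eq hb]
  push_cast
  rw [Finset.sum_add_distrib, Finset.sum_add_distrib, h1, h2, ← hs]
  simp only [Pi.add_apply, Pi.smul_apply, smul_eq_mul]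
  ring

theorem fixedCosetCount_eq_oddPairs {b : ℕ} (hb : b ≠ 0) :
    (fixedCosetCount b : ℚ) = (oddPairs + (2 : ℚ) • dil 2 oddPairs) b := by
  have h := sum_dilate two_ne_zero b fun a c : ℕ =>
    if Odd c then (if Odd a then (2 : ℚ) else 0) else 0
  have h2 : ∀ n, ∑ p ∈ n.divisorsAntidiagonal,
      (if Odd p.2 then (if Odd p.1 then (2 : ℚ) else 0) else 0) = 2 * oddPairs n := by
    intro n
    rw [oddPairs, Finset.mul_sum]
    refine Finset.sum_congr rfl fun p _ => ?_
    split_ifs <;> simp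
  rw [h2] at h
  rw [fixedCosetCount_eq hb]
  push_cast
  rw [← sum_divisorsAntidiagonal_swap b fun α β => if Odd α then
      ((if Odd β then (1 : ℚ) else 0) + if 2 ∣ β then (if Odd (β / 2) then 2 else 0) else 0)
      else 0]
  have h3 : ∀ p ∈ b.divisorsAntidiagonal, (if Odd p.2 then
      ((if Odd p.1 then (1 : ℚ) else 0) + if 2 ∣ p.1 then (if Odd (p.1 / 2) then 2 else 0) else 0)
      else 0) = (if Odd p.2 then (if Odd p.1 then 1 else 0) else 0) +
        if 2 ∣ p.1 then (if Odd p.2 then (if Odd (p.1 / 2) then (2 : ℚ) else 0) else 0) else 0 := by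
    intro p _
    split_ifs <;> simp
  rw [Finset.sum_congr rfl h3, Finset.sum_add_distrib, h, ← oddPairs, Pi.add_apply, Pi.smul_apply,
    dil]
  split_ifs <;> simp

theorem sum_cosetCount (m : ℕ) :
    ((∑ p ∈ m.divisorsAntidiagonal, cosetCount p.2 : ℕ) : ℚ) = s2 m + 3 * dil 2 s2 m := by
  have h : conv (fun b => (cosetCount b : ℚ)) = conv (s1 + (3 : ℚ) • dil 2 s1) :=
    conv_congr fun b hb => cosetCount_eq_s1 hb
  rw [conv_add, conv_smul, conv_dil two_ne_zero, conv_s1] at h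
  rw [sum_divisorsAntidiagonal_swap m fun a _ => cosetCount a]
  push_cast
  exact congrFun h m

/-- With `D` for `dil 2`, odd height contributes `1 - D`, the lattices contribute `(1 + 3D) σ₂`, and
the fixed data `(1 + 2D)(1 - D)² d₃`. The coefficients are those of `(1 - D)(1 + 3D) = 1 + 2D - 3D²`
and `(1 - D)³(1 + 2D) = 1 - D - 3D² + 5D³ - 2D⁴`. -/
theorem sum_odd_cosetCount (m : ℕ) :
    ((∑ p ∈ m.divisorsAntidiagonal,
      if Odd p.1 then cosetCount p.2 + fixedCosetCount p.2 else 0 : ℕ) : ℚ) =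
      s2 m + 2 * dil 2 s2 m - 3 * dil 4 s2 m + q3 m - dil 2 q3 m - 3 * dil 4 q3 m
        + 5 * dil 8 q3 m - 2 * dil 16 q3 m := by
  have h : conv (fun b => (cosetCount b : ℚ) + fixedCosetCount b) =
      conv (s1 + (3 : ℚ) • dil 2 s1 + (oddPairs + (2 : ℚ) • dil 2 oddPairs)) :=
    conv_congr fun b hb => by
      rw [cosetCount_eq_s1 hb, fixedCosetCount_eq_oddPairs hb]
      rfl
  rw [← sum_divisorsAntidiagonal_swap m fun a b =>
    if Odd a then cosetCount b + fixedCosetCount b else 0]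
  push_cast
  rw [sum_odd_snd (fun b => (cosetCount b : ℚ) + fixedCosetCount b) m, h]
  simp only [conv_add, conv_smul, conv_dil two_ne_zero, conv_s1, conv_oddPairs, dil_add, dil_sub,
    dil_smul, dil_dil, Pi.add_apply, Pi.sub_apply, Pi.smul_apply, smul_eq_mul, smul_add, smul_sub]
  norm_num
  ring

/-- Three oddness conditions apply `(1 - D)³` to `d₃`, with `D` for `dil 2`. -/
theorem encard_oddTriples {n : ℕ} (hn : n ≠ 0) :
    ∃ k : ℕ, {t : ℕ × ℕ × ℕ | Odd t.1 ∧ Odd t.2.1 ∧ Odd t.2.2 ∧ t.1 * t.2.1 * t.2.2 = n}.encard =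
      k ∧ (k : ℚ) = q3 n - 3 * dil 2 q3 n + 3 * dil 4 q3 n - dil 8 q3 n := by
  let R : Finset (Σ _ : ℕ × ℕ, ℕ × ℕ) := (n.divisorsAntidiagonal.filter fun p => Odd p.2).sigma
    fun p => p.1.divisorsAntidiagonal.filter fun q => Odd q.2 ∧ Odd q.1
  have hR : {t : ℕ × ℕ × ℕ | Odd t.1 ∧ Odd t.2.1 ∧ Odd t.2.2 ∧ t.1 * t.2.1 * t.2.2 = n} =
      (fun r : Σ _ : ℕ × ℕ, ℕ × ℕ => (r.2.1, r.2.2, r.1.2)) '' (R : Set (Σ _ : ℕ × ℕ, ℕ × ℕ)) := by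
    ext ⟨a, b, c⟩
    constructor
    · rintro ⟨ha, hb, hc, h⟩
      dsimp only at ha hb hc h
      refine ⟨⟨(a * b, c), (a, b)⟩, ?_, rfl⟩
      have : a * b ≠ 0 := left_ne_zero_of_mul (h.trans_ne hn)
      simp [R, ha, hb, hc, h, hn, left_ne_zero_of_mul this, right_ne_zero_of_mul this]
    · rintro ⟨⟨⟨d, c⟩, a, b⟩, h, he⟩
      simp only [Prod.mk.injEq] at he
      obtain ⟨rfl, rfl, rfl⟩ := he
      simp only [R, Finset.coe_sigma, Set.mem_sigma_iff, Finset.mem_coe, Finset.mem_filter,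
        Nat.mem_divisorsAntidiagonal] at h
      obtain ⟨⟨⟨h1, -⟩, h2⟩, ⟨h3, -⟩, h4, h5⟩ := h
      exact ⟨h5, h4, h2, by rw [h3, h1]⟩
  refine ⟨R.card, ?_, ?_⟩
  · rw [hR, Set.InjOn.encard_image, Set.encard_coe_eq_coe_finsetCard]
    rintro ⟨⟨d, c⟩, a, b⟩ h ⟨⟨d', c'⟩, a', b'⟩ h' he
    simp only [R, Finset.coe_sigma, Set.mem_sigma_iff, Finset.mem_coe, Finset.mem_filter,
        Nat.mem_divisorsAntidiagonal] at h h'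
    simp only [Prod.mk.injEq] at he
    obtain ⟨rfl, rfl, rfl⟩ := he
    obtain rfl : d = d' := h.2.1.1.symm.trans h'.2.1.1
    rfl
  · have : (R.card : ℚ) = ∑ p ∈ n.divisorsAntidiagonal, if Odd p.2 then oddPairs p.1 else 0 := by
      rw [Finset.card_sigma, Finset.sum_filter]
      push_cast
      refine Finset.sum_congr rfl fun p _ => ?_
      split_ifs
      · rw [oddPairs, Finset.card_filter]
        push_cast
        refine Finset.sum_congr rfl fun q _ => ?_
        split_ifs <;> simp_all
      · rfl
    rw [this, sum_odd_snd, conv_oddPairs]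
    simp only [dil_add, dil_sub, dil_smul, dil_dil, Pi.add_apply, Pi.sub_apply, Pi.smul_apply,
      smul_eq_mul]
    norm_num
    ring

/-! ### The Hantzsche-Wendt group in integer coordinates -/

/-- The sign `(-1) ^ n` as an integer. -/
def sg (n : ℤ) : ℤ := (n.negOnePow : ℤ)

theorem sg_of_even {n : ℤ} (h : Even n) : sg n = 1 := by rw [sg, Int.negOnePow_even n h]; rfl

theorem sg_of_odd {n : ℤ} (h : Odd n) : sg n = -1 := by rw [sg, Int.negOnePow_odd n h]; rfl

theorem sg_eq_or (n : ℤ) : sg n = 1 ∨ sg n = -1 := by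
  rcases Int.even_or_odd n with h | h
  · exact Or.inl (sg_of_even h)
  · exact Or.inr (sg_of_odd h)

theorem sg_add (m n : ℤ) : sg (m + n) = sg m * sg n := by
  rw [sg, Int.negOnePow_add]
  rfl

theorem sg_neg (n : ℤ) : sg (-n) = sg n := by rw [sg, Int.negOnePow_neg]; rfl

theorem sg_mul_self (n : ℤ) : sg n * sg n = 1 := by
  rcases sg_eq_or n with h | h <;> rw [h] <;> rfl

theorem sg_sg_mul (m n : ℤ) : sg (sg m * n) = sg n := by
  rcases sg_eq_or m with h | h <;> rw [h]
  · rw [one_mul]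
  · rw [neg_one_mul, sg_neg]

theorem even_sg_mul {m n : ℤ} : Even (sg m * n) ↔ Even n := by
  rcases sg_eq_or m with h | h <;> rw [h] <;> simp

theorem dvd_sg_mul {a m n : ℤ} : a ∣ sg m * n ↔ a ∣ n := by
  rcases sg_eq_or m with h | h <;> rw [h] <;> simp

theorem sg_two_mul (n : ℤ) : sg (2 * n) = 1 := sg_of_even (even_two_mul n)

/-- The group of the motions
`(a, b, c) ↦ ((-1) ^ y a + x, (-1) ^ z b + y, (-1) ^ x c + z)` with `x + y + z` even. -/
@[ext]
structure HW where
  /-- The first component of the translation part. -/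
  x : ℤ
  /-- The second component of the translation part. -/
  y : ℤ
  /-- The third component of the translation part. -/
  z : ℤ
  even : Even (x + y + z)

namespace HW

instance : Mul HW := ⟨fun g h => ⟨g.x + sg g.y * h.x, g.y + sg g.z * h.y, g.z + sg g.x * h.z, by
  have hg := g.even
  have hh := h.even
  simp only [Int.even_add, even_sg_mul] at *
  tauto⟩⟩

instance : One HW := ⟨⟨0, 0, 0, by simp⟩⟩

instance : Inv HW := ⟨fun g => ⟨-(sg g.y * g.x), -(sg g.z * g.y), -(sg g.x * g.z), by
  have hg := g.even
  simp only [Int.even_add, even_neg, even_sg_mul] at *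
  tauto⟩⟩

@[simp] theorem mul_x (g h : HW) : (g * h).x = g.x + sg g.y * h.x := rfl
@[simp] theorem mul_y (g h : HW) : (g * h).y = g.y + sg g.z * h.y := rfl
@[simp] theorem mul_z (g h : HW) : (g * h).z = g.z + sg g.x * h.z := rfl
@[simp] theorem one_x : (1 : HW).x = 0 := rfl
@[simp] theorem one_y : (1 : HW).y = 0 := rfl
@[simp] theorem one_z : (1 : HW).z = 0 := rfl
@[simp] theorem inv_x (g : HW) : g⁻¹.x = -(sg g.y * g.x) := rfl
@[simp] theorem inv_y (g : HW) : g⁻¹.y = -(sg g.z * g.y) := rfl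
@[simp] theorem inv_z (g : HW) : g⁻¹.z = -(sg g.x * g.z) := rfl

instance : Group HW := Group.ofLeftAxioms
  (by
    intro a b c
    ext <;> simp only [mul_x, mul_y, mul_z, sg_add, sg_sg_mul] <;> ring)
  (by
    intro a
    ext <;> simp [sg_of_even])
  (by
    intro a
    ext <;> simp [sg_neg, sg_sg_mul])

/-- Up to a sign, conjugation adds `(1 - sg g.y) * h.x`: nothing if the linear part of `g` fixes the
axis, and `2 * h.x` if it reverses it. Every later conjugation argument rests on this dichotomy. -/
theorem conj_x (h g : HW) : (h * g * h⁻¹).x = h.x + sg h.y * g.x - sg g.y * h.x := by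
  simp only [mul_x, mul_y, inv_x, sg_add, sg_sg_mul]
  linear_combination (-sg g.y * h.x) * sg_mul_self h.y

theorem conj_y (h g : HW) : (h * g * h⁻¹).y = h.y + sg h.z * g.y - sg g.z * h.y := by
  simp only [mul_y, mul_z, inv_y, sg_add, sg_sg_mul]
  linear_combination (-sg g.z * h.y) * sg_mul_self h.z

theorem conj_z (h g : HW) : (h * g * h⁻¹).z = h.z + sg h.x * g.z - sg g.x * h.z := by
  simp only [mul_z, mul_x, inv_z, sg_add, sg_sg_mul]
  linear_combination (-sg g.x * h.z) * sg_mul_self h.x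

theorem even_z {g : HW} (hx : Even g.x) (hy : Even g.y) : Even g.z := by
  have := g.even
  simp only [Int.even_add, hx, hy] at this
  tauto

/-- The translation by twice a vector. -/
def tr (u : ℤ × ℤ × ℤ) : HW := ⟨2 * u.1, 2 * u.2.1, 2 * u.2.2, by simp [Int.even_add]⟩

@[simp] theorem tr_x (u : ℤ × ℤ × ℤ) : (tr u).x = 2 * u.1 := rfl
@[simp] theorem tr_y (u : ℤ × ℤ × ℤ) : (tr u).y = 2 * u.2.1 := rfl
@[simp] theorem tr_z (u : ℤ × ℤ × ℤ) : (tr u).z = 2 * u.2.2 := rfl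

/-- Translations as a homomorphism. -/
def trHom : Multiplicative (ℤ × ℤ × ℤ) →* HW where
  toFun u := tr u.toAdd
  map_one' := by ext <;> simp
  map_mul' u v := by ext <;> simp [sg_two_mul, mul_add]

theorem tr_add (u v : ℤ × ℤ × ℤ) : tr (u + v) = tr u * tr v :=
  trHom.map_mul (Multiplicative.ofAdd u) (Multiplicative.ofAdd v)

theorem tr_neg (u : ℤ × ℤ × ℤ) : tr (-u) = (tr u)⁻¹ :=
  trHom.map_inv (Multiplicative.ofAdd u)

theorem exists_tr {g : HW} (hx : Even g.x) (hy : Even g.y) : ∃ u, g = tr u := by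
  obtain ⟨c, hc⟩ := even_z hx hy
  obtain ⟨a, ha⟩ := hx
  obtain ⟨b, hb⟩ := hy
  exact ⟨(a, b, c), by ext <;> simp <;> omega⟩

/-- The parities of the first two components. -/
def parity : HW →* Multiplicative (ZMod 2 × ZMod 2) where
  toFun g := Multiplicative.ofAdd ((g.x : ZMod 2), (g.y : ZMod 2))
  map_one' := by simp
  map_mul' g h := by
    have hs : ∀ m n : ℤ, ((sg m * n : ℤ) : ZMod 2) = n := fun m n => by
      rcases sg_eq_or m with h | h <;> rw [h]
      · rw [one_mul]
      · rw [neg_one_mul, Int.cast_neg, ZMod.neg_eq_self_mod_two]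
    rw [← ofAdd_add]
    simp only [mul_x, mul_y, Int.cast_add, hs, Prod.mk_add_mk]

theorem parity_apply (g : HW) :
    parity g = Multiplicative.ofAdd ((g.x : ZMod 2), (g.y : ZMod 2)) := rfl

theorem parity_eq_one_iff {g : HW} : parity g = 1 ↔ Even g.x ∧ Even g.y := by
  rw [parity_apply, ← ofAdd_zero, Multiplicative.ofAdd.injective.eq_iff, Prod.ext_iff]
  simp only [Prod.fst_zero, Prod.snd_zero, ZMod.intCast_eq_zero_iff_even]

theorem parity_surjective : Function.Surjective parity := by
  intro w
  refine ⟨⟨(w.toAdd.1.val : ℤ), (w.toAdd.2.val : ℤ), w.toAdd.1.val + w.toAdd.2.val, ?_⟩, ?_⟩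
  · simp
  · rw [parity_apply]
    simp

theorem range_trHom : trHom.range = parity.ker := by
  ext g
  rw [MonoidHom.mem_ker, parity_eq_one_iff]
  constructor
  · rintro ⟨u, rfl⟩
    exact ⟨even_two_mul _, even_two_mul _⟩
  · rintro ⟨hx, hy⟩
    obtain ⟨u, rfl⟩ := exists_tr hx hy
    exact ⟨Multiplicative.ofAdd u, rfl⟩

/-- The lattice of all `u` such that the translation by `2u` belongs to a subgroup. -/
def lattice (K : Subgroup HW) : AddSubgroup (ℤ × ℤ × ℤ) where
  carrier := {u | tr u ∈ K}
  zero_mem' := K.one_mem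
  add_mem' {u v} hu hv := by
    change tr (u + v) ∈ K
    rw [tr_add]
    exact K.mul_mem hu hv
  neg_mem' {u} hu := by
    change tr (-u) ∈ K
    rw [tr_neg]
    exact K.inv_mem hu

theorem mem_lattice {K : Subgroup HW} {u : ℤ × ℤ × ℤ} : u ∈ lattice K ↔ tr u ∈ K := Iff.rfl

/-- Both sides are the index of `K ∩ T`, where `T` is the translation subgroup, of index 4: one
tower passes through `K`, the other through `T`. -/
theorem card_map_parity_mul_index (K : Subgroup HW) :
    Nat.card (K.map parity) * K.index = (lattice K).index * 4 := by
  have h1 := Subgroup.relIndex_mul_index (inf_le_left : K ⊓ parity.ker ≤ K)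
  have h2 := Subgroup.relIndex_mul_index (inf_le_right : K ⊓ parity.ker ≤ parity.ker)
  rw [Subgroup.inf_relIndex_left, Subgroup.relIndex_ker] at h1
  rw [Subgroup.inf_relIndex_right, Subgroup.index_ker,
    MonoidHom.range_eq_top_of_surjective _ parity_surjective, ← range_trHom,
    ← Subgroup.index_comap] at h2
  have h3 : (K.comap trHom).index = (lattice K).index := by
    rw [← AddSubgroup.index_toSubgroup]
    rfl
  rw [h1, ← range_trHom, ← h2, h3]
  congr 1
  rw [Subgroup.card_top, Nat.card_eq_fintype_card]
  rfl

/-! ### Types of subgroups -/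

/-- A subgroup is of torus type if it consists of translations. -/
def IsTorus (K : Subgroup HW) : Prop := ∀ g ∈ K, Even g.x ∧ Even g.y

/-- A subgroup is of half-turn type along the third axis. -/
def IsHalfTurn (K : Subgroup HW) : Prop := (∀ g ∈ K, Even g.x) ∧ ∃ g ∈ K, Odd g.z

/-- A subgroup is of Hantzsche-Wendt type if it contains screw motions along all axes. -/
def IsFull (K : Subgroup HW) : Prop :=
  (∃ g ∈ K, Odd g.x ∧ Even g.y) ∧ ∃ g ∈ K, Odd g.x ∧ Odd g.y

theorem IsHalfTurn.odd_y_iff {K : Subgroup HW} (hK : IsHalfTurn K) {g : HW} (hg : g ∈ K) :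
    Odd g.y ↔ Odd g.z := by
  have h1 := hK.1 g hg
  have h2 := g.even
  simp only [Int.even_add, h1, true_iff] at h2
  rw [← Int.not_even_iff_odd, ← Int.not_even_iff_odd]
  tauto

theorem IsTorus.index {K : Subgroup HW} (hK : IsTorus K) : K.index = 4 * (lattice K).index := by
  have h := card_map_parity_mul_index K
  have h1 : K.map parity = ⊥ := by
    rw [eq_bot_iff]
    rintro _ ⟨g, hg, rfl⟩
    exact parity_eq_one_iff.2 (hK g hg)
  rw [h1, Subgroup.card_bot] at h
  omega

theorem IsHalfTurn.index {K : Subgroup HW} (hK : IsHalfTurn K) :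
    K.index = 2 * (lattice K).index := by
  have h := card_map_parity_mul_index K
  obtain ⟨g, hg, hgz⟩ := hK.2
  have hgy := (hK.odd_y_iff hg).2 hgz
  have h0 : ∀ n : ℤ, Even n → (n : ZMod 2) = 0 := fun n => ZMod.intCast_eq_zero_iff_even.2
  have h1 : ∀ n : ℤ, Odd n → (n : ZMod 2) = 1 := fun n => ZMod.intCast_eq_one_iff_odd.2
  have h2 : (K.map parity : Set (Multiplicative (ZMod 2 × ZMod 2))) =
      {Multiplicative.ofAdd (0, 0), Multiplicative.ofAdd (0, 1)} := by
    ext w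
    constructor
    · rintro ⟨k, hk, rfl⟩
      rw [parity_apply, h0 _ (hK.1 k hk)]
      rcases Int.even_or_odd k.y with hy | hy
      · rw [h0 _ hy]
        exact Or.inl rfl
      · rw [h1 _ hy]
        exact Or.inr rfl
    · rintro (rfl | rfl)
      · exact (K.map parity).one_mem
      · exact ⟨g, hg, by rw [parity_apply, h0 _ (hK.1 g hg), h1 _ hgy]⟩
  have h3 : Nat.card (K.map parity) = 2 := by
    change Nat.card (K.map parity : Set (Multiplicative (ZMod 2 × ZMod 2))) = 2
    rw [h2, Nat.card_coe_set_eq, Set.ncard_pair]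
    decide
  rw [h3] at h
  omega

theorem IsFull.index {K : Subgroup HW} (hK : IsFull K) : K.index = (lattice K).index := by
  have h := card_map_parity_mul_index K
  obtain ⟨⟨g, hg, hgx, hgy⟩, k, hk, hkx, hky⟩ := hK
  have h0 : ∀ n : ℤ, Even n → (n : ZMod 2) = 0 := fun n => ZMod.intCast_eq_zero_iff_even.2
  have h1 : ∀ n : ℤ, Odd n → (n : ZMod 2) = 1 := fun n => ZMod.intCast_eq_one_iff_odd.2
  have hg' : Multiplicative.ofAdd (1, 0) ∈ K.map parity :=
    ⟨g, hg, by rw [parity_apply, h0 _ hgy, h1 _ hgx]⟩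
  have hk' : Multiplicative.ofAdd (1, 1) ∈ K.map parity :=
    ⟨k, hk, by rw [parity_apply, h1 _ hky, h1 _ hkx]⟩
  have h2 : K.map parity = ⊤ := by
    rw [eq_top_iff]
    intro w _
    have : ∀ w : Multiplicative (ZMod 2 × ZMod 2), w = 1 ∨ w = Multiplicative.ofAdd (1, 0) ∨
        w = Multiplicative.ofAdd (1, 1) ∨
        w = Multiplicative.ofAdd (1, 0) * Multiplicative.ofAdd (1, 1) := by
      decide
    rcases this w with rfl | rfl | rfl | rfl
    · exact one_mem _
    · exact hg'
    · exact hk'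
    · exact mul_mem hg' hk'
  rw [h2, Subgroup.card_top, Nat.card_eq_fintype_card,
    show Fintype.card (Multiplicative (ZMod 2 × ZMod 2)) = 4 from rfl] at h
  omega

/-! ### The cyclic symmetry of the axes and the three types. -/

/-- The cyclic permutation of the coordinates. -/
def rot : HW ≃* HW where
  toFun g := ⟨g.y, g.z, g.x, by have := g.even; rwa [add_assoc, add_comm] at this⟩
  invFun g := ⟨g.z, g.x, g.y, by have := g.even; rwa [add_comm, ← add_assoc] at this⟩
  left_inv _ := rfl
  right_inv _ := rfl
  map_mul' _ _ := rfl

@[simp] theorem rot_x (g : HW) : (rot g).x = g.y := rfl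
@[simp] theorem rot_y (g : HW) : (rot g).y = g.z := rfl
@[simp] theorem rot_z (g : HW) : (rot g).z = g.x := rfl

/-- The image of a subgroup under the cyclic permutation of the coordinates. -/
def rotate (K : Subgroup HW) : Subgroup HW := K.map rot.toMonoidHom

theorem forall_mem_rotate {K : Subgroup HW} {P : HW → Prop} :
    (∀ g ∈ rotate K, P g) ↔ ∀ g ∈ K, P (rot g) := by
  constructor
  · intro h g hg
    exact h _ ⟨g, hg, rfl⟩
  · rintro h _ ⟨g, hg, rfl⟩
    exact h g hg

theorem exists_mem_rotate {K : Subgroup HW} {P : HW → Prop} :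
    (∃ g ∈ rotate K, P g) ↔ ∃ g ∈ K, P (rot g) := by
  constructor
  · rintro ⟨_, ⟨g, hg, rfl⟩, h⟩
    exact ⟨g, hg, h⟩
  · rintro ⟨g, hg, h⟩
    exact ⟨_, ⟨g, hg, rfl⟩, h⟩

theorem index_rotate (K : Subgroup HW) : (rotate K).index = K.index :=
  Subgroup.index_map_of_bijective rot.bijective K

theorem rotate_injective : Function.Injective rotate := Subgroup.map_injective rot.injective

theorem rotate_rotate_rotate (K : Subgroup HW) : rotate (rotate (rotate K)) = K := by
  ext g
  constructor
  · rintro ⟨_, ⟨_, ⟨k, hk, rfl⟩, rfl⟩, rfl⟩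
    exact hk
  · intro hg
    exact ⟨_, ⟨_, ⟨g, hg, rfl⟩, rfl⟩, rfl⟩

/-- The Klein four-group has only the trivial subgroup, three subgroups of order two, which `rotate`
permutes cyclically, and itself. -/
theorem type_cases (K : Subgroup HW) : IsTorus K ∨ (IsHalfTurn K ∨ IsHalfTurn (rotate K) ∨
    IsHalfTurn (rotate (rotate K))) ∨ IsFull K := by
  have hpar : ∀ g : HW, (Even g.x ∧ Even g.y ∧ Even g.z) ∨ (Odd g.x ∧ Even g.y ∧ Odd g.z) ∨
      (Odd g.x ∧ Odd g.y ∧ Even g.z) ∨ (Even g.x ∧ Odd g.y ∧ Odd g.z) := by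
    intro g
    have := g.even
    simp only [Int.even_add, ← Int.not_even_iff_odd] at *
    tauto
  simp only [IsTorus, IsHalfTurn, forall_mem_rotate, exists_mem_rotate, rot_x, rot_y, rot_z]
  by_cases h1 : ∃ g ∈ K, Odd g.x ∧ Even g.y
  · by_cases h2 : ∃ g ∈ K, Odd g.y
    · right; right
      obtain ⟨g, hg, hx, hy⟩ := h1
      obtain ⟨k, hk, hky⟩ := h2
      refine ⟨⟨g, hg, hx, hy⟩, ?_⟩
      rcases Int.even_or_odd k.x with hkx | hkx
      · refine ⟨g * k, K.mul_mem hg hk, ?_, ?_⟩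
        · simp only [← Int.not_even_iff_odd, mul_x, Int.even_add, even_sg_mul] at *
          tauto
        · simp only [← Int.not_even_iff_odd, mul_y, Int.even_add, even_sg_mul] at *
          tauto
      · exact ⟨k, hk, hkx, hky⟩
    · right; left; right; left
      refine ⟨fun g hg => Int.not_odd_iff_even.1 fun h => h2 ⟨g, hg, h⟩, ?_⟩
      obtain ⟨g, hg, hx, -⟩ := h1
      exact ⟨g, hg, hx⟩
  · by_cases h2 : ∃ g ∈ K, Odd g.x ∧ Odd g.y
    · by_cases h3 : ∃ g ∈ K, Odd g.z
      · exfalso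
        obtain ⟨g, hg, hx, hy⟩ := h2
        obtain ⟨k, hk, hkz⟩ := h3
        apply h1
        rcases hpar k with h | h | h | h
        · exact absurd h.2.2 (Int.not_even_iff_odd.2 hkz)
        · exact ⟨k, hk, h.1, h.2.1⟩
        · exact absurd h.2.2 (Int.not_even_iff_odd.2 hkz)
        · refine ⟨g * k, K.mul_mem hg hk, ?_, ?_⟩
          · simp only [← Int.not_even_iff_odd, mul_x, Int.even_add, even_sg_mul] at *
            tauto
          · simp only [← Int.not_even_iff_odd, mul_y, Int.even_add, even_sg_mul] at *
            tauto
      · right; left; right; right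
        refine ⟨fun g hg => Int.not_odd_iff_even.1 fun h => h3 ⟨g, hg, h⟩, ?_⟩
        obtain ⟨g, hg, -, hy⟩ := h2
        exact ⟨g, hg, hy⟩
    · have hx : ∀ g ∈ K, Even g.x := fun g hg => Int.not_odd_iff_even.1 fun h => by
        rcases Int.even_or_odd g.y with hy | hy
        · exact h1 ⟨g, hg, h, hy⟩
        · exact h2 ⟨g, hg, h, hy⟩
      by_cases h3 : ∃ g ∈ K, Odd g.z
      · right; left; left
        exact ⟨hx, h3⟩
      · left
        intro g hg
        refine ⟨hx g hg, ?_⟩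
        rcases hpar g with h | h | h | h
        · exact h.2.1
        · exact h.2.1
        · exact absurd (hx g hg) (Int.not_even_iff_odd.2 h.1)
        · exact absurd ⟨g, hg, h.2.2⟩ h3

theorem mem_conj {H : Type*} [Group H] {h k : H} {K : Subgroup H} :
    k ∈ ConjAct.toConjAct h • K ↔ ∃ g ∈ K, h * g * h⁻¹ = k := Iff.rfl

/-! ### The geometric action -/

theorem ext_E3 {v w : E3} : v = w ↔ v 0 = w 0 ∧ v 1 = w 1 ∧ v 2 = w 2 := by
  constructor
  · rintro rfl
    exact ⟨rfl, rfl, rfl⟩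
  · rintro ⟨h0, h1, h2⟩
    ext i
    fin_cases i <;> assumption

/-- The motion with given integer coordinates. -/
noncomputable def motionOf (g : HW) : E3 ≃ᵢ E3 :=
  motion ![g.y.negOnePow, g.z.negOnePow, g.x.negOnePow] !₂[(g.x : ℝ), g.y, g.z]

theorem motionOf_apply (g : HW) (v : E3) : motionOf g v =
    !₂[sg g.y * v 0 + g.x, sg g.z * v 1 + g.y, sg g.x * v 2 + g.z] := motion_apply _ _ _

/-- The group in integer coordinates as a group of motions. -/
noncomputable def toMotion : HW →* (E3 ≃ᵢ E3) where
  toFun := motionOf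
  map_one' := by
    apply IsometryEquiv.ext
    intro v
    rw [motionOf_apply, ext_E3]
    simp [sg_of_even]
  map_mul' g h := by
    apply IsometryEquiv.ext
    intro v
    change _ = motionOf g (motionOf h v)
    simp only [motionOf_apply, ext_E3, mul_x, mul_y, mul_z, sg_add, sg_sg_mul]
    refine ⟨?_, ?_, ?_⟩ <;> simp <;> ring

noncomputable instance : MulAction HW E3 := MulAction.compHom E3 toMotion

theorem smul_zero_apply (g : HW) (v : E3) : (g • v) 0 = sg g.y * v 0 + g.x := by
  change (motionOf g v) 0 = _
  rw [motionOf_apply]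
  rfl

theorem smul_one_apply (g : HW) (v : E3) : (g • v) 1 = sg g.z * v 1 + g.y := by
  change (motionOf g v) 1 = _
  rw [motionOf_apply]
  rfl

theorem smul_two_apply (g : HW) (v : E3) : (g • v) 2 = sg g.x * v 2 + g.z := by
  change (motionOf g v) 2 = _
  rw [motionOf_apply]
  rfl

theorem smul_eq_iff {g : HW} {v w : E3} : g • v = w ↔ sg g.y * v 0 + g.x = w 0 ∧
    sg g.z * v 1 + g.y = w 1 ∧ sg g.x * v 2 + g.z = w 2 := by
  rw [ext_E3, smul_zero_apply, smul_one_apply, smul_two_apply]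

theorem tr_zpow (u : ℤ × ℤ × ℤ) (n : ℤ) : tr u ^ n = tr (n • u) :=
  (trHom.map_zpow (Multiplicative.ofAdd u) n).symm

/-- The squares of the three screw motions are the basic translations, and multiplying `g` by the
generator of the same parity, or by 1, leaves a translation. -/
theorem mem_closure_generators (g : HW) :
    g ∈ Subgroup.closure ({⟨1, 0, 1, by decide⟩, ⟨1, 1, 0, by decide⟩,
      ⟨0, 1, 1, by decide⟩} : Set HW) := by
  set C := Subgroup.closure ({⟨1, 0, 1, by decide⟩, ⟨1, 1, 0, by decide⟩,
      ⟨0, 1, 1, by decide⟩} : Set HW)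
  have g1 : (⟨1, 0, 1, by decide⟩ : HW) ∈ C := Subgroup.subset_closure (by simp)
  have g2 : (⟨1, 1, 0, by decide⟩ : HW) ∈ C := Subgroup.subset_closure (by simp)
  have g3 : (⟨0, 1, 1, by decide⟩ : HW) ∈ C := Subgroup.subset_closure (by simp)
  have sq : ∀ k : HW, k ∈ C → ∀ u, tr u = k * k → tr u ∈ C := fun k hk u hu => by
    rw [hu]
    exact C.mul_mem hk hk
  have e1 : tr (1, 0, 0) ∈ C := sq _ g1 _ (by ext <;> simp [sg_of_even, sg_of_odd])
  have e2 : tr (0, 1, 0) ∈ C := sq _ g2 _ (by ext <;> simp [sg_of_even, sg_of_odd])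
  have e3 : tr (0, 0, 1) ∈ C := sq _ g3 _ (by ext <;> simp [sg_of_even, sg_of_odd])
  have ht : ∀ u, tr u ∈ C := by
    rintro ⟨a, b, c⟩
    have : tr (a, b, c) = tr (1, 0, 0) ^ a * tr (0, 1, 0) ^ b * tr (0, 0, 1) ^ c := by
      rw [tr_zpow, tr_zpow, tr_zpow, ← tr_add, ← tr_add]
      simp
    rw [this]
    exact C.mul_mem (C.mul_mem (C.zpow_mem e1 a) (C.zpow_mem e2 b)) (C.zpow_mem e3 c)
  have hred : ∀ k ∈ C, Even (g * k).x → Even (g * k).y → g ∈ C := fun k hk hx hy => by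
    obtain ⟨u, hu⟩ := exists_tr hx hy
    rw [eq_mul_inv_of_mul_eq hu]
    exact C.mul_mem (ht u) (C.inv_mem hk)
  rcases Int.even_or_odd g.x with hx | hx <;> rcases Int.even_or_odd g.y with hy | hy
  · exact hred 1 C.one_mem (by simpa using hx) (by simpa using hy)
  · refine hred _ g3 ?_ ?_ <;>
      simp only [mul_x, mul_y, Int.even_add, even_sg_mul, ← Int.not_even_iff_odd] at * <;> simp_all
  · refine hred _ g1 ?_ ?_ <;>
      simp only [mul_x, mul_y, Int.even_add, even_sg_mul, ← Int.not_even_iff_odd] at * <;> simp_all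
  · refine hred _ g2 ?_ ?_ <;>
      simp only [mul_x, mul_y, Int.even_add, even_sg_mul, ← Int.not_even_iff_odd] at * <;> simp_all

theorem Gamma6_eq_range : Gamma6 = toMotion.range := by
  have h1 : S1 = toMotion ⟨1, 0, 1, by decide⟩ := by
    apply IsometryEquiv.ext
    intro v
    change _ = motionOf _ v
    simp only [S1, motionOf, motion_apply]
    ext i
    fin_cases i <;> simp
  have h2 : S2 = toMotion ⟨1, 1, 0, by decide⟩ := by
    apply IsometryEquiv.ext
    intro v
    change _ = motionOf _ v
    simp only [S2, motionOf, motion_apply]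
    ext i
    fin_cases i <;> simp
  have h3 : S3 = toMotion ⟨0, 1, 1, by decide⟩ := by
    apply IsometryEquiv.ext
    intro v
    change _ = motionOf _ v
    simp only [S3, motionOf, motion_apply]
    ext i
    fin_cases i <;> simp
  rw [Gamma6, h1, h2, h3, MonoidHom.range_eq_map, ← (Subgroup.eq_top_iff' _).2
    mem_closure_generators, MonoidHom.map_closure, Set.image_insert_eq, Set.image_pair]

/-- The projection to the Hantzsche-Wendt manifold. -/
noncomputable def proj6 : E3 → G6 := Quotient.mk (MulAction.orbitRel Gamma6 E3)

theorem proj6_eq_iff (v w : E3) : proj6 v = proj6 w ↔ v ∈ MulAction.orbit HW w := by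
  rw [proj6, Quotient.eq]
  change v ∈ MulAction.orbit Gamma6 w ↔ _
  constructor
  · rintro ⟨⟨g, hg⟩, rfl⟩
    rw [Gamma6_eq_range] at hg
    obtain ⟨k, rfl⟩ := hg
    exact ⟨k, rfl⟩
  · rintro ⟨g, rfl⟩
    refine ⟨⟨toMotion g, ?_⟩, rfl⟩
    rw [Gamma6_eq_range]
    exact ⟨g, rfl⟩

theorem abs_apply_le_norm (v : E3) (i : Fin 3) : |v i| ≤ ‖v‖ := by
  simpa using PiLp.norm_apply_le v i

/-- A coordinate that is not reversed moves by an integer, which must vanish. So even `y` forces `x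
= 0`, even `z` forces `y = 0` and even `x` forces `z = 0`. Some component is even because the sum
is, and from it the implications run around the cycle. -/
theorem eq_one_of_dist_lt {g : HW} {v : E3} (h : dist (g • v) v < 1) : g = 1 := by
  have hcoord : ∀ i, |(g • v) i - v i| < 1 := fun i => by
    refine lt_of_le_of_lt ?_ h
    rw [dist_eq_norm]
    simpa using abs_apply_le_norm (g • v - v) i
  have hint : ∀ n : ℤ, |(n : ℝ)| < 1 → n = 0 := fun n hn => by
    have : |n| < 1 := by exact_mod_cast hn
    exact Int.abs_lt_one_iff.1 this
  have h0 := hcoord 0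
  have h1 := hcoord 1
  have h2 := hcoord 2
  rw [smul_zero_apply] at h0
  rw [smul_one_apply] at h1
  rw [smul_two_apply] at h2
  have key : ∀ m n : ℤ, ∀ t : ℝ, Even m → |(sg m : ℝ) * t + n - t| < 1 → n = 0 := by
    intro m n t hm ht
    apply hint
    rw [sg_of_even hm] at ht
    simpa using ht
  have hx : Even g.y → g.x = 0 := fun h => key _ _ _ h h0
  have hy : Even g.z → g.y = 0 := fun h => key _ _ _ h h1
  have hz : Even g.x → g.z = 0 := fun h => key _ _ _ h h2
  have he := g.even
  have : Even g.x ∧ Even g.y ∧ Even g.z := by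
    by_cases hxe : Even g.x
    · have := hz hxe
      have hze : Even g.z := by rw [this]; simp
      have := hy hze
      exact ⟨hxe, by rw [this]; simp, hze⟩
    · by_cases hye : Even g.y
      · exact absurd (by rw [hx hye]; simp) hxe
      · have hze : Even g.z := by
          simp only [Int.even_add, hxe, hye] at he
          simpa using he
        exact absurd (by rw [hy hze]; simp) hye
  ext
  · exact hx this.2.1
  · exact hy this.2.2
  · exact hz this.1

theorem isQuotientCoveringMap_proj6 : IsQuotientCoveringMap proj6 HW where
  __ := isQuotientMap_quotient_mk'
  continuous_const_smul g := (toMotion g).continuous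
  apply_eq_iff_mem_orbit {v w} := proj6_eq_iff v w
  disjoint v := by
    refine ⟨Metric.ball v (1 / 2), Metric.ball_mem_nhds v (by norm_num), fun g hg => ?_⟩
    obtain ⟨_, ⟨w, hw, rfl⟩, hw'⟩ := hg
    apply eq_one_of_dist_lt (v := w)
    rw [Metric.mem_ball] at hw hw'
    have := dist_triangle_right (g • w) w v
    dsimp only at hw'
    linarith

/-! ### Subgroups of Hantzsche-Wendt type -/

theorem int_subgroup_eq (S : AddSubgroup ℤ) : S = AddSubgroup.zmultiples (S.index : ℤ) := by
  obtain ⟨g, hg⟩ := Int.subgroup_cyclic S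
  rw [← AddSubgroup.zmultiples_eq_closure, ← Int.zmultiples_natAbs] at hg
  have : S.index = g.natAbs := by rw [hg, Int.index_zmultiples, Int.natAbs_natCast]
  rw [this, ← hg]

/-- The first components of the elements whose linear part fixes the first axis. -/
def axisComp (K : Subgroup HW) : AddSubgroup ℤ where
  carrier := {x | ∃ g ∈ K, Even g.y ∧ g.x = x}
  zero_mem' := ⟨1, K.one_mem, by simp, rfl⟩
  add_mem' := by
    rintro _ _ ⟨g, hg, hy, rfl⟩ ⟨h, hh, hy', rfl⟩
    refine ⟨g * h, K.mul_mem hg hh, ?_, ?_⟩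
    · rw [mul_y, Int.even_add, even_sg_mul]
      tauto
    · rw [mul_x, sg_of_even hy, one_mul]
  neg_mem' := by
    rintro _ ⟨g, hg, hy, rfl⟩
    refine ⟨g⁻¹, K.inv_mem hg, ?_, ?_⟩
    · rwa [inv_y, even_neg, even_sg_mul]
    · rw [inv_x, sg_of_even hy, one_mul]

/-- The positive generator of the group of translation lengths along the first axis. -/
noncomputable def axisIdx (K : Subgroup HW) : ℕ := (axisComp K).index

theorem axisIdx_dvd {K : Subgroup HW} {g : HW} (hg : g ∈ K) (hy : Even g.y) :
    (axisIdx K : ℤ) ∣ g.x := by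
  rw [← Int.mem_zmultiples_iff, axisIdx, ← int_subgroup_eq]
  exact ⟨g, hg, hy, rfl⟩

theorem exists_axisIdx (K : Subgroup HW) : ∃ g ∈ K, Even g.y ∧ g.x = axisIdx K := by
  have : (axisIdx K : ℤ) ∈ axisComp K := by
    rw [int_subgroup_eq (axisComp K)]
    exact AddSubgroup.mem_zmultiples _
  exact this

theorem axisIdx_eq {K : Subgroup HW} {a : ℕ} (h1 : ∀ g ∈ K, Even g.y → (a : ℤ) ∣ g.x)
    (h2 : ∃ g ∈ K, Even g.y ∧ g.x = a) : axisIdx K = a := by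
  obtain ⟨g, hg, hy, hx⟩ := h2
  obtain ⟨k, hk, hky, hkx⟩ := exists_axisIdx K
  refine Nat.dvd_antisymm ?_ ?_
  · have := axisIdx_dvd hg hy
    rw [hx] at this
    exact Int.natCast_dvd_natCast.1 this
  · have := h1 k hk hky
    rw [hkx] at this
    exact Int.natCast_dvd_natCast.1 this

/-- On elements that preserve the direction of the first axis, conjugation only multiplies the first
component by a sign. -/
theorem axisIdx_conj (h : HW) (K : Subgroup HW) :
    axisIdx (ConjAct.toConjAct h • K) = axisIdx K := by
  have hx : ∀ g : HW, Even g.y → (h * g * h⁻¹).x = sg h.y * g.x := fun g hy => by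
    rw [conj_x, sg_of_even hy]
    ring
  have hy : ∀ g : HW, Even g.y → Even (h * g * h⁻¹).y := fun g hy => by
    rw [conj_y]
    simp only [Int.even_add, Int.even_sub, even_sg_mul, hy]
    tauto
  have hy' : ∀ g : HW, Even (h * g * h⁻¹).y → Even g.y := fun g hy => by
    rw [conj_y] at hy
    simp only [Int.even_add, Int.even_sub, even_sg_mul] at hy
    tauto
  apply axisIdx_eq
  · rintro k hk hke
    obtain ⟨g, hg, rfl⟩ := mem_conj.1 hk
    rw [hx g (hy' g hke), dvd_sg_mul]
    exact axisIdx_dvd hg (hy' g hke)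
  · obtain ⟨g, hg, hgy, hgx⟩ := exists_axisIdx K
    rcases sg_eq_or h.y with hs | hs
    · exact ⟨_, mem_conj.2 ⟨g, hg, rfl⟩, hy g hgy, by rw [hx g hgy, hs, one_mul, hgx]⟩
    · refine ⟨_, mem_conj.2 ⟨g⁻¹, K.inv_mem hg, rfl⟩, ?_, ?_⟩
      · apply hy
        rwa [inv_y, even_neg, even_sg_mul]
      · rw [hx, hs, inv_x, sg_of_even hgy, hgx]
        · ring
        · rwa [inv_y, even_neg, even_sg_mul]

theorem rotate_conj (h : HW) (K : Subgroup HW) :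
    rotate (ConjAct.toConjAct h • K) = ConjAct.toConjAct (rot h) • rotate K := by
  ext g
  constructor
  · rintro ⟨_, ⟨k, hk, rfl⟩, rfl⟩
    exact ⟨rot k, ⟨k, hk, rfl⟩, rfl⟩
  · rintro ⟨_, ⟨k, hk, rfl⟩, rfl⟩
    exact ⟨_, ⟨k, hk, rfl⟩, rfl⟩

theorem IsFull.rotate {K : Subgroup HW} (hK : IsFull K) : IsFull (rotate K) := by
  obtain ⟨⟨g, hg, hgx, hgy⟩, k, hk, hkx, hky⟩ := hK
  rw [IsFull, exists_mem_rotate, exists_mem_rotate]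
  have h1 := g.even
  have h2 := k.even
  refine ⟨⟨k, hk, hky, ?_⟩, ⟨g * k, K.mul_mem hg hk, ?_, ?_⟩⟩ <;>
    simp only [rot_x, rot_y, mul_y, mul_z, ← Int.not_even_iff_odd, Int.even_add,
      even_sg_mul] at * <;>
    tauto

theorem IsFull.odd_axisIdx {K : Subgroup HW} (hK : IsFull K) : Odd (axisIdx K) := by
  obtain ⟨g, hg, hx, hy⟩ := hK.1
  obtain ⟨c, hc⟩ := axisIdx_dvd hg hy
  rw [hc, Int.odd_mul] at hx
  exact_mod_cast hx.1

/-- The subgroup of all elements whose components are divisible by given numbers. -/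
def diagSub (a b c : ℕ) : Subgroup HW where
  carrier := {g | (a : ℤ) ∣ g.x ∧ (b : ℤ) ∣ g.y ∧ (c : ℤ) ∣ g.z}
  one_mem' := ⟨dvd_zero _, dvd_zero _, dvd_zero _⟩
  mul_mem' {_ _} hg hh := ⟨dvd_add hg.1 (dvd_sg_mul.2 hh.1), dvd_add hg.2.1 (dvd_sg_mul.2 hh.2.1),
    dvd_add hg.2.2 (dvd_sg_mul.2 hh.2.2)⟩
  inv_mem' {_} hg := ⟨(dvd_neg.2 (dvd_sg_mul.2 hg.1)), (dvd_neg.2 (dvd_sg_mul.2 hg.2.1)),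
    (dvd_neg.2 (dvd_sg_mul.2 hg.2.2))⟩

theorem mem_diagSub {a b c : ℕ} {g : HW} :
    g ∈ diagSub a b c ↔ (a : ℤ) ∣ g.x ∧ (b : ℤ) ∣ g.y ∧ (c : ℤ) ∣ g.z := Iff.rfl

theorem rotate_diagSub (a b c : ℕ) : rotate (diagSub a b c) = diagSub b c a := by
  ext g
  constructor
  · rintro ⟨k, hk, rfl⟩
    exact ⟨hk.2.1, hk.2.2, hk.1⟩
  · rintro hg
    exact ⟨rot.symm g, ⟨hg.2.2, hg.1, hg.2.1⟩, rfl⟩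

theorem isFull_diagSub {a b c : ℕ} (ha : Odd a) (hb : Odd b) (hc : Odd c) :
    IsFull (diagSub a b c) := by
  have ha : Odd (a : ℤ) := by exact_mod_cast ha
  have hb : Odd (b : ℤ) := by exact_mod_cast hb
  have hc : Odd (c : ℤ) := by exact_mod_cast hc
  exact ⟨⟨⟨a, 0, c, by simpa using ha.add_odd hc⟩, ⟨dvd_rfl, dvd_zero _, dvd_rfl⟩, ha, by simp⟩,
    ⟨⟨a, b, 0, by simpa using ha.add_odd hb⟩, ⟨dvd_rfl, dvd_rfl, dvd_zero _⟩, ha, hb⟩⟩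

theorem axisIdx_diagSub {a b c : ℕ} (ha : Odd a) (hc : Odd c) : axisIdx (diagSub a b c) = a := by
  have ha : Odd (a : ℤ) := by exact_mod_cast ha
  have hc : Odd (c : ℤ) := by exact_mod_cast hc
  exact axisIdx_eq (fun g hg _ => hg.1) ⟨⟨a, 0, c, by simpa using ha.add_odd hc⟩,
    ⟨dvd_rfl, dvd_zero _, dvd_rfl⟩, by simp, rfl⟩

theorem odd_dvd_two_mul {a : ℕ} (ha : Odd a) {n : ℤ} : (a : ℤ) ∣ 2 * n ↔ (a : ℤ) ∣ n := by
  have h : IsCoprime (a : ℤ) ((2 : ℕ) : ℤ) :=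
    Nat.isCoprime_iff_coprime.2 (Nat.coprime_two_right.2 ha)
  exact ⟨IsCoprime.dvd_of_dvd_mul_left h, fun h => h.mul_left 2⟩

/-- The step is 4 because conjugation by `tr` shifts a reversed component by twice an even number.
-/
theorem exists_dvd_add_four_mul {a : ℕ} (ha : Odd a) (n : ℤ) : ∃ t : ℤ, (a : ℤ) ∣ n + 4 * t := by
  have h : IsCoprime (a : ℤ) ((2 ^ 2 : ℕ) : ℤ) :=
    Nat.isCoprime_iff_coprime.2 (Nat.Coprime.pow_right 2 (Nat.coprime_two_right.2 ha))
  obtain ⟨u, v, huv⟩ := h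
  exact ⟨-n * v, n * u, by push_cast at huv; linear_combination (-n) * huv⟩

theorem index_diagSub {a b c : ℕ} (ha : Odd a) (hb : Odd b) (hc : Odd c) :
    (diagSub a b c).index = a * b * c := by
  rw [(isFull_diagSub ha hb hc).index]
  have : lattice (diagSub a b c) = (AddSubgroup.zmultiples (a : ℤ)).prod
      ((AddSubgroup.zmultiples (b : ℤ)).prod (AddSubgroup.zmultiples (c : ℤ))) := by
    ext u
    rw [mem_lattice, mem_diagSub, AddSubgroup.mem_prod, AddSubgroup.mem_prod]
    simp only [tr_x, tr_y, tr_z, odd_dvd_two_mul ha, odd_dvd_two_mul hb, odd_dvd_two_mul hc,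
      Int.mem_zmultiples_iff]
  rw [this, AddSubgroup.index_prod, AddSubgroup.index_prod, Int.index_zmultiples,
    Int.index_zmultiples, Int.index_zmultiples]
  simp [mul_assoc]

/-- The elements `1`, `g1`, `g2` and `g1 * g2` represent all parity classes. Hence two subgroups
that share `g1` and `g2` are equal once they have the same translations. -/
theorem exists_mul_tr {S : Subgroup HW} {g1 g2 : HW} (h1 : g1 ∈ S) (h2 : g2 ∈ S)
    (h1x : Odd g1.x) (h1y : Even g1.y) (h2x : Odd g2.x) (h2y : Odd g2.y) (g : HW) :
    ∃ k, (k = 1 ∨ k = g1 ∨ k = g2 ∨ k = g1 * g2) ∧ k ∈ S ∧ ∃ u, g * k = tr u := by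
  rcases Int.even_or_odd g.x with hx | hx <;> rcases Int.even_or_odd g.y with hy | hy
  · refine ⟨1, by tauto, S.one_mem, exists_tr ?_ ?_⟩ <;>
      simp only [mul_one] <;> assumption
  · refine ⟨g1 * g2, by tauto, S.mul_mem h1 h2, exists_tr ?_ ?_⟩ <;>
      simp only [mul_x, mul_y, Int.even_add, even_sg_mul, ← Int.not_even_iff_odd] at * <;> tauto
  · refine ⟨g1, by tauto, h1, exists_tr ?_ ?_⟩ <;>
      simp only [mul_x, mul_y, Int.even_add, even_sg_mul, ← Int.not_even_iff_odd] at * <;> tauto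
  · refine ⟨g2, by tauto, h2, exists_tr ?_ ?_⟩ <;>
      simp only [mul_x, mul_y, Int.even_add, even_sg_mul, ← Int.not_even_iff_odd] at * <;> tauto

/-- An element realizing the odd number `axisIdx K` is a screw motion, and its square is the pure
translation by twice that length. -/
theorem tr_axis_mem {K : Subgroup HW} (h : Odd (axisIdx K)) (i : ℤ) :
    tr (i * axisIdx K, 0, 0) ∈ K := by
  obtain ⟨g, hg, hy, hx⟩ := exists_axisIdx K
  have hxo : Odd g.x := by rw [hx]; exact_mod_cast h
  have hzo : Odd g.z := by
    have := g.even
    simp only [Int.even_add, ← Int.not_even_iff_odd] at *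
    tauto
  have : tr ((axisIdx K : ℤ), 0, 0) = g * g := by
    ext
    · simp only [tr_x, mul_x, sg_of_even hy, hx]
      ring
    · simp [sg_of_odd hzo]
    · simp [sg_of_odd hxo]
  have h2 : tr ((axisIdx K : ℤ), 0, 0) ∈ K := by
    rw [this]
    exact K.mul_mem hg hg
  have h3 := K.zpow_mem h2 i
  rw [tr_zpow] at h3
  simpa using h3

/-- The translations of `K` form exactly a box lattice: divisibility holds by definition of the
three lengths, and `tr_axis_mem` along each axis supplies the generators. -/
theorem eq_diagSub {K : Subgroup HW} {a b c : ℕ} (ha : axisIdx K = a)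
    (hb : axisIdx (rotate K) = b) (hc : axisIdx (rotate (rotate K)) = c)
    (hao : Odd a) (hbo : Odd b) (hco : Odd c) {g1 g2 : HW}
    (h1 : g1 ∈ K) (h2 : g2 ∈ K) (h1x : Odd g1.x) (h1y : Even g1.y) (h2x : Odd g2.x)
    (h2y : Odd g2.y) (h1d : g1 ∈ diagSub a b c) (h2d : g2 ∈ diagSub a b c) :
    K = diagSub a b c := by
  have htr : ∀ u, tr u ∈ K ↔ tr u ∈ diagSub a b c := by
    intro u
    constructor
    · intro hu
      refine ⟨?_, ?_, ?_⟩
      · rw [← ha]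
        exact axisIdx_dvd hu (even_two_mul _)
      · rw [← hb]
        exact axisIdx_dvd (g := rot (tr u)) ⟨_, hu, rfl⟩ (even_two_mul _)
      · rw [← hc]
        exact axisIdx_dvd (g := rot (rot (tr u))) ⟨_, ⟨_, hu, rfl⟩, rfl⟩ (even_two_mul _)
    · obtain ⟨u1, u2, u3⟩ := u
      rintro ⟨hu1, hu2, hu3⟩
      simp only [tr_x, tr_y, tr_z, odd_dvd_two_mul hao, odd_dvd_two_mul hbo,
        odd_dvd_two_mul hco] at hu1 hu2 hu3
      obtain ⟨i, rfl⟩ := hu1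
      obtain ⟨j, rfl⟩ := hu2
      obtain ⟨k, rfl⟩ := hu3
      have e1 := tr_axis_mem (ha.symm ▸ hao) i
      obtain ⟨v2, hv2, e2⟩ := tr_axis_mem (K := rotate K) (hb.symm ▸ hbo) j
      obtain ⟨_, ⟨v3, hv3, rfl⟩, e3⟩ :=
        tr_axis_mem (K := rotate (rotate K)) (hc.symm ▸ hco) k
      have hv : tr ((a : ℤ) * i, (b : ℤ) * j, (c : ℤ) * k) =
          tr (i * axisIdx K, 0, 0) * v2 * v3 := by
        have e2' : v2 = rot.symm (tr (j * axisIdx (rotate K), 0, 0)) := by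
          rw [← e2]; rfl
        have e3' : v3 = rot.symm (rot.symm (tr (k * axisIdx (rotate (rotate K)), 0, 0))) := by
          rw [← e3]; rfl
        rw [e2', e3', ha, hb, hc]
        ext <;> simp [rot, sg_of_even] <;> ring
      rw [hv]
      exact K.mul_mem (K.mul_mem e1 hv2) hv3
  ext g
  constructor
  · intro hg
    obtain ⟨k, hk, hkK, u, hu⟩ := exists_mul_tr h1 h2 h1x h1y h2x h2y g
    have hkd : k ∈ diagSub a b c := by
      rcases hk with rfl | rfl | rfl | rfl
      · exact one_mem _
      · exact h1d
      · exact h2d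
      · exact mul_mem h1d h2d
    have := (htr u).1 (hu ▸ K.mul_mem hg hkK)
    rw [← hu] at this
    exact (Subgroup.mul_mem_cancel_right _ hkd).1 this
  · intro hg
    obtain ⟨k, hk, hkd, u, hu⟩ := exists_mul_tr h1d h2d h1x h1y h2x h2y g
    have hkK : k ∈ K := by
      rcases hk with rfl | rfl | rfl | rfl
      · exact one_mem _
      · exact h1
      · exact h2
      · exact mul_mem h1 h2
    have := (htr u).2 (hu ▸ mul_mem hg hkd)
    rw [← hu] at this
    exact (Subgroup.mul_mem_cancel_right _ hkK).1 this

/-- Conjugating by `tr (s, t, r)` shifts `g2.x` by `4 * s`, `g1.y` by `4 * t`, and both `g1.z` and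
`g2.z` by `4 * r`, while `g1.x` and `g2.y` stay fixed and are divisible already. Oddness of the
three lengths makes the shifts reach multiples of them. -/
theorem IsFull.exists_conj {K : Subgroup HW} (hK : IsFull K) : ∃ h : HW,
    ConjAct.toConjAct h • K =
      diagSub (axisIdx K) (axisIdx (HW.rotate K)) (axisIdx (HW.rotate (HW.rotate K))) := by
  have hao := hK.odd_axisIdx
  have hbo := hK.rotate.odd_axisIdx
  have hco := hK.rotate.rotate.odd_axisIdx
  set a := axisIdx K with ha
  set b := axisIdx (HW.rotate K) with hb
  set c := axisIdx (HW.rotate (HW.rotate K)) with hc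
  obtain ⟨⟨g1, hg1, h1x, h1y⟩, g2, hg2, h2x, h2y⟩ := hK
  have h1z : Odd g1.z := by
    have := g1.even
    simp only [Int.even_add, ← Int.not_even_iff_odd] at *
    tauto
  have h2z : Even g2.z := by
    have := g2.even
    simp only [Int.even_add, ← Int.not_even_iff_odd] at *
    tauto
  obtain ⟨s, hs⟩ := exists_dvd_add_four_mul hao g2.x
  obtain ⟨t, ht⟩ := exists_dvd_add_four_mul hbo g1.y
  obtain ⟨r, hr⟩ := exists_dvd_add_four_mul hco g1.z
  -- One `r` serves both elements, because `g1 * g2` preserves the direction of the third axis and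
  -- its component `g1.z - g2.z` is therefore a multiple of `c`.
  have hr2 : (c : ℤ) ∣ g2.z + 4 * r := by
    have h12 := axisIdx_dvd (K := HW.rotate (HW.rotate K)) (g := rot (rot (g1 * g2)))
      ⟨_, ⟨_, K.mul_mem hg1 hg2, rfl⟩, rfl⟩ (by
        simp only [rot_y, rot_z, mul_x, Int.even_add, even_sg_mul, ← Int.not_even_iff_odd] at *
        tauto)
    simp only [rot_x, rot_y, mul_z, sg_of_odd h1x] at h12
    have h := dvd_sub hr h12
    rwa [show g1.z + 4 * r - (g1.z + -1 * g2.z) = g2.z + 4 * r by ring] at h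
  have hx1 := axisIdx_dvd hg1 h1y
  have hy2 := axisIdx_dvd (K := HW.rotate K) (g := rot g2) ⟨_, hg2, rfl⟩ h2z
  rw [← ha] at hx1
  rw [← hb, rot_x] at hy2
  refine ⟨tr (s, t, r), eq_diagSub (g1 := tr (s, t, r) * g1 * (tr (s, t, r))⁻¹)
    (g2 := tr (s, t, r) * g2 * (tr (s, t, r))⁻¹) (axisIdx_conj _ _)
    (by rw [rotate_conj, axisIdx_conj]) (by rw [rotate_conj, rotate_conj, axisIdx_conj])
    hao hbo hco (mem_conj.2 ⟨g1, hg1, rfl⟩) (mem_conj.2 ⟨g2, hg2, rfl⟩) ?_ ?_ ?_ ?_ ?_ ?_⟩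
  · rw [conj_x]
    simpa [sg_two_mul, sg_of_even h1y] using h1x
  · rw [conj_y]
    simp [sg_two_mul, Int.even_add, Int.even_sub, h1y]
  · rw [conj_x, ← Int.not_even_iff_odd]
    simpa [sg_two_mul, Int.even_add, Int.even_sub, even_sg_mul] using h2x
  · rw [conj_y]
    simpa [sg_two_mul, sg_of_even h2z] using h2y
  · rw [mem_diagSub, conj_x, conj_y, conj_z]
    simp only [tr_x, tr_y, tr_z, sg_two_mul, sg_of_even h1y, sg_of_odd h1x, sg_of_odd h1z]
    refine ⟨?_, ?_, ?_⟩
    · convert hx1 using 1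
      ring
    · convert ht using 1
      ring
    · convert hr using 1
      ring
  · rw [mem_diagSub, conj_x, conj_y, conj_z]
    simp only [tr_x, tr_y, tr_z, sg_two_mul, sg_of_even h2z, sg_of_odd h2x, sg_of_odd h2y]
    refine ⟨?_, ?_, ?_⟩
    · convert hs using 1
      ring
    · convert hy2 using 1
      ring
    · convert hr2 using 1
      ring

theorem index_conj (h : HW) (K : Subgroup HW) : (ConjAct.toConjAct h • K).index = K.index :=
  Subgroup.index_map_of_bijective (f := (MulAut.conj h).toMonoidHom) (MulAut.conj h).bijective K

theorem encard_classesOf_isFull (n : ℕ) :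
    (classesOf fun K : Subgroup HW => K.index = n ∧ IsFull K).encard =
      {t : ℕ × ℕ × ℕ | Odd t.1 ∧ Odd t.2.1 ∧ Odd t.2.2 ∧ t.1 * t.2.1 * t.2.2 = n}.encard := by
  refine encard_classesOf
    (fun K => (axisIdx K, axisIdx (rotate K), axisIdx (rotate (rotate K)))) ?_ ?_ ?_
  · rintro K ⟨hn, hK⟩
    obtain ⟨h, hh⟩ := hK.exists_conj
    refine ⟨hK.odd_axisIdx, hK.rotate.odd_axisIdx, hK.rotate.rotate.odd_axisIdx, ?_⟩
    rw [← index_diagSub hK.odd_axisIdx hK.rotate.odd_axisIdx hK.rotate.rotate.odd_axisIdx, ← hh,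
      index_conj, hn]
  · rintro ⟨a, b, c⟩ ⟨ha, hb, hc, rfl⟩
    refine ⟨diagSub a b c, ⟨index_diagSub ha hb hc, isFull_diagSub ha hb hc⟩, ?_⟩
    rw [rotate_diagSub, rotate_diagSub, axisIdx_diagSub ha hc, axisIdx_diagSub hb ha,
      axisIdx_diagSub hc hb]
  · rintro K L ⟨-, hK⟩ ⟨-, hL⟩
    constructor
    · intro h
      simp only [Prod.mk.injEq] at h
      obtain ⟨g, hg⟩ := hK.exists_conj
      obtain ⟨k, hk⟩ := hL.exists_conj
      rw [h.1, h.2.1, h.2.2, ← hk] at hg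
      refine ⟨g⁻¹ * k, ?_⟩
      rw [ConjAct.toConjAct_mul, mul_smul, ← hg, ConjAct.toConjAct_inv, inv_smul_smul]
    · rintro ⟨h, rfl⟩
      simp only [rotate_conj, axisIdx_conj]

end HW
/-! ### Counting lemmas -/

-- The unordered pairs are the orbits of `τ`. An orbit has two points and no fixed point, or one
-- point which is fixed; in both cases size plus number of fixed points is 2.
open Classical in
theorem two_mul_card_image_involution {β : Type*} (Y : Finset β) {τ : β → β}
    (hτ : ∀ y ∈ Y, τ y ∈ Y ∧ τ (τ y) = y) :
    2 * (Y.image fun y => s(y, τ y)).card = Y.card + (Y.filter fun y => τ y = y).card := by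
  rw [Finset.card_eq_sum_card_image (fun y => s(y, τ y)) Y,
    Finset.card_eq_sum_card_fiberwise (f := fun y => s(y, τ y)) (s := Y.filter fun y => τ y = y)
      (t := Y.image fun y => s(y, τ y))
      (fun y hy => Finset.mem_image_of_mem _ (Finset.mem_filter.1 hy).1),
    ← Finset.sum_add_distrib, mul_comm, ← smul_eq_mul, ← Finset.sum_const]
  refine Finset.sum_congr rfl fun e he => ?_
  obtain ⟨y, hy, rfl⟩ := Finset.mem_image.1 he
  obtain ⟨hτy, hττ⟩ := hτ y hy
  have h1 : (Y.filter fun z => s(z, τ z) = s(y, τ y)) = {y, τ y} := by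
    ext z
    simp only [Finset.mem_filter, Finset.mem_insert, Finset.mem_singleton, Sym2.eq_iff]
    constructor
    · tauto
    · rintro (rfl | rfl)
      · exact ⟨hy, Or.inl ⟨rfl, rfl⟩⟩
      · exact ⟨hτy, Or.inr ⟨rfl, hττ⟩⟩
  rw [Finset.filter_comm, h1, Finset.filter_insert, Finset.filter_singleton, hττ]
  by_cases h : τ y = y
  · simp [h]
  · rw [Finset.card_pair (Ne.symm h), if_neg h, if_neg (Ne.symm h)]
    rfl

open Classical in
/-- The finite set of all cosets of a subgroup of finite index. -/
noncomputable def cosets {A : Type*} [AddCommGroup A] (N : AddSubgroup A) : Finset (Set A) :=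
  if h : (Set.range fun v : A => {c : A | c - v ∈ N}).Finite then h.toFinset else ∅

section Cosets

variable {A : Type*} [AddCommGroup A] {N : AddSubgroup A}

/-- Cosets are kept as subsets of `A`, so that cosets of different `N` live in one type; this ties
them back to the quotient for counting. -/
theorem range_cosets (N : AddSubgroup A) : (Set.range fun v : A => {c : A | c - v ∈ N}) =
    Set.range fun w : A ⧸ N => {c : A | (c : A ⧸ N) = w} := by
  have h : ∀ v : A, {c : A | c - v ∈ N} = {c : A | (c : A ⧸ N) = (v : A ⧸ N)} := fun v => by
    ext c
    rw [Set.mem_ofPred_eq, Set.mem_ofPred_eq, ← QuotientAddGroup.eq_iff_sub_mem]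
  ext C
  constructor
  · rintro ⟨v, rfl⟩
    exact ⟨v, (h v).symm⟩
  · rintro ⟨w, rfl⟩
    obtain ⟨v, rfl⟩ := QuotientAddGroup.mk_surjective w
    exact ⟨v, h v⟩

theorem finite_cosets (hN : N.index ≠ 0) :
    (Set.range fun v : A => {c : A | c - v ∈ N}).Finite := by
  have : Finite (A ⧸ N) := AddSubgroup.index_ne_zero_iff_finite.1 hN
  rw [range_cosets]
  exact Set.finite_range _

theorem mem_cosets (hN : N.index ≠ 0) {C : Set A} :
    C ∈ cosets N ↔ ∃ v, {c : A | c - v ∈ N} = C := by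
  rw [cosets, dif_pos (finite_cosets hN), Set.Finite.mem_toFinset]
  rfl

theorem card_cosets (hN : N.index ≠ 0) : (cosets N).card = N.index := by
  have hinj : Function.Injective fun w : A ⧸ N => {c : A | (c : A ⧸ N) = w} := by
    intro w w' h
    obtain ⟨v, rfl⟩ := QuotientAddGroup.mk_surjective w
    have : v ∈ {c : A | (c : A ⧸ N) = w'} := by
      rw [← show {c : A | (c : A ⧸ N) = (v : A ⧸ N)} = {c : A | (c : A ⧸ N) = w'} from h]
      rfl
    exact this
  rw [cosets, dif_pos (finite_cosets hN), ← Set.ncard_eq_toFinset_card _ (finite_cosets hN),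
    range_cosets,
    ← Nat.card_coe_set_eq, Nat.card_range_of_injective hinj]
  rfl

end Cosets

theorem classesOf_or {H : Type*} [Group H] (P Q : Subgroup H → Prop) :
    classesOf (fun K => P K ∨ Q K) = classesOf P ∪ classesOf Q := by
  ext c
  simp only [classesOf, Set.mem_ofPred_eq, Set.mem_union]
  constructor
  · rintro ⟨K, h⟩
    rcases h with ⟨rfl, h | h⟩
    · exact Or.inl ⟨K, rfl, h⟩
    · exact Or.inr ⟨K, rfl, h⟩
  · rintro (⟨K, rfl, h⟩ | ⟨K, rfl, h⟩)
    · exact ⟨K, rfl, Or.inl h⟩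
    · exact ⟨K, rfl, Or.inr h⟩

theorem disjoint_classesOf {H : Type*} [Group H] {P Q : Subgroup H → Prop}
    (hP : ∀ (h : H) K, P K → P (ConjAct.toConjAct h • K)) (hPQ : ∀ K, P K → ¬ Q K) :
    Disjoint (classesOf P) (classesOf Q) := by
  rw [Set.disjoint_left]
  rintro c ⟨K, rfl, hK⟩ ⟨L, hLK, hL⟩
  obtain ⟨h, rfl⟩ := (conjClass_eq_iff L K).1 hLK
  exact hPQ _ (hP h K hK) hL

namespace HW

theorem encard_classesOf_rotate (P : Subgroup HW → Prop) :
    (classesOf fun K => P (rotate K)).encard = (classesOf P).encard := by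
  refine encard_classesOf (fun K => Quotient.mk _ (rotate K)) ?_ ?_ ?_
  · intro K hK
    exact ⟨_, rfl, hK⟩
  · rintro _ ⟨K, rfl, hK⟩
    refine ⟨rotate (rotate K), ?_, ?_⟩
    · rwa [rotate_rotate_rotate]
    · rw [rotate_rotate_rotate]
  · intro K L _ _
    rw [conjClass_eq_iff]
    constructor
    · rintro ⟨h, hh⟩
      refine ⟨rot.symm h, rotate_injective ?_⟩
      rw [rotate_conj, rot.apply_symm_apply, hh]
    · rintro ⟨h, rfl⟩
      exact ⟨rot h, (rotate_conj h L).symm⟩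

/-! ### Subgroups of half-turn type -/

theorem conj_mem_iff {H : Type*} [Group H] {h g : H} {K : Subgroup H} :
    h * g * h⁻¹ ∈ ConjAct.toConjAct h • K ↔ g ∈ K := by
  rw [mem_conj]
  constructor
  · rintro ⟨k, hk, e⟩
    rwa [← mul_left_cancel (mul_right_cancel e)]
  · intro hg
    exact ⟨g, hg, rfl⟩

theorem IsHalfTurn.conj {K : Subgroup HW} (hK : IsHalfTurn K) (h : HW) :
    IsHalfTurn (ConjAct.toConjAct h • K) := by
  obtain ⟨hx, g, hg, hz⟩ := hK
  refine ⟨?_, _, mem_conj.2 ⟨g, hg, rfl⟩, ?_⟩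
  · rintro _ ⟨k, hk, rfl⟩
    have := hx k hk
    change Even (h * k * h⁻¹).x
    rw [conj_x]
    simp only [Int.even_add, Int.even_sub, even_sg_mul, this]
    tauto
  · rw [conj_z]
    simp only [← Int.not_even_iff_odd, Int.even_add, Int.even_sub, even_sg_mul] at *
    tauto

/-- The translations in a subgroup orthogonal to the third axis. -/
def planar (K : Subgroup HW) : AddSubgroup (ℤ × ℤ) :=
  (lattice K).comap ((AddMonoidHom.id ℤ).prodMap (AddMonoidHom.inl ℤ ℤ))

theorem mem_planar {K : Subgroup HW} {a b : ℤ} : (a, b) ∈ planar K ↔ tr (a, b, 0) ∈ K := Iff.rfl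

/-- The smallest positive third component of an element of a subgroup of half-turn type. -/
noncomputable def height (K : Subgroup HW) : ℕ := axisIdx (rotate (rotate K))

theorem height_dvd {K : Subgroup HW} {g : HW} (hg : g ∈ K) (hx : Even g.x) :
    (height K : ℤ) ∣ g.z :=
  axisIdx_dvd (g := rot (rot g)) ⟨_, ⟨_, hg, rfl⟩, rfl⟩ hx

theorem height_eq {K : Subgroup HW} {k : ℕ} (h1 : ∀ g ∈ K, (k : ℤ) ∣ g.z)
    (h2 : ∃ g ∈ K, Even g.x ∧ g.z = k) : height K = k := by
  apply axisIdx_eq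
  · rw [forall_mem_rotate, forall_mem_rotate]
    exact fun g hg _ => h1 g hg
  · rw [exists_mem_rotate, exists_mem_rotate]
    exact h2

theorem height_conj (h : HW) (K : Subgroup HW) : height (ConjAct.toConjAct h • K) = height K := by
  rw [height, rotate_conj, rotate_conj, axisIdx_conj, height]

theorem IsHalfTurn.odd_height {K : Subgroup HW} (hK : IsHalfTurn K) : Odd (height K) := by
  obtain ⟨g, hg, hz⟩ := hK.2
  obtain ⟨c, hc⟩ := height_dvd hg (hK.1 g hg)
  rw [hc, Int.odd_mul] at hz
  exact_mod_cast hz.1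

theorem IsHalfTurn.exists_screw {K : Subgroup HW} (hK : IsHalfTurn K) :
    ∃ g ∈ K, ∃ p q : ℤ, g.x = 2 * p ∧ g.y = 2 * q + 1 ∧ g.z = height K := by
  obtain ⟨_, ⟨_, ⟨g, hg, rfl⟩, rfl⟩, -, hz⟩ := exists_axisIdx (rotate (rotate K))
  change g.z = height K at hz
  have hzo : Odd g.z := by
    rw [hz]
    exact_mod_cast hK.odd_height
  obtain ⟨p, hp⟩ := hK.1 g hg
  obtain ⟨q, hq⟩ := (hK.odd_y_iff hg).2 hzo
  exact ⟨g, hg, p, q, by omega, hq, hz⟩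

/-- The translation lattice splits because the square of the lowest screw motion is a purely
vertical translation. Its height is odd, so divisibility of `2 * c` already gives that of `c`. -/
theorem IsHalfTurn.tr_mem_iff {K : Subgroup HW} (hK : IsHalfTurn K) {a b c : ℤ} :
    tr (a, b, c) ∈ K ↔ (a, b) ∈ planar K ∧ (height K : ℤ) ∣ c := by
  have hz : ∀ i : ℤ, tr (0, 0, i * height K) ∈ K := by
    intro i
    obtain ⟨g, hg, p, q, hx, hy, hz⟩ := hK.exists_screw
    have hzo : Odd g.z := by
      rw [hz]
      exact_mod_cast hK.odd_height
    have : tr (0, 0, (height K : ℤ)) = g * g := by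
      ext
      · simp [sg_of_odd ⟨q, hy⟩]
      · simp [sg_of_odd hzo]
      · simp only [tr_z, mul_z, sg_of_even (hK.1 g hg), hz]
        ring
    have h2 := K.zpow_mem (this ▸ K.mul_mem hg hg) i
    rw [tr_zpow] at h2
    simpa using h2
  have hadd : ∀ i, tr (a, b, i * height K) = tr (a, b, 0) * tr (0, 0, i * height K) := fun i => by
    rw [← tr_add]
    simp
  constructor
  · intro h
    have hd := height_dvd h (even_two_mul _)
    rw [tr_z, odd_dvd_two_mul hK.odd_height] at hd
    obtain ⟨i, rfl⟩ := hd
    rw [mul_comm, hadd, Subgroup.mul_mem_cancel_right _ (hz i)] at h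
    exact ⟨h, dvd_mul_right _ _⟩
  · rintro ⟨h, i, rfl⟩
    rw [mul_comm, hadd]
    exact K.mul_mem h (hz i)

theorem IsHalfTurn.index_eq {K : Subgroup HW} (hK : IsHalfTurn K) :
    K.index = 2 * (height K * (planar K).index) := by
  rw [hK.index]
  congr 1
  have : lattice K = ((planar K).prod (AddSubgroup.zmultiples (height K : ℤ))).comap
      (AddEquiv.prodAssoc (M := ℤ) (N := ℤ) (P := ℤ)).symm.toAddMonoidHom := by
    ext ⟨a, b, c⟩
    rw [mem_lattice, hK.tr_mem_iff, ← Int.mem_zmultiples_iff]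
    rfl
  rw [this, AddSubgroup.index_comap_of_surjective _ (AddEquiv.surjective _),
    AddSubgroup.index_prod, Int.index_zmultiples, Int.natAbs_natCast, mul_comm]

theorem IsHalfTurn.mul_inv_eq_tr {K : Subgroup HW} (hK : IsHalfTurn K) {g h : HW} (hg : g ∈ K)
    (hgy : Odd g.y) (hx : Even h.x) (hy : Odd h.y) : ∃ u, h * g⁻¹ = tr u ∧
      2 * u.1 = h.x - g.x ∧ 2 * u.2.1 = h.y - g.y := by
  have hgz := (hK.odd_y_iff hg).1 hgy
  have hgx := hK.1 g hg
  have hz : Odd h.z := by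
    have := h.even
    simp only [Int.even_add, ← Int.not_even_iff_odd] at *
    tauto
  have e1 : (h * g⁻¹).x = h.x - g.x := by
    simp only [mul_x, inv_x, sg_of_odd hy, sg_of_odd hgy]
    ring
  have e2 : (h * g⁻¹).y = h.y - g.y := by
    simp only [mul_y, inv_y, sg_of_odd hz, sg_of_odd hgz]
    ring
  obtain ⟨u, hu⟩ := exists_tr (g := h * g⁻¹) (by rw [e1]; exact hx.sub hgx)
    (by rw [e2]; exact hy.sub_odd hgy)
  exact ⟨u, hu, by rw [← e1, hu, tr_x], by rw [← e2, hu, tr_y]⟩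

/-- Height and planar lattice determine all translations, and every screw motion is a translation
times one given screw motion. -/
theorem IsHalfTurn.le_of_mem {K L : Subgroup HW} (hK : IsHalfTurn K) (hL : IsHalfTurn L)
    (hh : height K = height L) (hp : planar K = planar L) {g : HW} (hgK : g ∈ K) (hgL : g ∈ L)
    (hg : Odd g.y) : K ≤ L := by
  intro h hhK
  have htr : ∀ u, tr u ∈ K → tr u ∈ L := by
    rintro ⟨a, b, c⟩
    rw [hK.tr_mem_iff, hL.tr_mem_iff, hh, hp]
    exact id
  rcases Int.even_or_odd h.y with hy | hy
  · obtain ⟨u, rfl⟩ := exists_tr (hK.1 h hhK) hy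
    exact htr u hhK
  · obtain ⟨u, hu, -⟩ := hK.mul_inv_eq_tr hgK hg (hK.1 h hhK) hy
    have := htr u (hu ▸ K.mul_mem hhK (K.inv_mem hgK))
    rw [← hu] at this
    exact (Subgroup.mul_mem_cancel_right _ (L.inv_mem hgL)).1 this

/-- The classes modulo two of the positions of the screw axes in a subgroup. -/
def screwClass (K : Subgroup HW) : Set (ℤ × ℤ) :=
  {c | ∃ g ∈ K, 4 ∣ g.x - 2 * c.1 ∧ 4 ∣ g.y - (2 * c.2 + 1)}

theorem mem_doubles {a b : ℤ} : (a, b) ∈ doubles (ℤ × ℤ) ↔ Even a ∧ Even b := by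
  constructor
  · rintro ⟨⟨c, d⟩, h⟩
    simp only [zsmulAddGroupHom_apply, Prod.smul_mk, smul_eq_mul, Prod.mk.injEq] at h
    rw [← h.1, ← h.2]
    exact ⟨even_two_mul _, even_two_mul _⟩
  · rintro ⟨⟨c, rfl⟩, d, rfl⟩
    exact ⟨(c, d), by simp [two_mul]⟩

/-- Multiplying `g` by a planar translation moves `(p, q)` by a vector of the planar lattice, and
the congruences modulo 4 in `screwClass` allow doubles. So the positions form a single coset. -/
theorem IsHalfTurn.screwClass_eq {K : Subgroup HW} (hK : IsHalfTurn K) {g : HW} (hg : g ∈ K)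
    {p q : ℤ} (hx : g.x = 2 * p) (hy : g.y = 2 * q + 1) :
    screwClass K = {c | c - (p, q) ∈ planar K ⊔ doubles (ℤ × ℤ)} := by
  ext ⟨c, d⟩
  rw [Set.mem_ofPred_eq, Prod.mk_sub_mk, AddSubgroup.mem_sup]
  constructor
  · rintro ⟨h, hh, ⟨s, hs⟩, t, ht⟩
    dsimp only at hs ht
    have hhy : Odd h.y := ⟨2 * t + d, by omega⟩
    obtain ⟨⟨u1, u2, u3⟩, hu, e1, e2⟩ := hK.mul_inv_eq_tr hg ⟨q, hy⟩ (hK.1 h hh) hhy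
    have hu' : (u1, u2) ∈ planar K :=
      (hK.tr_mem_iff.1 (hu ▸ K.mul_mem hh (K.inv_mem hg))).1
    refine ⟨_, hu', (-(2 * s), -(2 * t)), mem_doubles.2 ⟨by simp, by simp⟩, ?_⟩
    dsimp only at e1 e2
    rw [Prod.mk_add_mk, Prod.mk.injEq]
    constructor <;> omega
  · rintro ⟨⟨m1, m2⟩, hm, ⟨d1, d2⟩, hd, e⟩
    obtain ⟨⟨s, hs⟩, t, ht⟩ := mem_doubles.1 hd
    rw [Prod.mk_add_mk, Prod.mk.injEq] at e
    refine ⟨tr (m1, m2, 0) * g, K.mul_mem hm hg, ?_, ?_⟩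
    · simp only [mul_x, tr_y, tr_x, sg_two_mul, hx]
      exact ⟨-s, by omega⟩
    · simp only [mul_y, tr_y, tr_z, sg_two_mul, hy]
      exact ⟨-t, by omega⟩

/-- The positions of two lowest screws differ by a planar vector plus a double. The former is
absorbed by choosing another screw in `L`, the latter by conjugating with a translation. The
resulting groups share a screw motion and all translations. -/
theorem IsHalfTurn.exists_conj {K L : Subgroup HW} (hK : IsHalfTurn K) (hL : IsHalfTurn L)
    (hh : height K = height L) (hp : planar K = planar L) (hs : screwClass K = screwClass L) :
    ∃ h : HW, ConjAct.toConjAct h • L = K := by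
  obtain ⟨g, hg, p, q, hx, hy, hz⟩ := hK.exists_screw
  obtain ⟨g', hg', p', q', hx', hy', hz'⟩ := hL.exists_screw
  have h1 : (p, q) ∈ screwClass K := ⟨g, hg, by simp [hx], by simp [hy]⟩
  rw [hs, hL.screwClass_eq hg' hx' hy', Set.mem_ofPred_eq, AddSubgroup.mem_sup] at h1
  obtain ⟨⟨m1, m2⟩, hm, ⟨d1, d2⟩, hd, e⟩ := h1
  obtain ⟨⟨s, rfl⟩, t, rfl⟩ := mem_doubles.1 hd
  rw [Prod.mk_add_mk, Prod.mk_sub_mk, Prod.mk.injEq] at e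
  have hplanar : planar (ConjAct.toConjAct (tr (s, t, 0)) • L) = planar L := by
    ext ⟨a, b⟩
    rw [mem_planar, mem_planar, ← conj_mem_iff (h := tr (s, t, 0)) (K := L), ← tr_neg, ← tr_add,
      ← tr_add, add_neg_cancel_comm]
  have hL' := hL.conj (tr (s, t, 0))
  have hmem : g ∈ ConjAct.toConjAct (tr (s, t, 0)) • L := by
    refine mem_conj.2 ⟨tr (m1, m2, 0) * g', L.mul_mem hm hg', ?_⟩
    have ho : Odd g.z := by rw [hz]; exact_mod_cast hK.odd_height
    have ho' : Odd g'.z := by rw [hz', ← hh, ← hz]; exact ho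
    have hoy : Odd (2 * m2 + (2 * q' + 1)) := ⟨m2 + q', by ring⟩
    ext
    · rw [conj_x]
      simp only [mul_x, mul_y, tr_y, tr_x, tr_z, sg_two_mul, hx, hx', hy', sg_of_odd hoy, one_mul]
      omega
    · rw [conj_y]
      simp only [mul_y, mul_z, tr_y, tr_x, tr_z, sg_two_mul, hy, hy', one_mul, sg_add,
        sg_of_odd ho']
      omega
    · rw [conj_z]
      simp only [mul_z, tr_x, tr_z, sg_two_mul, hz, hz', hh]
      simp
  refine ⟨tr (s, t, 0), le_antisymm ?_ ?_⟩
  · exact hL'.le_of_mem hK (by rw [height_conj, hh]) (by rw [hplanar, hp]) hmem hg ⟨q, hy⟩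
  · exact hK.le_of_mem hL' (by rw [height_conj, hh]) (by rw [hplanar, hp]) hg hmem ⟨q, hy⟩

/-! ### The effect of conjugation on the invariants. -/

/-- The reflection of the plane. -/
def reflect (M : AddSubgroup (ℤ × ℤ)) : AddSubgroup (ℤ × ℤ) :=
  M.comap ((AddMonoidHom.id ℤ).prodMap (-AddMonoidHom.id ℤ))

theorem mem_reflect {M : AddSubgroup (ℤ × ℤ)} {a b : ℤ} : (a, b) ∈ reflect M ↔ (a, -b) ∈ M :=
  Iff.rfl

theorem reflect_reflect (M : AddSubgroup (ℤ × ℤ)) : reflect (reflect M) = M := by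
  ext ⟨a, b⟩
  rw [mem_reflect, mem_reflect, neg_neg]

theorem index_reflect (M : AddSubgroup (ℤ × ℤ)) : (reflect M).index = M.index :=
  AddSubgroup.index_comap_of_surjective _ fun p => ⟨(p.1, -p.2), by simp⟩

/-- A vector `(a, b)` and its mirror image differ by `(0, 2 * b)`, so the reflection is invisible
modulo doubles. -/
theorem reflect_sup_doubles_le (M : AddSubgroup (ℤ × ℤ)) :
    reflect M ⊔ doubles (ℤ × ℤ) ≤ M ⊔ doubles (ℤ × ℤ) := by
  refine sup_le ?_ le_sup_right
  rintro ⟨a, b⟩ h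
  refine AddSubgroup.mem_sup.2 ⟨_, mem_reflect.1 h, (0, 2 * b),
    mem_doubles.2 ⟨by simp, by simp⟩, ?_⟩
  rw [Prod.mk_add_mk, Prod.mk.injEq]
  constructor <;> ring

theorem reflect_sup_doubles (M : AddSubgroup (ℤ × ℤ)) :
    reflect M ⊔ doubles (ℤ × ℤ) = M ⊔ doubles (ℤ × ℤ) := by
  refine le_antisymm (reflect_sup_doubles_le M) ?_
  conv_lhs => rw [← reflect_reflect M]
  exact reflect_sup_doubles_le _

theorem sg_z_of_even {g : HW} (hx : Even g.x) : sg g.z = sg g.y := by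
  have := g.even
  rw [Int.even_add, Int.even_add] at this
  rcases Int.even_or_odd g.y with hy | hy
  · rw [sg_of_even hy, sg_of_even (by tauto)]
  · rw [sg_of_odd hy,
      sg_of_odd (Int.not_even_iff_odd.1 (by rw [← Int.not_even_iff_odd] at hy; tauto))]

/-- For even `h.x` the linear part of `h` acts on the plane as plus or minus the identity. -/
theorem planar_conj_of_even (K : Subgroup HW) {h : HW} (hx : Even h.x) :
    planar (ConjAct.toConjAct h • K) = planar K := by
  ext ⟨a, b⟩
  have hs := sg_z_of_even hx
  have e : tr (a, b, 0) = h * tr (sg h.y * a, sg h.y * b, 0) * h⁻¹ := by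
    ext
    · rw [conj_x]
      simp only [tr_x, tr_y, sg_two_mul]
      linear_combination (-2 * a) * sg_mul_self h.y
    · rw [conj_y]
      simp only [tr_y, tr_z, sg_two_mul, hs]
      linear_combination (-2 * b) * sg_mul_self h.y
    · rw [conj_z]
      simp only [tr_x, tr_z, sg_two_mul]
      ring
  rw [mem_planar, e, conj_mem_iff, ← mem_planar]
  rcases sg_eq_or h.y with h | h
  · simp [h]
  · rw [h, ← neg_mem_iff]
    simp

/-- For odd `h.x` the planar signs of `h` are opposite, so the action is a reflection up to an
overall sign. -/
theorem planar_conj_of_odd (K : Subgroup HW) {h : HW} (hx : Odd h.x) :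
    planar (ConjAct.toConjAct h • K) = reflect (planar K) := by
  ext ⟨a, b⟩
  have hs : sg h.z = -sg h.y := by
    have := h.even
    rw [← Int.not_even_iff_odd] at hx
    rw [Int.even_add, Int.even_add] at this
    rcases Int.even_or_odd h.y with hy | hy
    · rw [sg_of_even hy, sg_of_odd (Int.not_even_iff_odd.1 (by tauto))]
    · rw [sg_of_odd hy, sg_of_even (by rw [← Int.not_even_iff_odd] at hy; tauto)]
      rfl
  have e : tr (a, b, 0) = h * tr (sg h.y * a, sg h.y * (-b), 0) * h⁻¹ := by
    ext
    · rw [conj_x]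
      simp only [tr_x, tr_y, sg_two_mul]
      linear_combination (-2 * a) * sg_mul_self h.y
    · rw [conj_y]
      simp only [tr_y, tr_z, sg_two_mul, hs]
      linear_combination (-2 * b) * sg_mul_self h.y
    · rw [conj_z]
      simp only [tr_x, tr_z, sg_two_mul]
      ring
  rw [mem_planar, e, conj_mem_iff, ← mem_planar, mem_reflect]
  rcases sg_eq_or h.y with h | h
  · simp [h]
  · rw [h, ← neg_mem_iff]
    simp

/-- Modulo 4, conjugating a screw motion adds `2 * h.x` to its even first component and `2 * (h.y +
h.z)` to its odd second one. The two agree modulo 4, since `h.x + h.y + h.z` is even. -/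
theorem IsHalfTurn.screwClass_conj {K : Subgroup HW} (hK : IsHalfTurn K) (h : HW) :
    screwClass (ConjAct.toConjAct h • K) = {c | c + (h.x, h.x) ∈ screwClass K} := by
  have hkey : ∀ (s : ℤ) (n : ℤ), Even n → (4 : ℤ) ∣ sg s * n - n := fun s n hn => by
    obtain ⟨m, rfl⟩ := hn
    rcases sg_eq_or s with h | h <;> rw [h]
    · simp
    · exact ⟨-m, by ring⟩
  have hkey' : ∀ (s : ℤ) (n : ℤ), Odd n → (4 : ℤ) ∣ sg s * n - n - 2 * s := fun s n hn => by
    obtain ⟨m, rfl⟩ := hn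
    rcases Int.even_or_odd s with hs | hs
    · rw [sg_of_even hs]
      obtain ⟨t, rfl⟩ := hs
      exact ⟨-t, by ring⟩
    · rw [sg_of_odd hs]
      obtain ⟨t, rfl⟩ := hs
      exact ⟨-m - t - 1, by ring⟩
  have hc : ∀ g ∈ K, Odd g.y → (4 : ℤ) ∣ (h * g * h⁻¹).x - g.x - 2 * h.x ∧
      (4 : ℤ) ∣ (h * g * h⁻¹).y - g.y - 2 * h.x := by
    intro g hg hy
    rw [conj_x, conj_y, sg_of_odd hy, sg_of_odd ((hK.odd_y_iff hg).1 hy)]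
    obtain ⟨e, he⟩ := h.even
    have h1 := hkey h.y g.x (hK.1 g hg)
    have h2 := hkey' h.z g.y hy
    constructor <;> omega
  ext ⟨c, d⟩
  constructor
  · rintro ⟨_, ⟨g, hg, rfl⟩, h1, h2⟩
    change 4 ∣ (h * g * h⁻¹).x - _ at h1
    change 4 ∣ (h * g * h⁻¹).y - _ at h2
    have hy : Odd g.y := by
      have : Odd (h * g * h⁻¹).y := by
        obtain ⟨t, ht⟩ := h2
        exact ⟨2 * t + d, by dsimp only at ht; omega⟩
      rw [conj_y] at this
      have hx := hK.1 g hg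
      have := g.even
      simp only [← Int.not_even_iff_odd, Int.even_add, Int.even_sub, even_sg_mul] at *
      tauto
    obtain ⟨h3, h4⟩ := hc g hg hy
    refine ⟨g, hg, ?_, ?_⟩ <;> simp only [Prod.mk_add_mk] at * <;> omega
  · rintro ⟨g, hg, h1, h2⟩
    simp only [Prod.mk_add_mk] at h1 h2
    have hy : Odd g.y := by
      obtain ⟨t, ht⟩ := h2
      exact ⟨2 * t + (d + h.x), by omega⟩
    obtain ⟨h3, h4⟩ := hc g hg hy
    refine ⟨_, mem_conj.2 ⟨g, hg, rfl⟩, ?_, ?_⟩ <;> dsimp only <;> omega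

theorem even_one_sub_sg (n : ℤ) : Even (1 - sg n) := by
  rcases sg_eq_or n with h | h <;> rw [h] <;> decide

/-- The subgroup of half-turn type with given height, planar lattice and position of an axis. -/
def screwSub (k : ℕ) (M : AddSubgroup (ℤ × ℤ)) (p q : ℤ) : Subgroup HW where
  -- The factor `1 - sg g.y` is 0 for translations and 2 for screw motions, so one formula covers
  -- both; the second equation is doubled to avoid a division.
  carrier := {g | (k : ℤ) ∣ g.z ∧ ∃ a b, (a, b) ∈ M ∧ g.x = 2 * a + (1 - sg g.y) * p ∧
    2 * g.y = 4 * b + (1 - sg g.y) * (2 * q + 1)}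
  one_mem' := ⟨by simp, 0, 0, M.zero_mem, by simp [sg_of_even], by simp [sg_of_even]⟩
  mul_mem' := by
    rintro g h ⟨hg, a, b, hM, hx, hy⟩ ⟨hh, a', b', hM', hx', hy'⟩
    have he : Even g.x := by
      rw [hx]
      exact (even_two_mul _).add ((even_one_sub_sg _).mul_right _)
    have hsz := sg_z_of_even he
    refine ⟨dvd_add hg (dvd_sg_mul.2 hh), a + sg g.y * a', b + sg g.y * b', ?_, ?_, ?_⟩
    · have := M.add_mem hM (M.zsmul_mem hM' (sg g.y))
      simpa using this
    · rw [mul_x, mul_y, sg_add, sg_sg_mul]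
      linear_combination hx + sg g.y * hx'
    · rw [mul_y, sg_add, sg_sg_mul, hsz]
      linear_combination hy + sg g.y * hy'
  inv_mem' := by
    rintro g ⟨hg, a, b, hM, hx, hy⟩
    have he : Even g.x := by
      rw [hx]
      exact (even_two_mul _).add ((even_one_sub_sg _).mul_right _)
    have hsz := sg_z_of_even he
    refine ⟨dvd_neg.2 (dvd_sg_mul.2 hg), -(sg g.y * a), -(sg g.y * b), ?_, ?_, ?_⟩
    · have := M.neg_mem (M.zsmul_mem hM (sg g.y))
      simpa using this
    · rw [inv_x, inv_y, sg_neg, sg_sg_mul]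
      linear_combination (-sg g.y) * hx + p * sg_mul_self g.y
    · rw [inv_y, sg_neg, sg_sg_mul, hsz]
      linear_combination (-sg g.y) * hy + (2 * q + 1) * sg_mul_self g.y

theorem mem_screwSub {k : ℕ} {M : AddSubgroup (ℤ × ℤ)} {p q : ℤ} {g : HW} :
    g ∈ screwSub k M p q ↔ (k : ℤ) ∣ g.z ∧ ∃ a b, (a, b) ∈ M ∧ g.x = 2 * a + (1 - sg g.y) * p ∧
      2 * g.y = 4 * b + (1 - sg g.y) * (2 * q + 1) := Iff.rfl

theorem exists_mem_screwSub {k : ℕ} (hk : Odd k) (M : AddSubgroup (ℤ × ℤ)) (p q : ℤ) :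
    ∃ g ∈ screwSub k M p q, g.x = 2 * p ∧ g.y = 2 * q + 1 ∧ g.z = k := by
  have hk : Odd (k : ℤ) := by exact_mod_cast hk
  refine ⟨⟨2 * p, 2 * q + 1, k, ?_⟩, ⟨dvd_rfl, 0, 0, M.zero_mem, ?_, ?_⟩, rfl, rfl, rfl⟩
  · rw [add_assoc]
    exact (even_two_mul p).add (Odd.add_odd ⟨q, rfl⟩ hk)
  · rw [sg_of_odd ⟨q, rfl⟩]
    ring
  · rw [sg_of_odd ⟨q, rfl⟩]
    ring

theorem isHalfTurn_screwSub {k : ℕ} (hk : Odd k) (M : AddSubgroup (ℤ × ℤ)) (p q : ℤ) :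
    IsHalfTurn (screwSub k M p q) := by
  constructor
  · rintro g ⟨-, a, b, -, hx, -⟩
    rw [hx]
    exact (even_two_mul _).add ((even_one_sub_sg _).mul_right _)
  · obtain ⟨g, hg, -, -, hz⟩ := exists_mem_screwSub hk M p q
    exact ⟨g, hg, by rw [hz]; exact_mod_cast hk⟩

theorem height_screwSub {k : ℕ} (hk : Odd k) (M : AddSubgroup (ℤ × ℤ)) (p q : ℤ) :
    height (screwSub k M p q) = k := by
  obtain ⟨g, hg, hx, -, hz⟩ := exists_mem_screwSub hk M p q
  exact height_eq (fun g hg => hg.1) ⟨g, hg, by rw [hx]; simp, hz⟩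

theorem planar_screwSub (k : ℕ) (M : AddSubgroup (ℤ × ℤ)) (p q : ℤ) :
    planar (screwSub k M p q) = M := by
  ext ⟨a, b⟩
  rw [mem_planar, mem_screwSub]
  simp only [tr_x, tr_y, tr_z, sg_two_mul, mul_zero, dvd_zero, true_and, sub_self, zero_mul,
    add_zero]
  constructor
  · rintro ⟨a', b', h, h1, h2⟩
    obtain rfl : a = a' := by omega
    obtain rfl : b = b' := by omega
    exact h
  · intro h
    exact ⟨a, b, h, rfl, by ring⟩

/-! ### Counting subgroups of half-turn type -/

/-- The translation of a set of positions by the class of `(1, 1)`. -/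
def shift (C : Set (ℤ × ℤ)) : Set (ℤ × ℤ) := {c | c + (1, 1) ∈ C}

/-- The invariants of a subgroup of half-turn type. -/
abbrev ScrewData : Type := Σ _ : ℕ × ℕ, Σ _ : AddSubgroup (ℤ × ℤ), Set (ℤ × ℤ)

/-- The effect on the invariants of a conjugation that reverses one axis of the plane. -/
def flip (X : ScrewData) : ScrewData := ⟨X.1, reflect X.2.1, shift X.2.2⟩

open Classical in
/-- All possible invariants of subgroups of half-turn type of index `2m`. -/
noncomputable def screwData (m : ℕ) : Finset ScrewData :=
  (m.divisorsAntidiagonal.filter fun p => Odd p.1).sigma fun p =>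
    (subs (ℤ × ℤ) p.2).sigma fun M => cosets (M ⊔ doubles (ℤ × ℤ))

theorem index_sup_ne_zero {M : AddSubgroup (ℤ × ℤ)} (hM : M.index ≠ 0) :
    (M ⊔ doubles (ℤ × ℤ)).index ≠ 0 := fun h => hM (by
  have := AddSubgroup.index_dvd_of_le (le_sup_left : M ≤ M ⊔ doubles (ℤ × ℤ))
  rwa [h, zero_dvd_iff] at this)

theorem mem_screwData {m : ℕ} (hm : m ≠ 0) {k b : ℕ} {M : AddSubgroup (ℤ × ℤ)} {C : Set (ℤ × ℤ)} :
    (⟨(k, b), M, C⟩ : ScrewData) ∈ screwData m ↔ k * b = m ∧ Odd k ∧ M.index = b ∧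
      ∃ v, {c | c - v ∈ M ⊔ doubles (ℤ × ℤ)} = C := by
  rw [screwData, Finset.mem_sigma, Finset.mem_sigma, Finset.mem_filter,
    Nat.mem_divisorsAntidiagonal]
  dsimp only
  constructor
  · rintro ⟨⟨⟨rfl, -⟩, hk⟩, hM, hC⟩
    have hb : b ≠ 0 := right_ne_zero_of_mul hm
    rw [mem_subs finitelyManySubgroups_int2 hb] at hM
    exact ⟨rfl, hk, hM, (mem_cosets (index_sup_ne_zero (hM ▸ hb))).1 hC⟩
  · rintro ⟨rfl, hk, hM, hC⟩
    have hb : b ≠ 0 := right_ne_zero_of_mul hm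
    exact ⟨⟨⟨rfl, hm⟩, hk⟩, (mem_subs finitelyManySubgroups_int2 hb).2 hM,
      (mem_cosets (index_sup_ne_zero (hM ▸ hb))).2 hC⟩

theorem shift_coset (N : AddSubgroup (ℤ × ℤ)) (v : ℤ × ℤ) :
    shift {c | c - v ∈ N} = {c | c - (v - (1, 1)) ∈ N} := by
  ext c
  rw [shift, Set.mem_ofPred_eq, Set.mem_ofPred_eq, Set.mem_ofPred_eq, sub_sub_eq_add_sub]

theorem shift_coset_eq_iff (N : AddSubgroup (ℤ × ℤ)) (v : ℤ × ℤ) :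
    shift {c | c - v ∈ N} = {c | c - v ∈ N} ↔ (1, 1) ∈ N := by
  rw [shift_coset]
  constructor
  · intro h
    have : v ∈ {c | c - (v - (1, 1)) ∈ N} := by
      rw [h]
      simp [N.zero_mem]
    simpa using this
  · intro h
    ext c
    rw [Set.mem_ofPred_eq, Set.mem_ofPred_eq, ← sub_add, add_mem_cancel_right h]

/-- Shifting twice translates by the double `(2, 2)`; this makes `flip` an involution on the data.
-/
theorem shift_shift_coset {N : AddSubgroup (ℤ × ℤ)} (hN : doubles (ℤ × ℤ) ≤ N) (v : ℤ × ℤ) :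
    shift (shift {c | c - v ∈ N}) = {c | c - v ∈ N} := by
  rw [shift_coset, shift_coset]
  have h : ((1, 1) + (1, 1) : ℤ × ℤ) ∈ N := hN (mem_doubles.2 ⟨by decide, by decide⟩)
  ext c
  rw [Set.mem_ofPred_eq, Set.mem_ofPred_eq, sub_sub, ← sub_add, add_mem_cancel_right h]

theorem flip_mem {m : ℕ} (hm : m ≠ 0) : ∀ X ∈ screwData m,
    flip X ∈ screwData m ∧ flip (flip X) = X := by
  rintro ⟨⟨k, b⟩, M, C⟩ hX
  obtain ⟨hk, hko, hM, v, rfl⟩ := (mem_screwData hm).1 hX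
  constructor
  · refine (mem_screwData hm).2 ⟨hk, hko, ?_, v - (1, 1), ?_⟩
    · rw [← hM]
      exact index_reflect M
    · dsimp only
      rw [reflect_sup_doubles, shift_coset]
  · simp only [flip, reflect_reflect]
    rw [shift_shift_coset le_sup_right]

theorem card_screwData {m : ℕ} : (screwData m).card =
    ∑ p ∈ m.divisorsAntidiagonal, if Odd p.1 then cosetCount p.2 else 0 := by
  classical
  rw [screwData, Finset.card_sigma, Finset.sum_filter]
  refine Finset.sum_congr rfl fun p hp => ?_
  refine if_congr Iff.rfl ?_ rfl
  rw [Finset.card_sigma, cosetCount]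
  refine Finset.sum_congr rfl fun M hM => ?_
  have hb := (Nat.ne_zero_of_mem_divisorsAntidiagonal hp).2
  rw [mem_subs finitelyManySubgroups_int2 hb] at hM
  exact card_cosets (index_sup_ne_zero (hM ▸ hb))

-- For a given lattice, `flip` fixes either all cosets or none: the lattice has to be invariant
-- under the reflection and contain `(1, 1)` modulo doubles, independently of the coset.
open Classical in
theorem card_fixed_screwData {m : ℕ} : ((screwData m).filter fun X => flip X = X).card =
    ∑ p ∈ m.divisorsAntidiagonal, if Odd p.1 then fixedCosetCount p.2 else 0 := by
  rw [Finset.card_filter, screwData, Finset.sum_sigma, Finset.sum_filter]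
  refine Finset.sum_congr rfl fun p hp => ?_
  refine if_congr Iff.rfl ?_ rfl
  rw [Finset.sum_sigma, fixedCosetCount]
  refine Finset.sum_congr rfl fun M hM => ?_
  have hb := (Nat.ne_zero_of_mem_divisorsAntidiagonal hp).2
  rw [mem_subs finitelyManySubgroups_int2 hb] at hM
  have hi := index_sup_ne_zero (hM ▸ hb)
  have hr : (∀ q ∈ M, (q.1, -q.2) ∈ M) ↔ reflect M = M := by
    constructor
    · intro h
      ext ⟨a, b⟩
      rw [mem_reflect]
      constructor
      · intro h'
        simpa using h _ h'
      · exact h _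
    · rintro h ⟨a, b⟩ hq
      rw [← h] at hq
      exact hq
  have hval : ∀ C ∈ cosets (M ⊔ doubles (ℤ × ℤ)),
      (flip ⟨p, M, C⟩ = (⟨p, M, C⟩ : ScrewData)) ↔
        (∀ q ∈ M, (q.1, -q.2) ∈ M) ∧ (1, 1) ∈ M ⊔ doubles (ℤ × ℤ) := by
    intro C hC
    obtain ⟨v, rfl⟩ := (mem_cosets hi).1 hC
    rw [hr, ← shift_coset_eq_iff _ v]
    simp [flip]
  rw [Finset.sum_congr rfl fun C hC => if_congr (hval C hC) rfl rfl, Finset.sum_const,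
    card_cosets hi]
  simp

/-- The invariants of a subgroup. -/
noncomputable def dataOf (K : Subgroup HW) : ScrewData :=
  ⟨(height K, (planar K).index), planar K, screwClass K⟩

theorem IsHalfTurn.dataOf_conj_of_even {K : Subgroup HW} (hK : IsHalfTurn K) {h : HW}
    (hx : Even h.x) : dataOf (ConjAct.toConjAct h • K) = dataOf K := by
  have hs : screwClass (ConjAct.toConjAct h • K) = screwClass K := by
    obtain ⟨g, hg, p, q, hgx, hgy, -⟩ := hK.exists_screw
    rw [hK.screwClass_conj, hK.screwClass_eq hg hgx hgy]
    ext c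
    have : ((h.x, h.x) : ℤ × ℤ) ∈ planar K ⊔ doubles (ℤ × ℤ) :=
      (le_sup_right : _ ≤ planar K ⊔ doubles (ℤ × ℤ)) (mem_doubles.2 ⟨hx, hx⟩)
    rw [Set.mem_ofPred_eq, Set.mem_ofPred_eq, Set.mem_ofPred_eq, add_sub_right_comm,
      add_mem_cancel_right this]
  rw [dataOf, height_conj, planar_conj_of_even K hx, hs, dataOf]

/-- Translation by `(h.x, h.x)` agrees with translation by `(1, 1)` modulo doubles, and the planar
lattice is reflected. -/
theorem IsHalfTurn.dataOf_conj_of_odd {K : Subgroup HW} (hK : IsHalfTurn K) {h : HW}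
    (hx : Odd h.x) : dataOf (ConjAct.toConjAct h • K) = flip (dataOf K) := by
  have hs : screwClass (ConjAct.toConjAct h • K) = shift (screwClass K) := by
    obtain ⟨g, hg, p, q, hgx, hgy, -⟩ := hK.exists_screw
    rw [hK.screwClass_conj, hK.screwClass_eq hg hgx hgy, shift]
    ext c
    have : ((h.x - 1, h.x - 1) : ℤ × ℤ) ∈ planar K ⊔ doubles (ℤ × ℤ) :=
      (le_sup_right : _ ≤ planar K ⊔ doubles (ℤ × ℤ))
        (mem_doubles.2 ⟨hx.sub_odd odd_one, hx.sub_odd odd_one⟩)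
    have e : c + (h.x, h.x) - (p, q) = c + (1, 1) - (p, q) + (h.x - 1, h.x - 1) := by
      ext <;> simp <;> ring
    rw [Set.mem_ofPred_eq, Set.mem_ofPred_eq, Set.mem_ofPred_eq, Set.mem_ofPred_eq, e,
      add_mem_cancel_right this]
  rw [dataOf, height_conj, planar_conj_of_odd K hx, hs, dataOf, index_reflect]
  rfl

/-- The unordered pair of the data and their flip is a complete invariant of conjugacy, so the
classes are the orbits of an involution on `screwData m`. -/
theorem encard_classesOf_isHalfTurn {m : ℕ} (hm : m ≠ 0) : ∃ t : ℕ,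
    (classesOf fun K : Subgroup HW => K.index = 2 * m ∧ IsHalfTurn K).encard = t ∧
      2 * t = ∑ p ∈ m.divisorsAntidiagonal,
        if Odd p.1 then cosetCount p.2 + fixedCosetCount p.2 else 0 := by
  classical
  have hdata : ∀ K : Subgroup HW, K.index = 2 * m → IsHalfTurn K → dataOf K ∈ screwData m := by
    intro K hn hK
    obtain ⟨g, hg, p, q, hgx, hgy, -⟩ := hK.exists_screw
    refine (mem_screwData hm).2 ⟨?_, hK.odd_height, rfl, (p, q), (hK.screwClass_eq hg hgx hgy).symm⟩
    rw [hK.index_eq] at hn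
    omega
  refine ⟨((screwData m).image fun X => s(X, flip X)).card, ?_, ?_⟩
  · rw [← Set.encard_coe_eq_coe_finsetCard]
    refine encard_classesOf (fun K => s(dataOf K, flip (dataOf K))) ?_ ?_ ?_
    · rintro K ⟨hn, hK⟩
      exact Finset.mem_coe.2 (Finset.mem_image_of_mem _ (hdata K hn hK))
    · intro t ht
      obtain ⟨⟨⟨k, b⟩, M, C⟩, hX, rfl⟩ := Finset.mem_image.1 (Finset.mem_coe.1 ht)
      obtain ⟨hk, hko, hM, ⟨p, q⟩, rfl⟩ := (mem_screwData hm).1 hX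
      have hH := isHalfTurn_screwSub hko M p q
      obtain ⟨g, hg, hgx, hgy, -⟩ := exists_mem_screwSub hko M p q
      have hd : dataOf (screwSub k M p q) =
          ⟨(k, b), M, {c | c - (p, q) ∈ M ⊔ doubles (ℤ × ℤ)}⟩ := by
        rw [dataOf, hH.screwClass_eq hg hgx hgy, planar_screwSub, height_screwSub hko, hM]
      refine ⟨_, ⟨?_, hH⟩, by rw [hd]⟩
      rw [hH.index_eq, height_screwSub hko, planar_screwSub, hM, hk]
    · rintro K L ⟨-, hK⟩ ⟨hn, hL⟩
      have heq : ∀ {K L : Subgroup HW}, IsHalfTurn K → IsHalfTurn L → dataOf K = dataOf L →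
          ∃ h : HW, ConjAct.toConjAct h • L = K := by
        intro K L hK hL h
        simp only [dataOf, Sigma.mk.injEq, Prod.mk.injEq, heq_eq_eq] at h
        exact hK.exists_conj hL h.1.1 h.2.1 h.2.2
      constructor
      · intro h
        rw [Sym2.eq_iff] at h
        rcases h with h | h
        · exact heq hK hL h.1
        -- Any element with odd first component realizes the flip; this one is the generator `S1`.
        · have ho : Odd (⟨1, 0, 1, by decide⟩ : HW).x := odd_one
          rw [← hL.dataOf_conj_of_odd ho] at h
          obtain ⟨g, hg⟩ := heq hK (hL.conj _) h.1
          exact ⟨_, by rw [← hg, ← mul_smul, ← ConjAct.toConjAct_mul]⟩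
      · rintro ⟨h, rfl⟩
        rcases Int.even_or_odd h.x with hx | hx
        · rw [hL.dataOf_conj_of_even hx]
        · rw [hL.dataOf_conj_of_odd hx, (flip_mem hm _ (hdata L hn hL)).2, Sym2.eq_swap]
  · have h := two_mul_card_image_involution _ (flip_mem hm)
    have h' := card_fixed_screwData (m := m)
    rw [card_screwData] at h
    trans ∑ p ∈ m.divisorsAntidiagonal,
      ((if Odd p.1 then cosetCount p.2 else 0) + if Odd p.1 then fixedCosetCount p.2 else 0)
    · rw [Finset.sum_add_distrib, ← h']
      convert h
    · refine Finset.sum_congr rfl fun p _ => ?_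
      split_ifs <;> rfl

/-- The subgroups of half-turn type along any axis. -/
def IsHalfTurnType (K : Subgroup HW) : Prop :=
  IsHalfTurn K ∨ IsHalfTurn (rotate K) ∨ IsHalfTurn (rotate (rotate K))

theorem IsHalfTurn.not_rotate {K : Subgroup HW} (hK : IsHalfTurn K) : ¬ IsHalfTurn (rotate K) := by
  intro h
  obtain ⟨_, ⟨g, hg, rfl⟩, hz⟩ := h.2
  exact Int.not_even_iff_odd.2 hz (hK.1 g hg)

theorem IsHalfTurn.not_rotate_rotate {K : Subgroup HW} (hK : IsHalfTurn K) :
    ¬ IsHalfTurn (rotate (rotate K)) := by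
  intro h
  obtain ⟨g, hg, hz⟩ := hK.2
  exact Int.not_even_iff_odd.2 hz (h.1 (rot (rot g)) ⟨_, ⟨_, hg, rfl⟩, rfl⟩)

/-- The axis is unchanged by conjugation, so the three families of classes are disjoint, and the
cyclic symmetry makes them equally large. -/
theorem encard_classesOf_isHalfTurnType (n : ℕ) :
    (classesOf fun K : Subgroup HW => K.index = n ∧ IsHalfTurnType K).encard =
      3 * (classesOf fun K : Subgroup HW => K.index = n ∧ IsHalfTurn K).encard := by
  have h1 := encard_classesOf_rotate fun K => K.index = n ∧ IsHalfTurn K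
  have h2 := encard_classesOf_rotate fun K => K.index = n ∧ IsHalfTurn (rotate K)
  simp only [index_rotate] at h1 h2
  have hc : ∀ (h : HW) (K : Subgroup HW), K.index = n ∧ IsHalfTurn K →
      (ConjAct.toConjAct h • K).index = n ∧ IsHalfTurn (ConjAct.toConjAct h • K) :=
    fun h K hK => ⟨by rw [index_conj, hK.1], hK.2.conj h⟩
  have hc' : ∀ (h : HW) (K : Subgroup HW), K.index = n ∧ IsHalfTurn (rotate K) →
      (ConjAct.toConjAct h • K).index = n ∧ IsHalfTurn (rotate (ConjAct.toConjAct h • K)) :=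
    fun h K hK => ⟨by rw [index_conj, hK.1], by rw [rotate_conj]; exact hK.2.conj _⟩
  simp only [IsHalfTurnType, and_or_left]
  rw [classesOf_or, classesOf_or, Set.encard_union_eq, Set.encard_union_eq, h2, h1]
  · generalize Set.encard _ = x
    rw [show (3 : ℕ∞) = 1 + (1 + 1) by rfl, add_mul, add_mul, one_mul]
  · exact disjoint_classesOf hc' fun K h h' => h.2.not_rotate h'.2
  · rw [← classesOf_or]
    exact disjoint_classesOf hc fun K h h' => h'.elim (fun h' => h.2.not_rotate h'.2)
      fun h' => h.2.not_rotate_rotate h'.2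

theorem exists_encard_classesOf_isHalfTurnType {n : ℕ} (hn : n ≠ 0) : ∃ k : ℕ,
    (classesOf fun K : Subgroup HW => K.index = n ∧ IsHalfTurnType K).encard = k ∧
      (k : ℚ) = 3 / 2 * (dil 2 s2 n + 2 * dil 4 s2 n - 3 * dil 8 s2 n
        + dil 2 q3 n - dil 4 q3 n - 3 * dil 8 q3 n + 5 * dil 16 q3 n - 2 * dil 32 q3 n) := by
  have hd : ∀ (k : ℕ) (f : ℕ → ℚ), dil (2 * k) f n = if 2 ∣ n then dil k f (n / 2) else 0 := by
    intro k f
    rw [← dil_dil]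
    rfl
  rw [encard_classesOf_isHalfTurnType]
  by_cases h2 : 2 ∣ n
  · obtain ⟨m, rfl⟩ := h2
    obtain ⟨t, ht, ht'⟩ := encard_classesOf_isHalfTurn (m := m) (by omega)
    refine ⟨3 * t, by rw [ht]; rfl, ?_⟩
    have h := sum_odd_cosetCount m
    rw [← ht'] at h
    have e : 2 * m / 2 = m := by omega
    have e1 : ∀ f, dil 2 f (2 * m) = f m := fun f => by
      rw [dil, if_pos ⟨m, rfl⟩, e]
    have e2 : ∀ (k : ℕ) (f : ℕ → ℚ), dil (2 * k) f (2 * m) = dil k f m := fun k f => by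
      rw [hd, if_pos ⟨m, rfl⟩, e]
    rw [show (4 : ℕ) = 2 * 2 from rfl, show (8 : ℕ) = 2 * 4 from rfl,
      show (16 : ℕ) = 2 * 8 from rfl, show (32 : ℕ) = 2 * 16 from rfl]
    simp only [e1, e2]
    push_cast at h ⊢
    linear_combination (3 / 2) * h
  · have hempty : (classesOf fun K : Subgroup HW => K.index = n ∧ IsHalfTurn K) = ∅ := by
      rw [Set.eq_empty_iff_forall_notMem]
      rintro _ ⟨K, rfl, rfl, hK⟩
      exact h2 ⟨_, hK.index⟩
    refine ⟨0, by rw [hempty]; simp, ?_⟩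
    have e1 : ∀ f, dil 2 f n = 0 := fun f => if_neg h2
    have e2 : ∀ (k : ℕ) (f : ℕ → ℚ), dil (2 * k) f n = 0 := fun k f => by
      rw [hd, if_neg h2]
    rw [show (4 : ℕ) = 2 * 2 from rfl, show (8 : ℕ) = 2 * 4 from rfl,
      show (16 : ℕ) = 2 * 8 from rfl, show (32 : ℕ) = 2 * 16 from rfl]
    simp only [e1, e2]
    norm_num

/-! ### Counting subgroups of torus type -/

/-- A diagonal change of signs of determinant one. -/
def signMap (e : ℤˣ × ℤˣ) : ℤ × ℤ × ℤ →+ ℤ × ℤ × ℤ :=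
  (zsmulAddGroupHom (e.1 : ℤ)).prodMap
    ((zsmulAddGroupHom (e.2 : ℤ)).prodMap (zsmulAddGroupHom ((e.1 * e.2 : ℤˣ) : ℤ)))

theorem signMap_apply (e : ℤˣ × ℤˣ) (a b c : ℤ) :
    signMap e (a, b, c) = (e.1 * a, e.2 * b, ((e.1 * e.2 : ℤˣ) : ℤ) * c) := rfl

theorem signMap_one (u : ℤ × ℤ × ℤ) : signMap 1 u = u := by
  obtain ⟨a, b, c⟩ := u
  simp [signMap_apply]

theorem signMap_mul (e f : ℤˣ × ℤˣ) (u : ℤ × ℤ × ℤ) :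
    signMap (e * f) u = signMap f (signMap e u) := by
  obtain ⟨a, b, c⟩ := u
  simp only [signMap_apply, Prod.fst_mul, Prod.snd_mul, Units.val_mul, Prod.mk.injEq]
  refine ⟨?_, ?_, ?_⟩ <;> ring

theorem signMap_surjective (e : ℤˣ × ℤˣ) : Function.Surjective (signMap e) := fun u =>
  ⟨signMap e⁻¹ u, by rw [← signMap_mul, inv_mul_cancel, signMap_one]⟩

theorem comap_signMap_mem {m : ℕ} (hm : m ≠ 0) (e : ℤˣ × ℤˣ) {L : AddSubgroup (ℤ × ℤ × ℤ)}
    (hL : L ∈ subs (ℤ × ℤ × ℤ) m) : L.comap (signMap e) ∈ subs (ℤ × ℤ × ℤ) m := by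
  rw [mem_subs finitelyManySubgroups_int3 hm] at hL ⊢
  rw [AddSubgroup.index_comap_of_surjective _ (signMap_surjective e), hL]

/-- The action of the diagonal changes of signs on the lattices of given index. -/
abbrev signAction {m : ℕ} (hm : m ≠ 0) : MulAction (ℤˣ × ℤˣ) (subs (ℤ × ℤ × ℤ) m) where
  smul e L := ⟨(L : AddSubgroup (ℤ × ℤ × ℤ)).comap (signMap e), comap_signMap_mem hm e L.2⟩
  one_smul L := by
    apply Subtype.ext
    ext u
    change signMap 1 u ∈ L.1 ↔ _
    rw [signMap_one]
  mul_smul e f L := by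
    apply Subtype.ext
    ext u
    change signMap (e * f) u ∈ L.1 ↔ signMap f (signMap e u) ∈ L.1
    rw [signMap_mul]

open Classical in
theorem card_filter_comap {m : ℕ} (hm : m ≠ 0) (φ : ℤ × ℤ × ℤ ≃+ ℤ × ℤ × ℤ)
    (P : AddSubgroup (ℤ × ℤ × ℤ) → Prop) :
    ((subs (ℤ × ℤ × ℤ) m).filter fun L => P (L.comap φ.toAddMonoidHom)).card =
      ((subs (ℤ × ℤ × ℤ) m).filter P).card := by
  have hind : ∀ (ψ : ℤ × ℤ × ℤ ≃+ ℤ × ℤ × ℤ) {L}, L ∈ subs (ℤ × ℤ × ℤ) m →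
      L.comap ψ.toAddMonoidHom ∈ subs (ℤ × ℤ × ℤ) m := by
    intro ψ L hL
    rw [mem_subs finitelyManySubgroups_int3 hm] at hL ⊢
    rw [AddSubgroup.index_comap_of_surjective _ ψ.surjective, hL]
  refine Finset.card_bij (fun L _ => L.comap φ.toAddMonoidHom) ?_ ?_ ?_
  · intro L hL
    rw [Finset.mem_filter] at hL ⊢
    exact ⟨hind φ hL.1, hL.2⟩
  · intro L _ L' _ h
    exact AddSubgroup.comap_injective φ.surjective h
  · intro L hL
    rw [Finset.mem_filter] at hL
    have e : (L.comap φ.symm.toAddMonoidHom).comap φ.toAddMonoidHom = L := by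
      ext u
      change φ.symm (φ u) ∈ L ↔ _
      rw [φ.symm_apply_apply]
    refine ⟨L.comap φ.symm.toAddMonoidHom, ?_, e⟩
    rw [Finset.mem_filter, e]
    exact ⟨hind φ.symm hL.1, hL.2⟩

/-- The cyclic permutation of the coordinates of the lattice. -/
def cycle : ℤ × ℤ × ℤ ≃+ ℤ × ℤ × ℤ where
  toFun u := (u.2.1, u.2.2, u.1)
  invFun u := (u.2.2, u.1, u.2.1)
  left_inv _ := rfl
  right_inv _ := rfl
  map_add' _ _ := rfl

-- The three nontrivial sign changes of determinant one are half-turns about the coordinate axes.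
-- Cyclic permutations carry each to the reflection `(x, u) ↦ (x, -u)` treated by
-- `card_reflection_invariant`.
open Classical in
theorem card_signMap_invariant {m : ℕ} (hm : m ≠ 0) {e : ℤˣ × ℤˣ} (he : e ≠ 1) :
    ((subs (ℤ × ℤ × ℤ) m).filter fun L => L.comap (signMap e) = L).card =
      ∑ p ∈ m.divisorsAntidiagonal, cosetCount p.2 := by
  have hinv : ∀ L : AddSubgroup (ℤ × ℤ × ℤ), L.comap (signMap e) = L ↔
      ∀ u ∈ L, signMap e u ∈ L := by
    intro L
    constructor
    · intro h u hu
      rw [← h] at hu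
      exact hu
    · intro h
      ext u
      refine ⟨fun hu => ?_, h u⟩
      have := h _ hu
      rwa [← signMap_mul, show e * e = 1 from Prod.ext (Int.units_mul_self _)
        (Int.units_mul_self _), signMap_one] at this
  rw [← card_reflection_invariant hm]
  simp only [hinv]
  have hcases : e = (1, -1) ∨ e = (-1, 1) ∨ e = (-1, -1) := by
    obtain ⟨e1, e2⟩ := e
    rcases Int.units_eq_one_or e1 with rfl | rfl <;> rcases Int.units_eq_one_or e2 with rfl | rfl
    · exact absurd rfl he
    all_goals simp
  rcases hcases with rfl | rfl | rfl
  · congr 1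
    refine Finset.filter_congr fun L _ => ?_
    simp [signMap_apply]
  · rw [← card_filter_comap hm cycle]
    congr 1
    refine Finset.filter_congr fun L _ => ?_
    simp only [Prod.forall, signMap_apply]
    constructor
    · intro h a b c hu
      simpa [cycle] using h c a b hu
    · intro h a b c hu
      simpa [cycle] using h b c a hu
  · rw [← card_filter_comap hm cycle.symm]
    congr 1
    refine Finset.filter_congr fun L _ => ?_
    simp only [Prod.forall, signMap_apply]
    constructor
    · intro h a b c hu
      simpa [cycle] using h b c a hu
    · intro h a b c hu
      simpa [cycle] using h c a b hu

/-- Burnside's lemma for a group of order four: the identity fixes all `omega m` lattices, and the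
three other elements fix equally many. -/
theorem card_orbits_signAction {m : ℕ} (hm : m ≠ 0) :
    4 * Nat.card (@MulAction.orbitRel.Quotient (ℤˣ × ℤˣ) (subs (ℤ × ℤ × ℤ) m) _ (signAction hm)) =
      omega m + 3 * ∑ p ∈ m.divisorsAntidiagonal, cosetCount p.2 := by
  classical
  let _ := signAction hm
  have hfix : ∀ e : ℤˣ × ℤˣ, Fintype.card (MulAction.fixedBy (subs (ℤ × ℤ × ℤ) m) e) =
      ((subs (ℤ × ℤ × ℤ) m).filter fun L => L.comap (signMap e) = L).card := by
    intro e
    rw [← Nat.card_eq_fintype_card, Nat.card_coe_set_eq,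
      ← Set.ncard_image_of_injective _ Subtype.val_injective, ← Set.ncard_coe_finset]
    congr 1
    ext L
    rw [Finset.mem_coe, Finset.mem_filter]
    constructor
    · rintro ⟨L, hL, rfl⟩
      exact ⟨L.2, congrArg Subtype.val hL⟩
    · rintro ⟨hL, h⟩
      exact ⟨⟨L, hL⟩, Subtype.ext h, rfl⟩
  have h := MulAction.sum_card_fixedBy_eq_card_orbits_mul_card_group (ℤˣ × ℤˣ)
    (subs (ℤ × ℤ × ℤ) m)
  rw [← Nat.card_eq_fintype_card, Fintype.card_prod,
    show Fintype.card ℤˣ * Fintype.card ℤˣ = 4 from rfl, mul_comm] at h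
  rw [MulAction.orbitRel.Quotient, ← h, Finset.sum_congr rfl fun e _ => hfix e,
    ← Finset.add_sum_erase _ _ (Finset.mem_univ 1), Finset.sum_congr rfl fun e he =>
      card_signMap_invariant hm (Finset.ne_of_mem_erase he), Finset.sum_const]
  congr 1
  rw [Finset.filter_true_of_mem, card_subs_int3 hm]
  intro L _
  ext u
  change signMap 1 u ∈ L ↔ _
  rw [signMap_one]

theorem conj_tr (h : HW) (a b c : ℤ) :
    h * tr (a, b, c) * h⁻¹ = tr (sg h.y * a, sg h.z * b, sg h.x * c) := by
  ext
  · rw [conj_x]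
    simp only [tr_x, tr_y, sg_two_mul]
    ring
  · rw [conj_y]
    simp only [tr_y, tr_z, sg_two_mul]
    ring
  · rw [conj_z]
    simp only [tr_x, tr_z, sg_two_mul]
    ring

/-- Two signs suffice, since the even sum of the components of `h` makes the third sign their
product. -/
theorem lattice_conj (h : HW) (K : Subgroup HW) : lattice (ConjAct.toConjAct h • K) =
    (lattice K).comap (signMap (h.y.negOnePow, h.z.negOnePow)) := by
  ext ⟨a, b, c⟩
  have hx : sg h.y * sg h.z = sg h.x := by
    have := sg_of_even h.even
    rw [sg_add, sg_add] at this
    linear_combination (-sg h.y * sg h.z) * sg_mul_self h.x + sg h.x * this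
  have e : tr (a, b, c) = h * tr (sg h.y * a, sg h.z * b, sg h.x * c) * h⁻¹ := by
    rw [conj_tr, ← mul_assoc, ← mul_assoc, ← mul_assoc, sg_mul_self, sg_mul_self, sg_mul_self,
      one_mul, one_mul, one_mul]
  rw [mem_lattice, e, conj_mem_iff, AddSubgroup.mem_comap, mem_lattice, signMap_apply, ← hx]
  rfl

theorem exists_signs (e : ℤˣ × ℤˣ) : ∃ h : HW, (h.y.negOnePow, h.z.negOnePow) = e := by
  obtain ⟨e1, e2⟩ := e
  have hs : ∀ e : ℤˣ, ∃ n : ℤ, n.negOnePow = e := fun e => by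
    rcases Int.units_eq_one_or e with rfl | rfl
    · exact ⟨0, by simp⟩
    · exact ⟨1, by simp⟩
  obtain ⟨y, hy⟩ := hs e1
  obtain ⟨z, hz⟩ := hs e2
  exact ⟨⟨y + z, y, z, by rw [add_assoc]; exact ⟨y + z, rfl⟩⟩, Prod.ext hy hz⟩

theorem IsTorus.le_of_lattice_le {K L : Subgroup HW} (hK : IsTorus K)
    (h : lattice K ≤ lattice L) : K ≤ L := by
  intro g hg
  obtain ⟨u, rfl⟩ := exists_tr (hK g hg).1 (hK g hg).2
  exact h hg

theorem IsTorus.eq_of_lattice_eq {K L : Subgroup HW} (hK : IsTorus K) (hL : IsTorus L)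
    (h : lattice K = lattice L) : K = L :=
  le_antisymm (hK.le_of_lattice_le h.le) (hL.le_of_lattice_le h.ge)

theorem IsTorus.conj {K : Subgroup HW} (hK : IsTorus K) (h : HW) :
    IsTorus (ConjAct.toConjAct h • K) := by
  rintro _ ⟨g, hg, rfl⟩
  obtain ⟨⟨a, b, c⟩, rfl⟩ := exists_tr (hK g hg).1 (hK g hg).2
  change Even (h * _ * h⁻¹).x ∧ Even (h * _ * h⁻¹).y
  rw [conj_tr]
  exact ⟨even_two_mul _, even_two_mul _⟩

/-- The group of translations given by a lattice. -/
def torusSub (L : AddSubgroup (ℤ × ℤ × ℤ)) : Subgroup HW where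
  carrier := {g | ∃ u ∈ L, tr u = g}
  one_mem' := ⟨0, L.zero_mem, trHom.map_one⟩
  mul_mem' := by
    rintro _ _ ⟨u, hu, rfl⟩ ⟨v, hv, rfl⟩
    exact ⟨u + v, L.add_mem hu hv, tr_add u v⟩
  inv_mem' := by
    rintro _ ⟨u, hu, rfl⟩
    exact ⟨-u, L.neg_mem hu, tr_neg u⟩

theorem isTorus_torusSub (L : AddSubgroup (ℤ × ℤ × ℤ)) : IsTorus (torusSub L) := by
  rintro _ ⟨u, -, rfl⟩
  exact ⟨even_two_mul _, even_two_mul _⟩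

theorem tr_injective : Function.Injective tr := by
  rintro ⟨a, b, c⟩ ⟨a', b', c'⟩ h
  rw [HW.ext_iff] at h
  simp only [tr_x, tr_y, tr_z] at h
  simp only [Prod.mk.injEq]
  omega

theorem lattice_torusSub (L : AddSubgroup (ℤ × ℤ × ℤ)) : lattice (torusSub L) = L := by
  ext u
  constructor
  · rintro ⟨v, hv, h⟩
    rwa [← tr_injective h]
  · intro hu
    exact ⟨u, hu, rfl⟩

theorem encard_classesOf_isTorus {m : ℕ} (hm : m ≠ 0) : ∃ k : ℕ,
    (classesOf fun K : Subgroup HW => K.index = 4 * m ∧ IsTorus K).encard = k ∧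
      4 * k = omega m + 3 * ∑ p ∈ m.divisorsAntidiagonal, cosetCount p.2 := by
  classical
  refine ⟨_, ?_, card_orbits_signAction hm⟩
  let _ := signAction hm
  have hmem : ∀ K : Subgroup HW, K.index = 4 * m → IsTorus K →
      lattice K ∈ subs (ℤ × ℤ × ℤ) m := by
    intro K hn hK
    rw [mem_subs finitelyManySubgroups_int3 hm]
    rw [hK.index] at hn
    omega
  let mk : subs (ℤ × ℤ × ℤ) m → MulAction.orbitRel.Quotient (ℤˣ × ℤˣ) (subs (ℤ × ℤ × ℤ) m) :=
    Quotient.mk _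
  have hfin : Finite (MulAction.orbitRel.Quotient (ℤˣ × ℤˣ) (subs (ℤ × ℤ × ℤ) m)) :=
    Quotient.finite _
  trans (Set.range (some : MulAction.orbitRel.Quotient (ℤˣ × ℤˣ) (subs (ℤ × ℤ × ℤ) m) → _)).encard
  · refine encard_classesOf
      -- The invariant must be defined on all subgroups; the value `none` never occurs for torus
      -- type and index `4 * m`.
      (fun K => if h : lattice K ∈ subs (ℤ × ℤ × ℤ) m then some (mk ⟨_, h⟩) else none) ?_ ?_ ?_
    · rintro K ⟨hn, hK⟩
      rw [dif_pos (hmem K hn hK)]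
      exact ⟨_, rfl⟩
    · rintro _ ⟨⟨L, hL⟩, rfl⟩
      refine ⟨torusSub L, ⟨?_, isTorus_torusSub L⟩, ?_⟩
      · rw [(isTorus_torusSub L).index, lattice_torusSub,
          (mem_subs finitelyManySubgroups_int3 hm).1 hL]
      · simp only [lattice_torusSub]
        rw [dif_pos hL]
        rfl
    · rintro K L ⟨hKn, hK⟩ ⟨hLn, hL⟩
      rw [dif_pos (hmem K hKn hK), dif_pos (hmem L hLn hL), Option.some_inj, Quotient.eq]
      constructor
      · rintro ⟨e, he⟩
        obtain ⟨h, rfl⟩ := exists_signs e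
        refine ⟨h, (hL.conj h).eq_of_lattice_eq hK ?_⟩
        rw [lattice_conj]
        exact congrArg Subtype.val he
      · rintro ⟨h, rfl⟩
        exact ⟨_, Subtype.ext (lattice_conj h L).symm⟩
  · rw [← Set.image_univ, (Option.some_injective _).encard_image, Set.encard_univ,
      ENat.card_eq_coe_natCard]

theorem exists_encard_classesOf_isTorus {n : ℕ} (hn : n ≠ 0) : ∃ k : ℕ,
    (classesOf fun K : Subgroup HW => K.index = n ∧ IsTorus K).encard = k ∧
      (k : ℚ) = 1 / 4 * dil 4 (fun m => (omega m : ℚ)) n + 3 / 4 * dil 4 s2 n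
        + 9 / 4 * dil 8 s2 n := by
  rw [show (8 : ℕ) = 4 * 2 from rfl, ← dil_dil]
  by_cases h4 : 4 ∣ n
  · obtain ⟨m, rfl⟩ := h4
    obtain ⟨k, hk, hk'⟩ := encard_classesOf_isTorus (m := m) (by omega)
    refine ⟨k, hk, ?_⟩
    have h := sum_cosetCount m
    have h' : ((4 * k : ℕ) : ℚ) = _ := congrArg Nat.cast hk'
    have e : ∀ f, dil 4 f (4 * m) = f m := fun f => by
      rw [dil, if_pos ⟨m, rfl⟩, show 4 * m / 4 = m by omega]
    rw [e, e, e]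
    rw [Nat.cast_add, Nat.cast_mul, Nat.cast_mul, h] at h'
    push_cast at h'
    linear_combination h' / 4
  · have hempty : (classesOf fun K : Subgroup HW => K.index = n ∧ IsTorus K) = ∅ := by
      rw [Set.eq_empty_iff_forall_notMem]
      rintro _ ⟨K, rfl, rfl, hK⟩
      exact h4 ⟨_, hK.index⟩
    refine ⟨0, by rw [hempty]; simp, ?_⟩
    have e : ∀ f, dil 4 f n = 0 := fun f => if_neg h4
    rw [e, e, e]
    norm_num

end HW
/-! ### The fibers of the projections to the flat manifolds -/

/-- The projection to the three-torus. -/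
noncomputable def proj1 : E3 → G1 := Quotient.mk (MulAction.orbitRel Gamma1 E3)

/-- The projection to the half-turn manifold. -/
noncomputable def proj2 : E3 → G2 := Quotient.mk (MulAction.orbitRel Gamma2 E3)

theorem E3_ext {v w : E3} (h0 : v 0 = w 0) (h1 : v 1 = w 1) (h2 : v 2 = w 2) : v = w :=
  HW.ext_E3.2 ⟨h0, h1, h2⟩

theorem quotientMk_smul {Γ : Subgroup (E3 ≃ᵢ E3)} {g : E3 ≃ᵢ E3} (hg : g ∈ Γ) (v : E3) :
    Quotient.mk (MulAction.orbitRel Γ E3) (g v) = Quotient.mk (MulAction.orbitRel Γ E3) v :=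
  (quotientMk_eq_iff Γ _ _).2 ⟨g, hg, rfl⟩

theorem periodic_T1 {Γ : Subgroup (E3 ≃ᵢ E3)} (h : T1 ∈ Γ) :
    Function.Periodic (Quotient.mk (MulAction.orbitRel Γ E3)) !₂[(1 : ℝ), 0, 0] := by
  intro v
  rw [← quotientMk_smul h v]
  congr 1
  apply E3_ext <;> simp [T1, motion_apply]

theorem periodic_T2 {Γ : Subgroup (E3 ≃ᵢ E3)} (h : T2 ∈ Γ) :
    Function.Periodic (Quotient.mk (MulAction.orbitRel Γ E3)) !₂[(0 : ℝ), 1, 0] := by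
  intro v
  rw [← quotientMk_smul h v]
  congr 1
  apply E3_ext <;> simp [T2, motion_apply]

theorem periodic_T3 {Γ : Subgroup (E3 ≃ᵢ E3)} (h : T3 ∈ Γ) :
    Function.Periodic (Quotient.mk (MulAction.orbitRel Γ E3)) !₂[(0 : ℝ), 0, 1] := by
  intro v
  rw [← quotientMk_smul h v]
  congr 1
  apply E3_ext <;> simp [T3, motion_apply]

theorem proj1_eq_iff (v w : E3) : proj1 v = proj1 w ↔
    ∃ a b c : ℤ, v 0 = w 0 + a ∧ v 1 = w 1 + b ∧ v 2 = w 2 + c := by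
  constructor
  · intro h
    obtain ⟨g, hg, rfl⟩ := (quotientMk_eq_iff Gamma1 v w).1 h
    have : ∃ a b c : ℤ, ∀ w : E3, (g • w) 0 = w 0 + a ∧ (g • w) 1 = w 1 + b ∧
        (g • w) 2 = w 2 + c := by
      clear h
      induction hg using Subgroup.closure_induction with
      | mem g hg =>
        rcases hg with rfl | rfl | rfl
        · refine ⟨1, 0, 0, fun w => ?_⟩
          change (T1 w) 0 = _ ∧ (T1 w) 1 = _ ∧ (T1 w) 2 = _
          simp [T1, motion_apply]
        · refine ⟨0, 1, 0, fun w => ?_⟩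
          change (T2 w) 0 = _ ∧ (T2 w) 1 = _ ∧ (T2 w) 2 = _
          simp [T2, motion_apply]
        · refine ⟨0, 0, 1, fun w => ?_⟩
          change (T3 w) 0 = _ ∧ (T3 w) 1 = _ ∧ (T3 w) 2 = _
          simp [T3, motion_apply]
      | one => exact ⟨0, 0, 0, by simp⟩
      | mul g h _ _ hg hh =>
        obtain ⟨a, b, c, e⟩ := hg
        obtain ⟨a', b', c', e'⟩ := hh
        refine ⟨a + a', b + b', c + c', fun w => ?_⟩
        rw [mul_smul, (e _).1, (e _).2.1, (e _).2.2, (e' _).1, (e' _).2.1, (e' _).2.2]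
        push_cast
        refine ⟨?_, ?_, ?_⟩ <;> ring
      | inv g _ hg =>
        obtain ⟨a, b, c, e⟩ := hg
        refine ⟨-a, -b, -c, fun w => ?_⟩
        have := e (g⁻¹ • w)
        rw [smul_inv_smul] at this
        push_cast
        refine ⟨?_, ?_, ?_⟩ <;> linarith
    obtain ⟨a, b, c, h⟩ := this
    exact ⟨a, b, c, h w⟩
  · rintro ⟨a, b, c, h0, h1, h2⟩
    have e : v = w + a • !₂[(1 : ℝ), 0, 0] + b • !₂[(0 : ℝ), 1, 0] + c • !₂[(0 : ℝ), 0, 1] := by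
      apply E3_ext <;> simp [h0, h1, h2]
    have p1 := periodic_T1 (Γ := Gamma1) (Subgroup.subset_closure (by simp))
    have p2 := periodic_T2 (Γ := Gamma1) (Subgroup.subset_closure (by simp))
    have p3 := periodic_T3 (Γ := Gamma1) (Subgroup.subset_closure (by simp))
    rw [e, proj1, p3.zsmul c, p2.zsmul b, p1.zsmul a]

/-- The vertical displacement `c` counts the half-turn screws used, so its parity is the sign acting
on the plane. Conversely such a motion is a power of `R3` followed by powers of `T1` and `T2`. -/
theorem proj2_eq_iff (v w : E3) : proj2 v = proj2 w ↔
    ∃ a b c : ℤ, v 0 = sg c * w 0 + a ∧ v 1 = sg c * w 1 + b ∧ v 2 = w 2 + c := by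
  constructor
  · intro h
    obtain ⟨g, hg, rfl⟩ := (quotientMk_eq_iff Gamma2 v w).1 h
    have : ∃ a b c : ℤ, ∀ w : E3, (g • w) 0 = sg c * w 0 + a ∧ (g • w) 1 = sg c * w 1 + b ∧
        (g • w) 2 = w 2 + c := by
      clear h
      induction hg using Subgroup.closure_induction with
      | mem g hg =>
        rcases hg with rfl | rfl | rfl
        · refine ⟨1, 0, 0, fun w => ?_⟩
          change (T1 w) 0 = _ ∧ (T1 w) 1 = _ ∧ (T1 w) 2 = _
          simp [T1, motion_apply, sg_of_even]
        · refine ⟨0, 1, 0, fun w => ?_⟩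
          change (T2 w) 0 = _ ∧ (T2 w) 1 = _ ∧ (T2 w) 2 = _
          simp [T2, motion_apply, sg_of_even]
        · refine ⟨0, 0, 1, fun w => ?_⟩
          change (R3 w) 0 = _ ∧ (R3 w) 1 = _ ∧ (R3 w) 2 = _
          simp [R3, motion_apply, sg_of_odd]
      | one => exact ⟨0, 0, 0, by simp [sg_of_even]⟩
      | mul g h _ _ hg hh =>
        obtain ⟨a, b, c, e⟩ := hg
        obtain ⟨a', b', c', e'⟩ := hh
        refine ⟨a + sg c * a', b + sg c * b', c + c', fun w => ?_⟩
        rw [mul_smul, (e _).1, (e _).2.1, (e _).2.2, (e' _).1, (e' _).2.1, (e' _).2.2, sg_add]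
        push_cast
        refine ⟨?_, ?_, ?_⟩ <;> ring
      | inv g _ hg =>
        obtain ⟨a, b, c, e⟩ := hg
        refine ⟨-(sg c * a), -(sg c * b), -c, fun w => ?_⟩
        obtain ⟨e0, e1, e2⟩ := e (g⁻¹ • w)
        rw [smul_inv_smul] at e0 e1 e2
        rw [sg_neg]
        have hs : (sg c : ℝ) * sg c = 1 := by exact_mod_cast sg_mul_self c
        push_cast
        refine ⟨?_, ?_, ?_⟩
        · linear_combination (-(sg c : ℝ)) * e0 - (g⁻¹ • w) 0 * hs
        · linear_combination (-(sg c : ℝ)) * e1 - (g⁻¹ • w) 1 * hs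
        · linarith
    obtain ⟨a, b, c, h⟩ := this
    exact ⟨a, b, c, h w⟩
  · rintro ⟨a, b, c, h0, h1, h2⟩
    have p1 := periodic_T1 (Γ := Gamma2) (Subgroup.subset_closure (by simp))
    have p2 := periodic_T2 (Γ := Gamma2) (Subgroup.subset_closure (by simp))
    have hR : ∀ v : E3, proj2 !₂[-v 0, -v 1, v 2 + 1] = proj2 v := by
      intro v
      have hm : R3 ∈ Gamma2 := Subgroup.subset_closure (by simp)
      rw [proj2, ← quotientMk_smul hm v]
      congr 1
      apply E3_ext <;> simp [R3, motion_apply]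
    have h3 : ∀ (c : ℤ) (w : E3), proj2 !₂[sg c * w 0, sg c * w 1, w 2 + c] = proj2 w := by
      intro c
      induction c with
      | zero =>
        intro w
        congr 1
        apply E3_ext <;> simp [sg_of_even]
      | succ i ih =>
        intro w
        rw [← ih w, ← hR !₂[sg i * w 0, sg i * w 1, w 2 + ((i : ℤ) : ℝ)]]
        congr 1
        apply E3_ext
        · simp [sg_add, sg_of_odd (n := 1)]
        · simp [sg_add, sg_of_odd (n := 1)]
        · simp [add_assoc]
      | pred i ih =>
        intro w
        rw [← ih w, ← hR !₂[sg (-(i : ℤ) - 1) * w 0, _, _]]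
        congr 1
        apply E3_ext
        · simp [sub_eq_add_neg, sg_add, sg_neg, sg_of_odd (n := 1)]
        · simp [sub_eq_add_neg, sg_add, sg_neg, sg_of_odd (n := 1)]
        · simp [add_assoc]
    have e : v = !₂[sg c * w 0, sg c * w 1, w 2 + c] + a • !₂[(1 : ℝ), 0, 0] +
        b • !₂[(0 : ℝ), 1, 0] := by
      apply E3_ext <;> simp [h0, h1, h2]
    rw [← h3 c w, e, proj2, p2.zsmul b, p1.zsmul a]

/-! ### Affine homeomorphisms -/

/-- A lower triangular affine transformation. -/
noncomputable def lowerAffine {α β γ : ℝ} (hα : α ≠ 0) (hβ : β ≠ 0) (hγ : γ ≠ 0) (p q r s t : ℝ) :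
    E3 ≃ₜ E3 where
  toFun v := !₂[α * v 0 + s, p * v 0 + β * v 1 + t, q * v 0 + r * v 1 + γ * v 2]
  invFun v := !₂[(v 0 - s) / α, (v 1 - t - p * ((v 0 - s) / α)) / β,
    (v 2 - q * ((v 0 - s) / α) - r * ((v 1 - t - p * ((v 0 - s) / α)) / β)) / γ]
  left_inv v := by
    apply E3_ext
    · simp; field_simp
    · simp; field_simp; ring
    · simp; field_simp; ring
  right_inv v := by
    apply E3_ext
    · simp; field_simp; ring
    · simp; field_simp; ring
    · simp; field_simp; ring
  continuous_toFun := by fun_prop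
  continuous_invFun := by fun_prop

namespace HW

/-- The quotient of Euclidean space by a subgroup. -/
abbrev Quo (K : Subgroup HW) : Type := MulAction.orbitRel.Quotient K E3

theorem nonempty_homeomorph {K : Subgroup HW} {Y : Type*} [TopologicalSpace Y] {g : E3 → Y}
    (hg : IsQuotientMap g) (φ : E3 ≃ₜ E3)
    (h : ∀ v w, (∃ k ∈ K, k • φ w = φ v) ↔ g v = g w) : Nonempty (Quo K ≃ₜ Y) := by
  have hK : IsQuotientMap (Quotient.mk (MulAction.orbitRel K E3)) := isQuotientMap_quotient_mk'
  obtain ⟨ψ, -⟩ := exists_homeomorph_of_fibers (hK.comp φ.isQuotientMap) hg fun v w => by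
    rw [← h]
    exact quotientMk_eq_iff K _ _
  exact ⟨ψ⟩

theorem nonempty_homeomorph_quo {K L : Subgroup HW} (φ : E3 ≃ₜ E3)
    (h : ∀ v w, (∃ k ∈ K, k • φ w = φ v) ↔ ∃ l ∈ L, l • w = v) : Nonempty (Quo K ≃ₜ Quo L) :=
  nonempty_homeomorph isQuotientMap_quotient_mk' φ fun v w => by
    rw [h]
    exact (quotientMk_eq_iff L _ _).symm

end HW
theorem isQuotientMap_proj1 : IsQuotientMap proj1 := isQuotientMap_quotient_mk'

theorem isQuotientMap_proj2 : IsQuotientMap proj2 := isQuotientMap_quotient_mk'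

theorem lowerAffine_zero {α β γ : ℝ} (hα : α ≠ 0) (hβ : β ≠ 0) (hγ : γ ≠ 0) (p q r s t : ℝ)
    (v : E3) : lowerAffine hα hβ hγ p q r s t v 0 = α * v 0 + s := rfl

theorem lowerAffine_one {α β γ : ℝ} (hα : α ≠ 0) (hβ : β ≠ 0) (hγ : γ ≠ 0) (p q r s t : ℝ)
    (v : E3) : lowerAffine hα hβ hγ p q r s t v 1 = p * v 0 + β * v 1 + t := rfl

theorem lowerAffine_two {α β γ : ℝ} (hα : α ≠ 0) (hβ : β ≠ 0) (hγ : γ ≠ 0) (p q r s t : ℝ)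
    (v : E3) : lowerAffine hα hβ hγ p q r s t v 2 = q * v 0 + r * v 1 + γ * v 2 := rfl

/-! ### Homeomorphism types of the quotients. -/

theorem exists_eq_lat {M : AddSubgroup (ℤ × ℤ)} (hM : M.index ≠ 0) :
    ∃ (α β : ℕ) (w : ℤ), α ≠ 0 ∧ β ≠ 0 ∧ M = lat α β w := by
  obtain ⟨α, w, hα, h⟩ := exists_eq_build M hM
  rw [HW.int_subgroup_eq (M.comap _)] at h
  refine ⟨α, _, w, hα, ?_, h⟩
  intro h0
  rw [h, h0, index_build hα] at hM
  simp at hM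

theorem exists_lattice_basis {L : AddSubgroup (ℤ × ℤ × ℤ)} (hL : L.index ≠ 0) :
    ∃ (a b c : ℕ) (p q r : ℤ), a ≠ 0 ∧ b ≠ 0 ∧ c ≠ 0 ∧ ∀ x y z : ℤ, (x, y, z) ∈ L ↔
      ∃ i j k : ℤ, x = i * a ∧ y = i * p + j * b ∧ z = i * q + j * r + k * c := by
  obtain ⟨a, ⟨p, q⟩, ha, h⟩ := exists_eq_build L hL
  set M := L.comap (AddMonoidHom.inr ℤ (ℤ × ℤ))
  have hM : M.index ≠ 0 := by
    rw [h, index_build ha] at hL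
    exact right_ne_zero_of_mul hL
  obtain ⟨b, c, r, hb, hc, hMe⟩ := exists_eq_lat hM
  refine ⟨a, b, c, p, q, r, ha, hb, hc, fun x y z => ?_⟩
  rw [h, mem_build, hMe]
  simp only [Prod.smul_mk, smul_eq_mul, Prod.mk_sub_mk, mem_lat]
  constructor
  · rintro ⟨i, hx, j, hy, k, hz⟩
    exact ⟨i, j, k, hx, by linarith, by linarith⟩
  · rintro ⟨i, j, k, hx, hy, hz⟩
    exact ⟨i, hx, j, by linarith, k, by linarith⟩

namespace HW

theorem IsTorus.nonempty_homeomorph {K : Subgroup HW} (hK : IsTorus K) (hn : K.index ≠ 0) :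
    Nonempty (Quo K ≃ₜ G1) := by
  have hL : (lattice K).index ≠ 0 := by
    rw [hK.index] at hn
    exact right_ne_zero_of_mul hn
  obtain ⟨a, b, c, p, q, r, ha, hb, hc, h⟩ := exists_lattice_basis hL
  have ha' : (2 * a : ℝ) ≠ 0 := by simpa using ha
  have hb' : (2 * b : ℝ) ≠ 0 := by simpa using hb
  have hc' : (2 * c : ℝ) ≠ 0 := by simpa using hc
  -- This affine map takes the standard lattice to the translation vectors of `K`, which are twice
  -- the vectors of `lattice K`.
  refine HW.nonempty_homeomorph isQuotientMap_proj1
    (lowerAffine ha' hb' hc' (2 * p) (2 * q) (2 * r) 0 0) fun v w => ?_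
  rw [proj1_eq_iff]
  simp only [smul_eq_iff, lowerAffine_zero, lowerAffine_one, lowerAffine_two]
  constructor
  · rintro ⟨k, hk, h0, h1, h2⟩
    obtain ⟨⟨x, y, z⟩, rfl⟩ := exists_tr (hK k hk).1 (hK k hk).2
    obtain ⟨i, j, l, rfl, rfl, rfl⟩ := (h x y z).1 hk
    simp only [tr_x, tr_y, tr_z, sg_two_mul] at h0 h1 h2
    push_cast at h0 h1 h2
    have e0 : v 0 = w 0 + i := mul_left_cancel₀ ha' (by linear_combination -h0)
    have e1 : v 1 = w 1 + j := mul_left_cancel₀ hb' (by linear_combination -h1 - 2 * p * e0)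
    have e2 : v 2 = w 2 + l := mul_left_cancel₀ hc' (by
      linear_combination -h2 - 2 * q * e0 - 2 * r * e1)
    exact ⟨i, j, l, e0, e1, e2⟩
  · rintro ⟨i, j, l, e0, e1, e2⟩
    refine ⟨tr (i * a, i * p + j * b, i * q + j * r + l * c),
      (h _ _ _).2 ⟨i, j, l, rfl, rfl, rfl⟩, ?_⟩
    simp only [tr_x, tr_y, tr_z, sg_two_mul, e0, e1, e2]
    push_cast
    refine ⟨?_, ?_, ?_⟩ <;> ring

theorem IsHalfTurn.eq_screwSub {K : Subgroup HW} (hK : IsHalfTurn K) :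
    ∃ p q, K = screwSub (height K) (planar K) p q := by
  obtain ⟨g, hg, p, q, hx, hy, hz⟩ := hK.exists_screw
  have ho := hK.odd_height
  have hS := isHalfTurn_screwSub ho (planar K) p q
  obtain ⟨g', hg', hx', hy', hz'⟩ := exists_mem_screwSub ho (planar K) p q
  obtain rfl : g = g' := HW.ext (by rw [hx, hx']) (by rw [hy, hy']) (by rw [hz, hz'])
  have h1 := height_screwSub ho (planar K) p q
  have h2 := planar_screwSub (height K) (planar K) p q
  exact ⟨p, q, le_antisymm (hK.le_of_mem hS h1.symm h2.symm hg hg' ⟨q, hy⟩)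
    (hS.le_of_mem hK h1 h2 hg' hg ⟨q, hy⟩)⟩

theorem sg_odd_mul {k : ℕ} (hk : Odd k) (c : ℤ) : sg (k * c) = sg c := by
  have hk : Odd (k : ℤ) := by exact_mod_cast hk
  rcases Int.even_or_odd c with hc | hc
  · rw [sg_of_even hc, sg_of_even (hc.mul_left _)]
  · rw [sg_of_odd hc, sg_of_odd (hk.mul hc)]

theorem exists_one_sub_sg (c : ℤ) : ∃ e, 1 - sg c = 2 * e ∧ (Even e ↔ Even c) := by
  rcases Int.even_or_odd c with hc | hc
  · exact ⟨0, by rw [sg_of_even hc]; rfl, by simpa using hc⟩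
  · exact ⟨1, by rw [sg_of_odd hc]; rfl, by simpa using hc⟩

theorem IsHalfTurn.nonempty_homeomorph {K : Subgroup HW} (hK : IsHalfTurn K) (hn : K.index ≠ 0) :
    Nonempty (Quo K ≃ₜ G2) := by
  have hM : (planar K).index ≠ 0 := by
    rw [hK.index_eq] at hn
    exact right_ne_zero_of_mul (right_ne_zero_of_mul hn)
  have hk := hK.odd_height
  obtain ⟨p, q, hS⟩ := hK.eq_screwSub
  obtain ⟨a, b, r, ha, hb, hlat⟩ := exists_eq_lat hM
  rw [hlat] at hS
  set k := height K
  rw [hS]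
  have ha' : (2 * a : ℝ) ≠ 0 := by simpa using ha
  have hb' : (2 * b : ℝ) ≠ 0 := by simpa using hb
  have hk' : (k : ℝ) ≠ 0 := by exact_mod_cast hk.pos.ne'
  -- The translation part `(p, q + 1/2)` puts the axis of the screw `(2 * p, 2 * q + 1, k)` in place
  -- of the standard axis, and the third coordinate is stretched to the height `k`.
  refine HW.nonempty_homeomorph isQuotientMap_proj2
    (lowerAffine ha' hb' hk' (2 * r) 0 0 p ((2 * q + 1) / 2)) fun v w => ?_
  rw [proj2_eq_iff]
  simp only [smul_eq_iff, lowerAffine_zero, lowerAffine_one, lowerAffine_two, zero_mul, zero_add]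
  constructor
  · rintro ⟨g, hg, h0, h1, h2⟩
    have hgx := (isHalfTurn_screwSub hk (lat a b r) p q).1 g hg
    obtain ⟨⟨c, hc⟩, x, y, hxy, hx, hy⟩ := hg
    obtain ⟨i, rfl, j, hj⟩ := mem_lat.1 hxy
    have hs : sg g.y = sg c := by rw [← sg_z_of_even hgx, hc, sg_odd_mul hk]
    rw [sg_z_of_even hgx] at h1
    rw [sg_of_even hgx] at h2
    rw [hs] at hx hy h0 h1
    have hx' : (g.x : ℝ) = 2 * (i * a) + (1 - sg c) * p := by exact_mod_cast hx
    have hy' : (2 * g.y : ℝ) = 4 * y + (1 - sg c) * (2 * q + 1) := by exact_mod_cast hy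
    have hz' : (g.z : ℝ) = k * c := by exact_mod_cast hc
    have hj' : (y - i * r : ℝ) = b * j := by exact_mod_cast hj
    have e0 : v 0 = sg c * w 0 + i := mul_left_cancel₀ ha' (by linear_combination -h0 + hx')
    have e1 : v 1 = sg c * w 1 + j := mul_left_cancel₀ hb' (by
      linear_combination -h1 + hy' / 2 - 2 * r * e0 + 2 * hj')
    have e2 : v 2 = w 2 + c := mul_left_cancel₀ hk' (by
      push_cast at h2
      linear_combination -h2 + hz')
    exact ⟨i, j, c, e0, e1, e2⟩
  · rintro ⟨i, j, c, e0, e1, e2⟩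
    obtain ⟨e, he, hec⟩ := exists_one_sub_sg c
    have hsy : sg (2 * (i * r + b * j) + e * (2 * q + 1)) = sg c := by
      have : Even (2 * (i * r + b * j) + e * (2 * q + 1)) ↔ Even c := by
        rw [← hec]
        simp [Int.even_add, Int.even_mul]
      rcases Int.even_or_odd c with hc | hc
      · rw [sg_of_even hc, sg_of_even (this.2 hc)]
      · rw [sg_of_odd hc, sg_of_odd (Int.not_even_iff_odd.1 (by rwa [this, Int.not_even_iff_odd]))]
    have hsx : sg (2 * (i * a) + 2 * e * p) = 1 := sg_of_even ⟨i * a + e * p, by ring⟩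
    have hko : Odd (k : ℤ) := by exact_mod_cast hk
    have he' : (1 - sg c : ℝ) = 2 * e := by exact_mod_cast he
    refine ⟨⟨2 * (i * a) + 2 * e * p, 2 * (i * r + b * j) + e * (2 * q + 1), k * c, ?_⟩,
      ⟨dvd_mul_right _ _, i * a, i * r + b * j, mem_lat.2 ⟨i, rfl, j, by ring⟩, ?_, ?_⟩, ?_⟩
    · simp only [Int.even_add, Int.even_mul, hec, Int.not_even_iff_odd.2 hko]
      simp
    · dsimp only
      rw [hsy, he]
    · dsimp only
      rw [hsy, he]
      ring
    · dsimp only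
      rw [hsy, sg_odd_mul hk, hsx, e0, e1, e2]
      push_cast
      refine ⟨?_, ?_, ?_⟩
      · linear_combination (-(p : ℝ)) * he'
      · linear_combination (-(2 * q + 1 : ℝ) / 2) * he'
      · ring

/-- The cyclic permutation of the coordinates of Euclidean space. -/
noncomputable def cycleE3 : E3 ≃ₜ E3 where
  toFun v := !₂[v 1, v 2, v 0]
  invFun v := !₂[v 2, v 0, v 1]
  left_inv v := E3_ext rfl rfl rfl
  right_inv v := E3_ext rfl rfl rfl
  continuous_toFun := by fun_prop
  continuous_invFun := by fun_prop

theorem nonempty_homeomorph_rotate (K : Subgroup HW) : Nonempty (Quo (rotate K) ≃ₜ Quo K) := by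
  refine nonempty_homeomorph_quo cycleE3 fun v w => ?_
  rw [exists_mem_rotate]
  refine exists_congr fun k => and_congr_right fun _ => ?_
  have : rot k • cycleE3 w = cycleE3 (k • w) := by
    apply E3_ext
    · rw [smul_zero_apply]
      exact (smul_one_apply k w).symm
    · rw [smul_one_apply]
      exact (smul_two_apply k w).symm
    · rw [smul_two_apply]
      exact (smul_zero_apply k w).symm
  rw [this, cycleE3.injective.eq_iff]

/-- An element of the group as a homeomorphism of Euclidean space. -/
noncomputable def smulHomeo (h : HW) : E3 ≃ₜ E3 := (motionOf h).toHomeomorph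

theorem nonempty_homeomorph_conj (h : HW) (K : Subgroup HW) :
    Nonempty (Quo (ConjAct.toConjAct h • K) ≃ₜ Quo K) := by
  refine nonempty_homeomorph_quo (smulHomeo h) fun v w => ?_
  change (∃ k ∈ _, k • h • w = h • v) ↔ _
  constructor
  · rintro ⟨_, ⟨k, hk, rfl⟩, e⟩
    change (h * k * h⁻¹) • h • w = h • v at e
    rw [mul_smul, inv_smul_smul, mul_smul, smul_left_cancel_iff] at e
    exact ⟨k, hk, e⟩
  · rintro ⟨k, hk, rfl⟩
    exact ⟨_, mem_conj.2 ⟨k, hk, rfl⟩, by rw [mul_smul, inv_smul_smul, mul_smul]⟩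

/-- Scaling the coordinates by odd numbers preserves all parities, hence the signs and the condition
on the sum. So it conjugates the whole group onto `diagSub a b c`. -/
theorem nonempty_homeomorph_diagSub {a b c : ℕ} (ha : Odd a) (hb : Odd b) (hc : Odd c) :
    Nonempty (Quo (diagSub a b c) ≃ₜ G6) := by
  have ha' : (a : ℝ) ≠ 0 := by exact_mod_cast ha.pos.ne'
  have hb' : (b : ℝ) ≠ 0 := by exact_mod_cast hb.pos.ne'
  have hc' : (c : ℝ) ≠ 0 := by exact_mod_cast hc.pos.ne'
  refine HW.nonempty_homeomorph isQuotientCoveringMap_proj6.toIsQuotientMap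
    (lowerAffine ha' hb' hc' 0 0 0 0 0) fun v w => ?_
  rw [proj6_eq_iff]
  change _ ↔ ∃ g : HW, g • w = v
  simp only [smul_eq_iff, lowerAffine_zero, lowerAffine_one, lowerAffine_two, zero_mul, zero_add,
    add_zero]
  have hpar : ∀ x y z : ℤ, Even (a * x + b * y + c * z) ↔ Even (x + y + z) := by
    intro x y z
    have ha : ¬ Even (a : ℤ) := by exact_mod_cast Nat.not_even_iff_odd.2 ha
    have hb : ¬ Even (b : ℤ) := by exact_mod_cast Nat.not_even_iff_odd.2 hb
    have hc : ¬ Even (c : ℤ) := by exact_mod_cast Nat.not_even_iff_odd.2 hc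
    simp only [Int.even_add, Int.even_mul, ha, hb, hc, false_or]
  constructor
  · rintro ⟨⟨_, _, _, he⟩, ⟨⟨x, rfl⟩, ⟨y, rfl⟩, z, rfl⟩, h0, h1, h2⟩
    dsimp only at h0 h1 h2
    rw [sg_odd_mul ha] at h2
    rw [sg_odd_mul hb] at h0
    rw [sg_odd_mul hc] at h1
    push_cast at h0 h1 h2
    exact ⟨⟨x, y, z, (hpar x y z).1 he⟩, mul_left_cancel₀ ha' (by linear_combination h0),
      mul_left_cancel₀ hb' (by linear_combination h1),
      mul_left_cancel₀ hc' (by linear_combination h2)⟩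
  · rintro ⟨⟨x, y, z, he⟩, h0, h1, h2⟩
    refine ⟨⟨a * x, b * y, c * z, (hpar x y z).2 he⟩,
      ⟨dvd_mul_right _ _, dvd_mul_right _ _, dvd_mul_right _ _⟩, ?_⟩
    dsimp only at h0 h1 h2 ⊢
    rw [sg_odd_mul ha, sg_odd_mul hb, sg_odd_mul hc, ← h0, ← h1, ← h2]
    push_cast
    refine ⟨?_, ?_, ?_⟩ <;> ring

theorem IsFull.nonempty_homeomorph {K : Subgroup HW} (hK : IsFull K) : Nonempty (Quo K ≃ₜ G6) := by
  obtain ⟨h, hh⟩ := hK.exists_conj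
  obtain ⟨φ⟩ := nonempty_homeomorph_conj h K
  obtain ⟨ψ⟩ := nonempty_homeomorph_diagSub hK.odd_axisIdx hK.rotate.odd_axisIdx
    hK.rotate.rotate.odd_axisIdx
  rw [← hh] at ψ
  exact ⟨φ.symm.trans ψ⟩

theorem IsHalfTurnType.nonempty_homeomorph {K : Subgroup HW} (hK : IsHalfTurnType K)
    (hn : K.index ≠ 0) : Nonempty (Quo K ≃ₜ G2) := by
  obtain ⟨φ⟩ := nonempty_homeomorph_rotate K
  obtain ⟨ψ⟩ := nonempty_homeomorph_rotate (HW.rotate K)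
  rcases hK with hK | hK | hK
  · exact hK.nonempty_homeomorph hn
  · obtain ⟨χ⟩ := hK.nonempty_homeomorph (by rwa [index_rotate])
    exact ⟨φ.symm.trans χ⟩
  · obtain ⟨χ⟩ := hK.nonempty_homeomorph (by rwa [index_rotate, index_rotate])
    exact ⟨φ.symm.trans (ψ.symm.trans χ)⟩

/-! ### Isomorphism types of the subgroups -/

theorem nonempty_fundamentalGroup_quo {K : Subgroup HW} {Y : Type} [TopologicalSpace Y]
    (φ : Quo K ≃ₜ Y) (y : Y) : Nonempty (FundamentalGroup Y y ≃* K) :=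
  nonempty_fundamentalGroup_mulEquiv
    ((isQuotientCoveringMap_quotientMk isQuotientCoveringMap_proj6 K).homeomorph_comp φ) y

/-- The existence of a nontrivial central element. -/
def HasCenter (G : Type*) [Group G] : Prop := ∃ z : G, z ≠ 1 ∧ ∀ g, g * z = z * g

theorem hasCenter_congr {G H : Type*} [Group G] [Group H] (e : G ≃* H) (h : HasCenter G) :
    HasCenter H := by
  obtain ⟨z, hz, hc⟩ := h
  refine ⟨e z, fun h => hz (e.map_eq_one_iff.1 h), fun g => ?_⟩
  rw [← e.apply_symm_apply g, ← map_mul, hc, map_mul]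

/-- Commutativity as a property of a group. -/
def IsComm (G : Type*) [Group G] : Prop := ∀ g h : G, g * h = h * g

theorem isComm_congr {G H : Type*} [Group G] [Group H] (e : G ≃* H) (h : IsComm G) :
    IsComm H := by
  intro x y
  rw [← e.apply_symm_apply x, ← e.apply_symm_apply y, ← map_mul, h, map_mul]

theorem exists_tr_mem {K : Subgroup HW} (hn : K.index ≠ 0) (u : ℤ × ℤ × ℤ) :
    ∃ m : ℤ, m ≠ 0 ∧ tr (m • u) ∈ K := by
  obtain ⟨m, hm, -, h⟩ := Subgroup.exists_pow_mem_of_index_ne_zero hn (tr u)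
  refine ⟨m, by omega, ?_⟩
  rwa [← tr_zpow, zpow_natCast]

theorem mul_comm_iff_conj {G : Type*} [Group G] {g h : G} : g * h = h * g ↔ g * h * g⁻¹ = h :=
  mul_inv_eq_iff_eq_mul.symm

theorem IsTorus.isComm {K : Subgroup HW} (hK : IsTorus K) : IsComm K := by
  rintro ⟨g, hg⟩ ⟨h, hh⟩
  obtain ⟨u, rfl⟩ := exists_tr (hK g hg).1 (hK g hg).2
  obtain ⟨v, rfl⟩ := exists_tr (hK h hh).1 (hK h hh).2
  apply Subtype.ext
  change tr u * tr v = tr v * tr u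
  rw [← tr_add, ← tr_add, add_comm]

/-- No element reverses the third axis, so vertical translations are central, and finite index
guarantees a nontrivial one. -/
theorem hasCenter_of_even_x {K : Subgroup HW} (hK : ∀ g ∈ K, Even g.x) (hn : K.index ≠ 0) :
    HasCenter K := by
  obtain ⟨m, hm, h⟩ := exists_tr_mem hn (0, 0, 1)
  have e : m • ((0, 0, 1) : ℤ × ℤ × ℤ) = (0, 0, m) := by simp
  rw [e] at h
  refine ⟨⟨_, h⟩, ?_, ?_⟩
  · intro h1
    have := congrArg HW.z (congrArg Subtype.val h1)
    simp [hm] at this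
  · rintro ⟨g, hg⟩
    apply Subtype.ext
    change g * tr (0, 0, m) = tr (0, 0, m) * g
    rw [mul_comm_iff_conj, conj_tr, sg_of_even (hK g hg)]
    simp

theorem IsHalfTurn.not_isComm {K : Subgroup HW} (hK : IsHalfTurn K) (hn : K.index ≠ 0) :
    ¬ IsComm K := by
  intro h
  obtain ⟨m, hm, ht⟩ := exists_tr_mem hn (1, 0, 0)
  obtain ⟨g, hg, hz⟩ := hK.2
  have e : m • ((1, 0, 0) : ℤ × ℤ × ℤ) = (m, 0, 0) := by simp
  rw [e] at ht
  have h1 : g * tr (m, 0, 0) = tr (m, 0, 0) * g := congrArg Subtype.val (h ⟨g, hg⟩ ⟨_, ht⟩)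
  rw [mul_comm_iff_conj, conj_tr, sg_of_odd ((hK.odd_y_iff hg).2 hz)] at h1
  have := congrArg HW.x h1
  simp only [tr_x] at this
  omega

/-- A central element commutes with translations along the first two axes, so it reverses neither
and is itself a translation. Every coordinate of its vector is negated by some screw motion in `K`,
hence vanishes. -/
theorem IsFull.not_hasCenter {K : Subgroup HW} (hK : IsFull K) (hn : K.index ≠ 0) :
    ¬ HasCenter K := by
  rintro ⟨⟨z, hz⟩, hz1, hc⟩
  have hcomm : ∀ g ∈ K, z * g * z⁻¹ = g := fun g hg =>
    mul_comm_iff_conj.1 (congrArg Subtype.val (hc ⟨g, hg⟩)).symm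
  have hcomm' : ∀ g ∈ K, g * z * g⁻¹ = z := fun g hg =>
    mul_comm_iff_conj.1 (congrArg Subtype.val (hc ⟨g, hg⟩))
  have hsg : ∀ n m : ℤ, m ≠ 0 → 2 * (sg n * m) = 2 * m → Even n := by
    intro n m hm h
    by_contra hn
    rw [sg_of_odd (Int.not_even_iff_odd.1 hn)] at h
    omega
  have hzy : Even z.y := by
    obtain ⟨m, hm, ht⟩ := exists_tr_mem hn (1, 0, 0)
    have h1 := congrArg HW.x (hcomm _ ht)
    simp only [Prod.smul_mk, smul_eq_mul, conj_tr, tr_x, mul_one] at h1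
    exact hsg _ m hm h1
  have hzz : Even z.z := by
    obtain ⟨m, hm, ht⟩ := exists_tr_mem hn (0, 1, 0)
    have h1 := congrArg HW.y (hcomm _ ht)
    simp only [Prod.smul_mk, smul_eq_mul, conj_tr, tr_y, mul_one] at h1
    exact hsg _ m hm h1
  have hzx : Even z.x := by
    have := z.even
    simp only [Int.even_add] at this
    tauto
  obtain ⟨⟨a, b, c⟩, rfl⟩ := exists_tr hzx hzy
  obtain ⟨⟨g, hg, hgx, hgy⟩, k, hk, hkx, hky⟩ := hK
  have hgz : Odd g.z := by
    have := g.even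
    simp only [Int.even_add, ← Int.not_even_iff_odd] at *
    tauto
  have h1 := hcomm' g hg
  have h2 := hcomm' k hk
  rw [conj_tr, HW.ext_iff, sg_of_odd hgx, sg_of_odd hgz] at h1
  rw [conj_tr, HW.ext_iff, sg_of_odd hky] at h2
  simp only [tr_x, tr_y, tr_z] at h1 h2
  apply hz1
  apply Subtype.ext
  ext
  · change 2 * a = 0
    omega
  · change 2 * b = 0
    omega
  · change 2 * c = 0
    omega

/-- The restriction of the cyclic permutation of coordinates to a subgroup. -/
noncomputable def rotateEquiv (K : Subgroup HW) : K ≃* rotate K :=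
  K.equivMapOfInjective _ rot.injective

theorem IsHalfTurnType.hasCenter {K : Subgroup HW} (hK : IsHalfTurnType K) (hn : K.index ≠ 0) :
    HasCenter K := by
  rcases hK with hK | hK | hK
  · exact hasCenter_of_even_x hK.1 hn
  · exact hasCenter_congr (rotateEquiv K).symm (hasCenter_of_even_x hK.1 (by rwa [index_rotate]))
  · exact hasCenter_congr ((rotateEquiv K).trans (rotateEquiv _)).symm
      (hasCenter_of_even_x hK.1 (by rwa [index_rotate, index_rotate]))

theorem IsHalfTurnType.not_isComm {K : Subgroup HW} (hK : IsHalfTurnType K) (hn : K.index ≠ 0) :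
    ¬ IsComm K := by
  intro h
  rcases hK with hK | hK | hK
  · exact hK.not_isComm hn h
  · exact hK.not_isComm (by rwa [index_rotate]) (isComm_congr (rotateEquiv K) h)
  · exact hK.not_isComm (by rwa [index_rotate, index_rotate])
      (isComm_congr ((rotateEquiv K).trans (rotateEquiv _)) h)

/-- Commutativity and the existence of a nontrivial central element separate the three types, here
and in the next two lemmas. -/
theorem isTorus_of_mulEquiv {K L : Subgroup HW} (hK : K.index ≠ 0) (hL : L.index ≠ 0)
    (hT : IsTorus L) (e : K ≃* L) : IsTorus K := by
  rcases type_cases K with h | h | h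
  · exact h
  · exact absurd (isComm_congr e.symm hT.isComm) (IsHalfTurnType.not_isComm h hK)
  · exact absurd (hasCenter_congr e.symm (hasCenter_of_even_x (fun g hg => (hT g hg).1) hL))
      (h.not_hasCenter hK)

theorem isHalfTurnType_of_mulEquiv {K L : Subgroup HW} (hK : K.index ≠ 0) (hL : L.index ≠ 0)
    (hT : IsHalfTurnType L) (e : K ≃* L) : IsHalfTurnType K := by
  rcases type_cases K with h | h | h
  · exact absurd (isComm_congr e h.isComm) (hT.not_isComm hL)
  · exact h
  · exact absurd (hasCenter_congr e.symm (hT.hasCenter hL)) (h.not_hasCenter hK)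

theorem isFull_of_mulEquiv {K L : Subgroup HW} (hK : K.index ≠ 0) (hL : L.index ≠ 0)
    (hT : IsFull L) (e : K ≃* L) : IsFull K := by
  rcases type_cases K with h | h | h
  · exact absurd (hasCenter_congr e (hasCenter_of_even_x (fun g hg => (h g hg).1) hK))
      (hT.not_hasCenter hL)
  · exact absurd (hasCenter_congr e (IsHalfTurnType.hasCenter h hK)) (hT.not_hasCenter hL)
  · exact h

/-- Coverings and conjugacy classes of a given type are counted by the subgroups of that type. -/
theorem counts_eq {T : Subgroup HW → Prop} {Y : Type} [TopologicalSpace Y]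
    (hT : ∀ K, K.index ≠ 0 → T K → Nonempty (Quo K ≃ₜ Y))
    {L : Subgroup HW} (hL : L.index ≠ 0) (hTL : T L)
    (hiso : ∀ {K : Subgroup HW}, K.index ≠ 0 → ∀ _ : K ≃* L, T K) {n : ℕ} (hn : n ≠ 0) :
    numCoverings.{u} Y G6 n = (classesOf fun K => K.index = n ∧ T K).encard ∧
      ∀ (x : Y) (y : G6), numConjClasses (FundamentalGroup Y x) (FundamentalGroup G6 y) n =
        (classesOf fun K => K.index = n ∧ T K).encard := by
  obtain ⟨φ⟩ := hT L hL hTL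
  constructor
  · rw [numCoverings_eq_encard_classesOf isQuotientCoveringMap_proj6 hn Y]
    congr 2
    funext K
    refine propext (and_congr_right fun hK => ⟨fun ⟨ψ⟩ => ?_, hT K (hK ▸ hn)⟩)
    -- If the quotient by `K` is also homeomorphic to `Y`, then `K` and the model `L` are both the
    -- fundamental group of `Y`, and the type passes from `L` to `K`.
    obtain ⟨x⟩ : Nonempty (Quo K) := ⟨Quotient.mk _ 0⟩
    obtain ⟨e⟩ := nonempty_fundamentalGroup_quo ψ (ψ x)
    obtain ⟨e'⟩ := nonempty_fundamentalGroup_quo φ (ψ x)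
    exact hiso (hK ▸ hn) (e.symm.trans e')
  · intro x y
    obtain ⟨e⟩ := nonempty_fundamentalGroup_quo φ x
    obtain ⟨g⟩ := nonempty_fundamentalGroup_mulEquiv isQuotientCoveringMap_proj6 y
    rw [numConjClasses_eq_encard_classesOf e g]
    congr 2
    funext K
    refine propext (and_congr_right fun hK => ⟨fun ⟨ψ⟩ => hiso (hK ▸ hn) ψ, fun h => ?_⟩)
    obtain ⟨χ⟩ := hT K (hK ▸ hn) h
    obtain ⟨e'⟩ := nonempty_fundamentalGroup_quo χ x
    exact ⟨e'.symm.trans e⟩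

theorem nonempty_homeomorph_of_covering {n : ℕ} (hn : n ≠ 0) (C : FiniteCovering.{u} G6 n) :
    Nonempty (C.Space ≃ₜ G6) ∨ Nonempty (C.Space ≃ₜ G2) ∨ Nonempty (C.Space ≃ₜ G1) := by
  obtain ⟨K, hK, ⟨φ⟩⟩ := exists_homeomorph_quotient_of_covering isQuotientCoveringMap_proj6 C
  rcases type_cases K with h | h | h
  · exact Or.inr (Or.inr ((h.nonempty_homeomorph (hK ▸ hn)).map φ.trans))
  · exact Or.inr (Or.inl ((IsHalfTurnType.nonempty_homeomorph h (hK ▸ hn)).map φ.trans))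
  · exact Or.inl (h.nonempty_homeomorph.map φ.trans)

end HW
end HantzscheWendt

/-! ### Assembly of the three counts. -/

open HantzscheWendt

theorem theorem2 (n : ℕ) (hn : 0 < n) :
    -- the possible total spaces of connected `n`-fold coverings
    (∀ C : FiniteCovering.{u} G6 n,
      Nonempty (C.Space ≃ₜ G6) ∨ Nonempty (C.Space ≃ₜ G2) ∨ Nonempty (C.Space ≃ₜ G1)) ∧
    -- coverings by the three-torus
    (∃ k : ℕ, numCoverings.{u} G1 G6 n = k ∧
      (∀ (x : G1) (y : G6), numConjClasses (FundamentalGroup G1 x) (FundamentalGroup G6 y) n = k) ∧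
      (k : ℚ) = 1 / 4 * atQuot omega n 4 + 3 / 4 * atQuot sigma2 n 4
        + 9 / 4 * atQuot sigma2 n 8) ∧
    -- coverings by the half-turn manifold
    (∃ k : ℕ, numCoverings.{u} G2 G6 n = k ∧
      (∀ (x : G2) (y : G6), numConjClasses (FundamentalGroup G2 x) (FundamentalGroup G6 y) n = k) ∧
      (k : ℚ) = 3 / 2 * (atQuot sigma2 n 2 + 2 * atQuot sigma2 n 4 - 3 * atQuot sigma2 n 8
        + atQuot d3 n 2 - atQuot d3 n 4 - 3 * atQuot d3 n 8 + 5 * atQuot d3 n 16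
        - 2 * atQuot d3 n 32)) ∧
    -- coverings by the Hantzsche–Wendt manifold itself
    (∃ k : ℕ, numCoverings.{u} G6 G6 n = k ∧
      (∀ (x : G6) (y : G6), numConjClasses (FundamentalGroup G6 x) (FundamentalGroup G6 y) n = k) ∧
      (k : ℚ) = d3 n - 3 * atQuot d3 n 2 + 3 * atQuot d3 n 4 - atQuot d3 n 8 ∧
      {t : ℕ × ℕ × ℕ | Odd t.1 ∧ Odd t.2.1 ∧ Odd t.2.2 ∧ t.1 * t.2.1 * t.2.2 = n}.encard = k) := by
  have hn' : n ≠ 0 := hn.ne'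
  refine ⟨HW.nonempty_homeomorph_of_covering hn', ?_, ?_, ?_⟩
  · obtain ⟨k, hk, hk'⟩ := HW.exists_encard_classesOf_isTorus hn'
    -- The group of all translations serves as the model of torus type; the other two cases likewise
    -- use `screwSub 1 ⊤ 0 0` and `diagSub 1 1 1`.
    have hT := HW.isTorus_torusSub ⊤
    have hi : (HW.torusSub ⊤).index ≠ 0 := by
      rw [hT.index, HW.lattice_torusSub, AddSubgroup.index_top]
      decide
    obtain ⟨h1, h2⟩ := HW.counts_eq.{u} (T := HW.IsTorus) (Y := G1)
      (fun K hK h => h.nonempty_homeomorph hK) hi hT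
      (fun hK e => HW.isTorus_of_mulEquiv hK hi hT e) hn'
    rw [hk] at h1 h2
    exact ⟨k, h1, h2, hk'⟩
  · obtain ⟨k, hk, hk'⟩ := HW.exists_encard_classesOf_isHalfTurnType hn'
    have hT := HW.isHalfTurn_screwSub odd_one ⊤ 0 0
    have hi : (HW.screwSub 1 ⊤ 0 0).index ≠ 0 := by
      rw [hT.index_eq, HW.height_screwSub odd_one, HW.planar_screwSub, AddSubgroup.index_top]
      decide
    obtain ⟨h1, h2⟩ := HW.counts_eq.{u} (T := HW.IsHalfTurnType) (Y := G2)
      (fun K hK h => h.nonempty_homeomorph hK) hi (Or.inl hT)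
      (fun hK e => HW.isHalfTurnType_of_mulEquiv hK hi (Or.inl hT) e) hn'
    rw [hk] at h1 h2
    exact ⟨k, h1, h2, hk'⟩
  · obtain ⟨k, hk, hk'⟩ := encard_oddTriples hn'
    have hT := HW.isFull_diagSub odd_one odd_one odd_one
    have hi : (HW.diagSub 1 1 1).index ≠ 0 := by
      rw [HW.index_diagSub odd_one odd_one odd_one]
      decide
    obtain ⟨h1, h2⟩ := HW.counts_eq.{u} (T := HW.IsFull) (Y := G6)
      (fun K _ h => h.nonempty_homeomorph) hi hT
      (fun hK e => HW.isFull_of_mulEquiv hK hi hT e) hn'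
    rw [HW.encard_classesOf_isFull, hk] at h1 h2
    exact ⟨k, h1, h2, hk', hk⟩
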